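/- Consider finite simple undirected graphs and the following two reductions of a graph $G$. - **D3a.** Let $p,q,r$ be three vertices of degree three that induce a triangle in $G$ and whose neighbors outside $\{p,q,r\}$ are all distinct. Replace $p,q,r$ by a single new vertex adjacent to the same three outside neighbors. - **D3b.** Let $p,q,r$ be three vertices of degree three that induce a path in $G$ with middle vertex $q$, and suppose that there is a vertex $s$ adjacent to all three of $p,q,r$. Delete $q$ and add the edge $pr$. A graph is *D3-reducible* if some (possibly empty) sequence of these reductions transforms it into a graph isomorphic to the complete graph $K_4$. **Theorem.** D3-reducible graphs can be recognized in linear time: there are a program for a random access machine (with unit-cost operations on words) and a constant $c$ such that, for every graph $G$ with vertex set $\{0,\dots,n-1\}$ and $m$ edges, given by adjacency lists (with each list in arbitrary order, and all lists stored consecutively in memory after $n$ and a table of their start addresses, so that the input consists of $N = n+2+2m$ words), the program halts after at most $c\,(n+1)$ time units, with output $1$ if $G$ is D3-reducible and output $0$ if it is not. The program works on every machine whose words can hold all natural numbers less than $cN$; thus words of $O(\log N)$ bits suffice. -/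

import Mathlib

/-! ### D3 reductions -/

namespace D3

/-- `v` has degree three. -/
def DegThree {V : Type} (G : SimpleGraph V) (v : V) : Prop :=
  (G.neighborSet v).ncard = 3

/-- The precondition of rule D3a: `p`, `q`, `r` are degree-three vertices that induce a triangle
and whose neighbors outside `{p, q, r}` are all distinct. -/
structure CanA {V : Type} (G : SimpleGraph V) (p q r : V) : Prop where
  deg_p : DegThree G p
  deg_q : DegThree G q
  deg_r : DegThree G r
  adj_pq : G.Adj p q
  adj_qr : G.Adj q r
  adj_pr : G.Adj p r
  distinct_pq : Disjoint (G.neighborSet p \ {p, q, r}) (G.neighborSet q \ {p, q, r})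
  distinct_qr : Disjoint (G.neighborSet q \ {p, q, r}) (G.neighborSet r \ {p, q, r})
  distinct_pr : Disjoint (G.neighborSet p \ {p, q, r}) (G.neighborSet r \ {p, q, r})

/-- Adjacency after rule D3a; `none` is the new vertex that replaces `p`, `q`, `r`. -/
def adjA {V : Type} (G : SimpleGraph V) (p q r : V) :
    Option {v : V // v ≠ p ∧ v ≠ q ∧ v ≠ r} → Option {v : V // v ≠ p ∧ v ≠ q ∧ v ≠ r} → Prop
  | none, none => False
  | none, some v => G.Adj p v ∨ G.Adj q v ∨ G.Adj r v
  | some u, none => G.Adj p u ∨ G.Adj q u ∨ G.Adj r u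
  | some u, some v => G.Adj u v

/-- The result of rule D3a: `p`, `q`, `r` are replaced by a single new vertex with the same
outside neighbors. -/
def resultA {V : Type} (G : SimpleGraph V) (p q r : V) :
    SimpleGraph (Option {v : V // v ≠ p ∧ v ≠ q ∧ v ≠ r}) where
  Adj := adjA G p q r
  symm := ⟨by
    rintro (_ | u) (_ | v) h
    · exact h
    · exact h
    · exact h
    · exact G.adj_symm h⟩
  loopless := ⟨by
    rintro (_ | u) h
    · exact h
    · exact G.irrefl h⟩

/-- The precondition of rule D3b: `p`, `q`, `r` are degree-three vertices that induce a path with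
middle vertex `q`, and some vertex `s` (the apex) is adjacent to all three of them. -/
structure CanB {V : Type} (G : SimpleGraph V) (p q r : V) : Prop where
  deg_p : DegThree G p
  deg_q : DegThree G q
  deg_r : DegThree G r
  adj_pq : G.Adj p q
  adj_qr : G.Adj q r
  ne_pr : p ≠ r
  not_adj_pr : ¬ G.Adj p r
  apex : ∃ s : V, G.Adj s p ∧ G.Adj s q ∧ G.Adj s r

/-- The result of rule D3b: `q` is deleted and the edge `pr` is added. -/
def resultB {V : Type} (G : SimpleGraph V) (p q r : V) : SimpleGraph {v : V // v ≠ q} :=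
  (G ⊔ SimpleGraph.edge p r).induce {v : V | v ≠ q}

/-- A graph together with its vertex set. -/
abbrev Graph : Type 1 := Σ V : Type, SimpleGraph V

/-- One D3 reduction. -/
inductive Step : Graph → Graph → Prop
  | d3a {V : Type} (G : SimpleGraph V) (p q r : V) (h : CanA G p q r) :
      Step ⟨V, G⟩ ⟨_, resultA G p q r⟩
  | d3b {V : Type} (G : SimpleGraph V) (p q r : V) (h : CanB G p q r) :
      Step ⟨V, G⟩ ⟨_, resultB G p q r⟩

/-- A graph is D3-reducible if some (possibly empty) sequence of D3 reductions turns it into a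
complete graph on four vertices. -/
def Reducible {V : Type} (G : SimpleGraph V) : Prop :=
  ∃ H : Graph, Relation.ReflTransGen Step ⟨V, G⟩ H ∧
    Nonempty (H.2 ≃g (⊤ : SimpleGraph (Fin 4)))

end D3

/-! ### A random access machine with unit-cost operations on bounded words -/

namespace RAM

/-- A memory state: registers `0, 1, 2, …` (a program mentions finitely many of them) and a random
access memory. -/
structure State where
  reg : ℕ → ℕ
  mem : ℕ → ℕ

/-- Expressions. `load a` reads the memory cell with address `a`; `sub` is truncated subtraction;
`lt` and `eq` return `1` for true and `0` for false. -/
inductive Expr : Type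
  | const (k : ℕ)
  | reg (i : ℕ)
  | load (a : Expr)
  | add (a b : Expr)
  | sub (a b : Expr)
  | lt (a b : Expr)
  | eq (a b : Expr)

/-- The value of an expression. -/
def Expr.val (σ : State) : Expr → ℕ
  | const k => k
  | reg i => σ.reg i
  | load a => σ.mem (a.val σ)
  | add a b => a.val σ + b.val σ
  | sub a b => a.val σ - b.val σ
  | lt a b => if a.val σ < b.val σ then 1 else 0
  | eq a b => if a.val σ = b.val σ then 1 else 0

/-- All values (addresses included) that occur in the evaluation of the expression fit in a machine
word, i.e. are less than `W`. -/
def Expr.Fits (W : ℕ) (σ : State) : Expr → Prop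
  | const k => k < W
  | reg i => σ.reg i < W
  | load a => a.Fits W σ ∧ σ.mem (a.val σ) < W
  | add a b => a.Fits W σ ∧ b.Fits W σ ∧ a.val σ + b.val σ < W
  | sub a b => a.Fits W σ ∧ b.Fits W σ
  | lt a b => a.Fits W σ ∧ b.Fits W σ ∧ 1 < W
  | eq a b => a.Fits W σ ∧ b.Fits W σ ∧ 1 < W

/-- The time to evaluate an expression: one unit per operation. -/
def Expr.cost : Expr → ℕ
  | const _ => 1
  | reg _ => 1
  | load a => a.cost + 1
  | add a b => a.cost + b.cost + 1
  | sub a b => a.cost + b.cost + 1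
  | lt a b => a.cost + b.cost + 1
  | eq a b => a.cost + b.cost + 1

/-- Programs. Conditions are true when their value is nonzero. -/
inductive Prog : Type
  /-- do nothing -/
  | skip
  /-- register `i` receives the value of `e` -/
  | assign (i : ℕ) (e : Expr)
  /-- the memory cell with address `a` receives the value of `e` -/
  | store (a e : Expr)
  /-- sequential composition -/
  | seq (c d : Prog)
  /-- if `e` then `c` else `d` -/
  | cond (e : Expr) (c d : Prog)
  /-- while `e` do `c` -/
  | loop (e : Expr) (c : Prog)

/-- `Exec W c σ t τ`: on a machine whose words hold the numbers less than `W`, the program `c`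
started in state `σ` halts in state `τ` after exactly `t` time units. A program that tries to
compute a value that does not fit in a word fails, i.e. has no halting run. -/
inductive Exec (W : ℕ) : Prog → State → ℕ → State → Prop
  | skip (σ : State) : Exec W .skip σ 1 σ
  | assign (i : ℕ) (e : Expr) (σ : State) (he : e.Fits W σ) :
      Exec W (.assign i e) σ (e.cost + 1) { σ with reg := Function.update σ.reg i (e.val σ) }
  | store (a e : Expr) (σ : State) (ha : a.Fits W σ) (he : e.Fits W σ) :
      Exec W (.store a e) σ (a.cost + e.cost + 1)
        { σ with mem := Function.update σ.mem (a.val σ) (e.val σ) }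
  | seq {c d : Prog} {σ τ υ : State} {t u : ℕ} (hc : Exec W c σ t τ) (hd : Exec W d τ u υ) :
      Exec W (.seq c d) σ (t + u) υ
  | cond_true {e : Expr} {c d : Prog} {σ τ : State} {t : ℕ} (he : e.Fits W σ)
      (h : e.val σ ≠ 0) (hc : Exec W c σ t τ) :
      Exec W (.cond e c d) σ (e.cost + 1 + t) τ
  | cond_false {e : Expr} {c d : Prog} {σ τ : State} {t : ℕ} (he : e.Fits W σ)
      (h : e.val σ = 0) (hd : Exec W d σ t τ) :
      Exec W (.cond e c d) σ (e.cost + 1 + t) τ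
  | loop_true {e : Expr} {c : Prog} {σ τ υ : State} {t u : ℕ} (he : e.Fits W σ)
      (h : e.val σ ≠ 0) (hc : Exec W c σ t τ) (hl : Exec W (.loop e c) τ u υ) :
      Exec W (.loop e c) σ (e.cost + 1 + t + u) υ
  | loop_false {e : Expr} {c : Prog} {σ : State} (he : e.Fits W σ) (h : e.val σ = 0) :
      Exec W (.loop e c) σ (e.cost + 1) σ

/-- The machine is deterministic: final state and running time are determined by the program and
the initial state. -/
theorem Exec.deterministic {W : ℕ} {c : Prog} {σ τ τ' : State} {t t' : ℕ}
    (h : Exec W c σ t τ) (h' : Exec W c σ t' τ') : t = t' ∧ τ = τ' := by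
  induction h generalizing t' τ' with
  | skip => cases h'; exact ⟨rfl, rfl⟩
  | assign => cases h'; exact ⟨rfl, rfl⟩
  | store => cases h'; exact ⟨rfl, rfl⟩
  | seq _ _ ih₁ ih₂ =>
    cases h' with
    | seq h₁ h₂ =>
      obtain ⟨rfl, rfl⟩ := ih₁ h₁
      obtain ⟨rfl, rfl⟩ := ih₂ h₂
      exact ⟨rfl, rfl⟩
  | cond_true _ h _ ih =>
    cases h' with
    | cond_true _ _ h₁ =>
      obtain ⟨rfl, rfl⟩ := ih h₁
      exact ⟨rfl, rfl⟩
    | cond_false _ h₀ _ => exact absurd h₀ h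
  | cond_false _ h _ ih =>
    cases h' with
    | cond_true _ h₀ _ => exact absurd h h₀
    | cond_false _ _ h₁ =>
      obtain ⟨rfl, rfl⟩ := ih h₁
      exact ⟨rfl, rfl⟩
  | loop_true _ h _ _ ih₁ ih₂ =>
    cases h' with
    | loop_true _ _ h₁ h₂ =>
      obtain ⟨rfl, rfl⟩ := ih₁ h₁
      obtain ⟨rfl, rfl⟩ := ih₂ h₂
      exact ⟨rfl, rfl⟩
    | loop_false _ h₀ => exact absurd h₀ h
  | loop_false _ h =>
    cases h' with
    | loop_true _ h₀ _ _ => exact absurd h h₀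
    | loop_false => exact ⟨rfl, rfl⟩

/-- The initial state on an input: the input occupies the memory cells from address `0` on, all
other cells and all registers are `0`. -/
def init (input : List ℕ) : State where
  reg := fun _ => 0
  mem := fun a => input.getD a 0

end RAM

/-! ### Adjacency lists -/

namespace AdjList

/-- `L v` lists the neighbors of `v`, each of them once, in an arbitrary order. -/
def Represents {n : ℕ} (L : Fin n → List (Fin n)) (G : SimpleGraph (Fin n)) : Prop :=
  ∀ v, (L v).Nodup ∧ ∀ w, w ∈ L v ↔ G.Adj v w

/-- The address at which the list of vertex `v` starts in `encode L`, and at which the list of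
vertex `v - 1` ends. -/
def start {n : ℕ} (L : Fin n → List (Fin n)) (v : ℕ) : ℕ :=
  n + 2 + ((List.ofFn L).take v).flatten.length

/-- Adjacency lists as a sequence of words: the number `n` of vertices, the `n + 1` addresses
`start L 0, …, start L n`, and the lists of the vertices `0, …, n - 1` one after the other. -/
def encode {n : ℕ} (L : Fin n → List (Fin n)) : List ℕ :=
  n :: ((List.range (n + 1)).map (start L) ++ (List.ofFn L).flatten.map Fin.val)

end AdjList

/-! The reductions are confluent up to isomorphism: if two of them apply to the same graph, then
either the results are isomorphic, or each still applies after the other and the two commute.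
Indeed, no edge of a D3a triangle lies in a second triangle. So two such triangles are equal or
disjoint, and none meets a D3b configuration (`IsA.disjoint_isB`). Disjoint D3a triangles interfere
only if at least two edges join them, and D3b configurations only if the vertex deleted by one is
the middle, an end or the apex of the other, or if their paths have the same ends. In all these
cases transpositions of vertices identify the results. By induction (`CRed.of_step`), carrying out
any applicable reduction does not affect reducibility. Hence one may reduce greedily, and a graph to
which no reduction applies is D3-reducible only if it is a $K_4$.

For this argument all graphs live on one vertex type, where deleted vertices become isolated and a
counter records how many vertices are left (`CRed`); `reducible_iff_cRed` relates this to the graphs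
with shrinking vertex sets.

Rule D3a removes two vertices and lowers the degree sum by 6, rule D3b removes one vertex and lowers
it by 4. So a reducible graph on $n$ vertices has degree sum at most $4n$ (`CRed.sum_card_le`).
Denser graphs are rejected without reading the lists, and otherwise the input has $O(n)$ words.

The adjacency lists need no updating. It suffices to know every degree, the three neighbors of each
vertex of degree three, and modulo $n$ the sum of the neighbors of each vertex of larger degree. The
only surviving vertex whose degree changes is the apex of a D3b reduction. When its degree falls to
three, two of its neighbors are the ends of the path, and the sum yields the third (`Good.opB`).

Whether a reduction applies at a vertex depends only on the neighborhoods of this vertex and of its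
neighbors of degree three (`Active.of_unchanged`). A stack contains every vertex where a reduction
applies. A reduction changes the neighborhoods of at most three surviving vertices of degree three;
they and their neighbors, at most 12 vertices, are pushed. The stack height plus 13 times the number
of remaining vertices therefore decreases in each round, which bounds the number of rounds by $14n$
(`wp_mainBody`).

The program is written in a small array language with weakest preconditions, whose compilation to
the machine preserves total correctness and time bounds (`Triple.of_wp`, `Triple.loop`). -/

/-! ### The reductions on a fixed vertex type -/

namespace D3

variable {V : Type}

/-- Rule D3a on a fixed vertex type: `p` becomes the new vertex, `q` and `r` become isolated. -/
def opA (G : SimpleGraph V) (p q r : V) : SimpleGraph V where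
  Adj u v := u ≠ v ∧ u ≠ q ∧ u ≠ r ∧ v ≠ q ∧ v ≠ r ∧
    (G.Adj u v ∨ (u = p ∧ (G.Adj q v ∨ G.Adj r v)) ∨ (v = p ∧ (G.Adj q u ∨ G.Adj r u)))
  symm := ⟨fun u v h => by
    obtain ⟨h₁, h₂, h₃, h₄, h₅, h⟩ := h
    refine ⟨h₁.symm, h₄, h₅, h₂, h₃, ?_⟩
    rcases h with h | h | h
    · exact Or.inl h.symm
    · exact Or.inr (Or.inr h)
    · exact Or.inr (Or.inl h)⟩
  loopless := ⟨fun _ h => h.1 rfl⟩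

/-- Rule D3b on a fixed vertex type: `q` becomes isolated. -/
def opB (G : SimpleGraph V) (p q r : V) : SimpleGraph V where
  Adj u v := u ≠ v ∧ u ≠ q ∧ v ≠ q ∧ (G.Adj u v ∨ (u = p ∧ v = r) ∨ (u = r ∧ v = p))
  symm := ⟨fun u v h => by
    obtain ⟨h₁, h₂, h₃, h⟩ := h
    refine ⟨h₁.symm, h₃, h₂, ?_⟩
    rcases h with h | h | h
    · exact Or.inl h.symm
    · exact Or.inr (Or.inr h.symm)
    · exact Or.inr (Or.inl h.symm)⟩
  loopless := ⟨fun _ h => h.1 rfl⟩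

theorem opA_adj {G : SimpleGraph V} {p q r u v : V} : (opA G p q r).Adj u v ↔
    u ≠ v ∧ u ≠ q ∧ u ≠ r ∧ v ≠ q ∧ v ≠ r ∧
    (G.Adj u v ∨ (u = p ∧ (G.Adj q v ∨ G.Adj r v)) ∨ (v = p ∧ (G.Adj q u ∨ G.Adj r u))) :=
  Iff.rfl

theorem opB_adj {G : SimpleGraph V} {p q r u v : V} : (opB G p q r).Adj u v ↔
    u ≠ v ∧ u ≠ q ∧ v ≠ q ∧ (G.Adj u v ∨ (u = p ∧ v = r) ∨ (u = r ∧ v = p)) :=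
  Iff.rfl

/-- `CanA` with the outside neighbors `p'`, `q'`, `r'` of `p`, `q`, `r` made explicit. -/
structure IsA (G : SimpleGraph V) (p q r p' q' r' : V) : Prop where
  np : ∀ w, G.Adj p w ↔ w = q ∨ w = r ∨ w = p'
  nq : ∀ w, G.Adj q w ↔ w = p ∨ w = r ∨ w = q'
  nr : ∀ w, G.Adj r w ↔ w = p ∨ w = q ∨ w = r'
  pq : p ≠ q
  pr : p ≠ r
  qr : q ≠ r
  pp : p' ≠ p ∧ p' ≠ q ∧ p' ≠ r
  qq : q' ≠ p ∧ q' ≠ q ∧ q' ≠ r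
  rr : r' ≠ p ∧ r' ≠ q ∧ r' ≠ r
  pq' : p' ≠ q'
  pr' : p' ≠ r'
  qr' : q' ≠ r'

/-- `CanB` with the apex `s` and the remaining neighbors `p'`, `r'` of `p`, `r` made explicit. -/
structure IsB (G : SimpleGraph V) (p q r s p' r' : V) : Prop where
  nq : ∀ w, G.Adj q w ↔ w = p ∨ w = r ∨ w = s
  np : ∀ w, G.Adj p w ↔ w = q ∨ w = s ∨ w = p'
  nr : ∀ w, G.Adj r w ↔ w = q ∨ w = s ∨ w = r'
  pr : p ≠ r
  pq : p ≠ q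
  qr : q ≠ r
  sp : s ≠ p
  sq : s ≠ q
  sr : s ≠ r
  pp : p' ≠ p ∧ p' ≠ q ∧ p' ≠ r ∧ p' ≠ s
  rr : r' ≠ p ∧ r' ≠ q ∧ r' ≠ r ∧ r' ≠ s

theorem DegThree.exists_third {G : SimpleGraph V} {v a b : V} (h : DegThree G v)
    (ha : G.Adj v a) (hb : G.Adj v b) (hab : a ≠ b) :
    ∃ c, c ≠ a ∧ c ≠ b ∧ c ≠ v ∧ ∀ w, G.Adj v w ↔ w = a ∨ w = b ∨ w = c := by
  have hfin : (G.neighborSet v).Finite := Set.finite_of_ncard_pos (by rw [h]; norm_num)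
  have hsub : ({a, b} : Set V) ⊆ G.neighborSet v := by
    rintro x (rfl | rfl) <;> assumption
  have h1 : (G.neighborSet v \ {a, b}).ncard = 1 := by
    rw [Set.ncard_sdiff hsub (Set.toFinite _), Set.ncard_pair hab, h]
  obtain ⟨c, hc⟩ := Set.ncard_eq_one.1 h1
  have hc' : ∀ w, (G.Adj v w ∧ ¬ (w = a ∨ w = b)) ↔ w = c := fun w => by
    have := Set.ext_iff.1 hc w
    simpa using this
  have hcc := (hc' c).2 rfl
  refine ⟨c, fun e => hcc.2 (Or.inl e), fun e => hcc.2 (Or.inr e), fun e => ?_, fun w => ?_⟩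
  · exact G.irrefl (e ▸ hcc.1)
  · grind

theorem degThree_of_nbrs {G : SimpleGraph V} {v a b c : V}
    (h : ∀ w, G.Adj v w ↔ w = a ∨ w = b ∨ w = c) (hab : a ≠ b) (hac : a ≠ c) (hbc : b ≠ c) :
    DegThree G v := by
  have : G.neighborSet v = {a, b, c} := by
    ext w
    simpa using h w
  rw [DegThree, this]
  exact Set.ncard_eq_three.2 ⟨a, b, c, hab, hac, hbc, rfl⟩

/-- A degree-three vertex of the triangle has exactly one neighbor outside it, so disjointness of
the outside neighborhoods becomes three inequalities between vertices. -/
theorem canA_iff {G : SimpleGraph V} {p q r : V} :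
    CanA G p q r ↔ ∃ p' q' r', IsA G p q r p' q' r' := by
  constructor
  · intro h
    have hpq := h.adj_pq.ne
    have hpr := h.adj_pr.ne
    have hqr := h.adj_qr.ne
    obtain ⟨p', h1, h2, h3, np⟩ := h.deg_p.exists_third h.adj_pq h.adj_pr hqr
    obtain ⟨q', h4, h5, h6, nq⟩ := h.deg_q.exists_third h.adj_pq.symm h.adj_qr hpr
    obtain ⟨r', h7, h8, h9, nr⟩ := h.deg_r.exists_third h.adj_pr.symm h.adj_qr.symm hpq
    have d1 := Set.disjoint_left.1 h.distinct_pq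
    have d2 := Set.disjoint_left.1 h.distinct_qr
    have d3 := Set.disjoint_left.1 h.distinct_pr
    simp only [Set.mem_sdiff, SimpleGraph.mem_neighborSet, Set.mem_insert_iff,
      Set.mem_singleton_iff, np, nq, nr] at d1 d2 d3
    specialize @d1 p'
    specialize @d2 q'
    specialize @d3 p'
    refine ⟨p', q', r', np, nq, nr, hpq, hpr, hqr, ⟨h3, h1, h2⟩, ⟨h4, h6, h5⟩, ⟨h7, h8, h9⟩,
      ?_, ?_, ?_⟩ <;> grind
  · rintro ⟨p', q', r', h⟩
    obtain ⟨np, nq, nr, pq, pr, qr, pp, qq, rr, pq', pr', qr'⟩ := h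
    refine ⟨degThree_of_nbrs np qr pp.2.1.symm pp.2.2.symm,
      degThree_of_nbrs nq pr qq.1.symm qq.2.2.symm, degThree_of_nbrs nr pq rr.1.symm rr.2.1.symm,
      (np _).2 (by simp), (nq _).2 (by simp), (np _).2 (by simp), ?_, ?_, ?_⟩ <;>
    · rw [Set.disjoint_left]
      simp only [Set.mem_sdiff, SimpleGraph.mem_neighborSet, Set.mem_insert_iff,
        Set.mem_singleton_iff, np, nq, nr]
      grind

/-- The apex is forced to be the third neighbor of `q`, and non-adjacency of the ends becomes part
of the conditions on `p'` and `r'`. These two may coincide. -/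
theorem canB_iff {G : SimpleGraph V} {p q r : V} :
    CanB G p q r ↔ ∃ s p' r', IsB G p q r s p' r' := by
  constructor
  · intro h
    have hpq := h.adj_pq.ne
    have hqr := h.adj_qr.ne
    obtain ⟨s, sp, sq, sr⟩ := h.apex
    obtain ⟨s', h1, h2, h3, nq⟩ := h.deg_q.exists_third h.adj_pq.symm h.adj_qr h.ne_pr
    have hs : s' = s := by
      have := (nq s).1 sq.symm
      have := sp.ne
      have := sr.ne
      grind
    subst hs
    obtain ⟨p', h4, h5, h6, np⟩ := h.deg_p.exists_third h.adj_pq sp.symm sq.ne'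
    obtain ⟨r', h7, h8, h9, nr⟩ := h.deg_r.exists_third h.adj_qr.symm sr.symm sq.ne'
    have hpr := h.not_adj_pr
    have hrp : ¬ G.Adj r p := fun e => hpr e.symm
    rw [np] at hpr
    rw [nr] at hrp
    refine ⟨s', p', r', nq, np, nr, h.ne_pr, hpq, hqr, sp.ne, sq.ne, sr.ne, ?_, ?_⟩ <;> grind
  · rintro ⟨s, p', r', h⟩
    obtain ⟨nq, np, nr, pr, pq, qr, sp, sq, sr, pp, rr⟩ := h
    refine ⟨degThree_of_nbrs np sq.symm pp.2.1.symm pp.2.2.2.symm,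
      degThree_of_nbrs nq pr sp.symm sr.symm,
      degThree_of_nbrs nr sq.symm rr.2.1.symm rr.2.2.2.symm,
      (np _).2 (by simp), (nq _).2 (by simp), pr, ?_, s, ?_, ?_, ?_⟩
    · rw [np]; grind
    · exact ((np s).2 (by simp)).symm
    · exact ((nq s).2 (by simp)).symm
    · exact ((nr s).2 (by simp)).symm

theorem IsA.swap_qr {G : SimpleGraph V} {p q r p' q' r' : V} (h : IsA G p q r p' q' r') :
    IsA G p r q p' r' q' := by
  obtain ⟨np, nq, nr, pq, pr, qr, pp, qq, rr, pq', pr', qr'⟩ := h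
  constructor <;> grind

theorem IsA.swap_pq {G : SimpleGraph V} {p q r p' q' r' : V} (h : IsA G p q r p' q' r') :
    IsA G q p r q' p' r' := by
  obtain ⟨np, nq, nr, pq, pr, qr, pp, qq, rr, pq', pr', qr'⟩ := h
  constructor <;> grind

theorem IsB.swap {G : SimpleGraph V} {p q r s p' r' : V} (h : IsB G p q r s p' r') :
    IsB G r q p s r' p' := by
  obtain ⟨nq, np, nr, pr, pq, qr, sp, sq, sr, pp, rr⟩ := h
  constructor <;> grind

theorem CanA.swap_qr {G : SimpleGraph V} {p q r : V} (h : CanA G p q r) : CanA G p r q := by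
  obtain ⟨_, _, _, h⟩ := canA_iff.1 h
  exact canA_iff.2 ⟨_, _, _, h.swap_qr⟩

theorem CanB.swap {G : SimpleGraph V} {p q r : V} (h : CanB G p q r) : CanB G r q p := by
  obtain ⟨_, _, _, h⟩ := canB_iff.1 h
  exact canB_iff.2 ⟨_, _, _, h.swap⟩

theorem opA_swap_qr (G : SimpleGraph V) (p q r : V) : opA G p r q = opA G p q r := by
  ext u v
  simp only [opA_adj]
  tauto

theorem opB_swap (G : SimpleGraph V) (p q r : V) : opB G r q p = opB G p q r := by
  ext u v
  simp only [opB_adj]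
  tauto

/-- `f` embeds `H` into `G`, and all vertices of `G` outside the image are isolated. -/
structure Emb {V' : Type} (f : V' → V) (H : SimpleGraph V') (G : SimpleGraph V) : Prop where
  inj : Function.Injective f
  adj : ∀ u v, G.Adj (f u) (f v) ↔ H.Adj u v
  range : ∀ u v, G.Adj u v → ∃ u', f u' = u

theorem Emb.comp {V' V'' : Type} {f : V' → V} {g : V'' → V'} {G : SimpleGraph V}
    {H : SimpleGraph V'} {K : SimpleGraph V''} (hf : Emb f H G) (hg : Emb g K H) :
    Emb (f ∘ g) K G where
  inj := hf.inj.comp hg.inj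
  adj u v := by simp [hf.adj, hg.adj]
  range u v h := by
    obtain ⟨u', rfl⟩ := hf.range u v h
    obtain ⟨v', rfl⟩ := hf.range v _ h.symm
    obtain ⟨u, rfl⟩ := hg.range _ _ ((hf.adj _ _).1 h)
    exact ⟨u, rfl⟩

/-- Vertices outside the image are isolated, so the neighbors of `f v` all lie in the image. This
lets the explicit forms of both preconditions pass through embeddings in either direction. -/
theorem Emb.nbrs_iff {V' : Type} {f : V' → V} {G : SimpleGraph V} {H : SimpleGraph V'}
    (hf : Emb f H G) {v a b c : V'} :
    (∀ w, G.Adj (f v) w ↔ w = f a ∨ w = f b ∨ w = f c) ↔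
      ∀ w, H.Adj v w ↔ w = a ∨ w = b ∨ w = c := by
  constructor
  · intro h w
    rw [← hf.adj, h, hf.inj.eq_iff, hf.inj.eq_iff, hf.inj.eq_iff]
  · intro h w
    constructor
    · intro hw
      obtain ⟨w', rfl⟩ := hf.range _ _ hw.symm
      rw [hf.adj, h] at hw
      grind
    · rintro (rfl | rfl | rfl) <;> rw [hf.adj, h] <;> simp

theorem Emb.isA_iff {V' : Type} {f : V' → V} {G : SimpleGraph V} {H : SimpleGraph V'}
    (hf : Emb f H G) {p q r p' q' r' : V'} :
    IsA G (f p) (f q) (f r) (f p') (f q') (f r') ↔ IsA H p q r p' q' r' := by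
  have e : ∀ a b, f a = f b ↔ a = b := fun a b => hf.inj.eq_iff
  constructor
  · rintro ⟨np, nq, nr, h⟩
    simp only [ne_eq, e] at *
    constructor <;> simp_all [hf.nbrs_iff]
  · rintro ⟨np, nq, nr, h⟩
    constructor <;> simp_all [hf.nbrs_iff]

theorem Emb.isB_iff {V' : Type} {f : V' → V} {G : SimpleGraph V} {H : SimpleGraph V'}
    (hf : Emb f H G) {p q r s p' r' : V'} :
    IsB G (f p) (f q) (f r) (f s) (f p') (f r') ↔ IsB H p q r s p' r' := by
  have e : ∀ a b, f a = f b ↔ a = b := fun a b => hf.inj.eq_iff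
  constructor
  · rintro ⟨np, nq, nr, h⟩
    simp only [ne_eq, e] at *
    constructor <;> simp_all [hf.nbrs_iff]
  · rintro ⟨np, nq, nr, h⟩
    constructor <;> simp_all [hf.nbrs_iff]

theorem Emb.canA {V' : Type} {f : V' → V} {G : SimpleGraph V} {H : SimpleGraph V'}
    (hf : Emb f H G) {p q r : V'} (h : CanA H p q r) : CanA G (f p) (f q) (f r) := by
  obtain ⟨_, _, _, h⟩ := canA_iff.1 h
  exact canA_iff.2 ⟨_, _, _, hf.isA_iff.2 h⟩

theorem Emb.canB {V' : Type} {f : V' → V} {G : SimpleGraph V} {H : SimpleGraph V'}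
    (hf : Emb f H G) {p q r : V'} (h : CanB H p q r) : CanB G (f p) (f q) (f r) := by
  obtain ⟨_, _, _, h⟩ := canB_iff.1 h
  exact canB_iff.2 ⟨_, _, _, hf.isB_iff.2 h⟩

theorem Emb.exists_canA {V' : Type} {f : V' → V} {G : SimpleGraph V} {H : SimpleGraph V'}
    (hf : Emb f H G) {p q r : V} (h : CanA G p q r) :
    ∃ p₀ q₀ r₀, p = f p₀ ∧ q = f q₀ ∧ r = f r₀ ∧ CanA H p₀ q₀ r₀ := by
  obtain ⟨p', q', r', h⟩ := canA_iff.1 h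
  obtain ⟨p₀, rfl⟩ := hf.range _ _ ((h.np q).2 (by simp))
  obtain ⟨q₀, rfl⟩ := hf.range _ _ ((h.nq r).2 (by simp))
  obtain ⟨r₀, rfl⟩ := hf.range _ _ ((h.nr _).2 (Or.inl rfl))
  obtain ⟨p', rfl⟩ := hf.range _ _ ((h.np p').2 (by simp)).symm
  obtain ⟨q', rfl⟩ := hf.range _ _ ((h.nq q').2 (by simp)).symm
  obtain ⟨r', rfl⟩ := hf.range _ _ ((h.nr r').2 (by simp)).symm
  exact ⟨_, _, _, rfl, rfl, rfl, canA_iff.2 ⟨_, _, _, hf.isA_iff.1 h⟩⟩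

theorem Emb.exists_canB {V' : Type} {f : V' → V} {G : SimpleGraph V} {H : SimpleGraph V'}
    (hf : Emb f H G) {p q r : V} (h : CanB G p q r) :
    ∃ p₀ q₀ r₀, p = f p₀ ∧ q = f q₀ ∧ r = f r₀ ∧ CanB H p₀ q₀ r₀ := by
  obtain ⟨s, p', r', h⟩ := canB_iff.1 h
  obtain ⟨p₀, rfl⟩ := hf.range _ _ ((h.np q).2 (by simp))
  obtain ⟨q₀, rfl⟩ := hf.range _ _ ((h.nq r).2 (by simp))
  obtain ⟨r₀, rfl⟩ := hf.range _ _ ((h.nr s).2 (by simp))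
  obtain ⟨s, rfl⟩ := hf.range _ _ ((h.nq s).2 (by simp)).symm
  obtain ⟨p', rfl⟩ := hf.range _ _ ((h.np p').2 (by simp)).symm
  obtain ⟨r', rfl⟩ := hf.range _ _ ((h.nr r').2 (by simp)).symm
  exact ⟨_, _, _, rfl, rfl, rfl, canB_iff.2 ⟨_, _, _, hf.isB_iff.1 h⟩⟩

theorem Emb.opA {V' : Type} {f : V' → V} {G : SimpleGraph V} {H : SimpleGraph V'}
    (hf : Emb f H G) (p q r : V') : Emb f (opA H p q r) (opA G (f p) (f q) (f r)) where
  inj := hf.inj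
  adj u v := by simp only [opA_adj, hf.adj, ne_eq, hf.inj.eq_iff]
  range u v h := by
    rw [opA_adj] at h
    obtain ⟨-, -, -, -, -, h | ⟨rfl, h⟩ | ⟨rfl, h | h⟩⟩ := h
    · exact hf.range _ _ h
    · exact ⟨_, rfl⟩
    · exact hf.range _ _ h.symm
    · exact hf.range _ _ h.symm

theorem Emb.opB {V' : Type} {f : V' → V} {G : SimpleGraph V} {H : SimpleGraph V'}
    (hf : Emb f H G) (p q r : V') : Emb f (opB H p q r) (opB G (f p) (f q) (f r)) where
  inj := hf.inj
  adj u v := by simp only [opB_adj, hf.adj, ne_eq, hf.inj.eq_iff]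
  range u v h := by
    rw [opB_adj] at h
    obtain ⟨-, -, -, h | ⟨rfl, h⟩ | ⟨rfl, h⟩⟩ := h
    · exact hf.range _ _ h
    · exact ⟨_, rfl⟩
    · exact ⟨_, rfl⟩

/-- The new vertex `none` is realized by `p`, which is why the fixed-type version of the rule keeps
`p`. -/
theorem emb_resultA {G : SimpleGraph V} {p q r : V} (h : CanA G p q r) :
    Emb (fun o : Option {v : V // v ≠ p ∧ v ≠ q ∧ v ≠ r} => o.elim p Subtype.val)
      (resultA G p q r) (opA G p q r) := by
  obtain ⟨_, _, _, h⟩ := canA_iff.1 h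
  have h1 := h.pq
  have h2 := h.pr
  refine ⟨?_, ?_, ?_⟩
  · rintro (_ | ⟨u, hu⟩) (_ | ⟨v, hv⟩) e <;> simp at e ⊢ <;> grind
  · rintro (_ | ⟨u, hu⟩) (_ | ⟨v, hv⟩) <;> simp only [opA_adj, resultA, adjA, Option.elim]
    · grind
    · grind
    · grind [G.adj_comm]
    · have : G.Adj u v → u ≠ v := fun h => h.ne
      grind
  · intro u v huv
    rw [opA_adj] at huv
    by_cases e : u = p
    · exact ⟨none, e.symm⟩
    · exact ⟨some ⟨u, e, huv.2.1, huv.2.2.1⟩, rfl⟩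

theorem emb_resultB {G : SimpleGraph V} {p q r : V} (_h : CanB G p q r) :
    Emb (Subtype.val : {v : V // v ≠ q} → V) (resultB G p q r) (opB G p q r) := by
  refine ⟨Subtype.val_injective, ?_, ?_⟩
  · rintro ⟨u, hu⟩ ⟨v, hv⟩
    have : G.Adj u v → u ≠ v := fun h => h.ne
    simp only [opB_adj, resultB, SimpleGraph.comap_adj, SimpleGraph.sup_adj,
      SimpleGraph.edge_adj, Function.Embedding.subtype_apply]
    grind
  · intro u v huv
    exact ⟨⟨u, huv.2.1⟩, rfl⟩

end D3

/-! ### Reducibility on a fixed vertex type, and interaction of two D3a reductions -/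

namespace D3

variable {V : Type}

/-- A complete graph on four vertices, all other vertices being isolated. -/
def IsK4 (G : SimpleGraph V) : Prop :=
  ∃ A : Finset V, A.card = 4 ∧ ∀ u v, G.Adj u v ↔ u ∈ A ∧ v ∈ A ∧ u ≠ v

/-- D3-reducibility on a fixed vertex type; `k` counts the vertices that have not been deleted. -/
inductive CRed : SimpleGraph V → ℕ → Prop
  | base {G : SimpleGraph V} (h : IsK4 G) : CRed G 4
  | stepA {G : SimpleGraph V} {k : ℕ} (p q r : V) (h : CanA G p q r)
      (hr : CRed (opA G p q r) (k - 2)) : CRed G k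
  | stepB {G : SimpleGraph V} {k : ℕ} (p q r : V) (h : CanB G p q r)
      (hr : CRed (opB G p q r) (k - 1)) : CRed G k

/-- The two graphs are isomorphic. -/
def Isom (G H : SimpleGraph V) : Prop := ∃ f : Equiv.Perm V, Emb f G H

theorem Isom.refl (G : SimpleGraph V) : Isom G G :=
  ⟨Equiv.refl V, Function.injective_id, fun _ _ => Iff.rfl, fun u _ _ => ⟨u, rfl⟩⟩

theorem isom_of_adj {G H : SimpleGraph V} (f : Equiv.Perm V)
    (h : ∀ u v, H.Adj (f u) (f v) ↔ G.Adj u v) : Isom G H :=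
  ⟨f, f.injective, h, fun u _ _ => f.surjective u⟩

theorem IsK4.map {V' : Type} {f : V → V'} {G : SimpleGraph V} {H : SimpleGraph V'}
    (hf : Emb f G H) (h : IsK4 G) : IsK4 H := by
  obtain ⟨A, hA, h⟩ := h
  refine ⟨A.map ⟨f, hf.inj⟩, by simpa using hA, fun u v => ?_⟩
  constructor
  · intro huv
    obtain ⟨u, rfl⟩ := hf.range _ _ huv
    obtain ⟨v, rfl⟩ := hf.range _ _ huv.symm
    have := (h u v).1 ((hf.adj _ _).1 huv)
    simpa [hf.inj.eq_iff] using this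
  · rintro ⟨hu, hv, huv⟩
    simp only [Finset.mem_map, Function.Embedding.coeFn_mk] at hu hv
    obtain ⟨u, hu, rfl⟩ := hu
    obtain ⟨v, hv, rfl⟩ := hv
    rw [hf.adj, h]
    exact ⟨hu, hv, fun e => huv (e ▸ rfl)⟩

theorem CRed.map {V' : Type} {G : SimpleGraph V} {k : ℕ} (h : CRed G k) :
    ∀ {f : V → V'} {H : SimpleGraph V'}, Emb f G H → CRed H k := by
  induction h with
  | base h => exact fun hf => .base (h.map hf)
  | stepA p q r h _ ih => exact fun hf => .stepA _ _ _ (hf.canA h) (ih (hf.opA p q r))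
  | stepB p q r h _ ih => exact fun hf => .stepB _ _ _ (hf.canB h) (ih (hf.opB p q r))

theorem CRed.isom {G H : SimpleGraph V} {k : ℕ} (h : CRed G k) (hf : Isom G H) : CRed H k := by
  obtain ⟨f, hf⟩ := hf
  exact h.map hf

theorem Isom.symm {G H : SimpleGraph V} (h : Isom G H) : Isom H G := by
  obtain ⟨f, hf⟩ := h
  exact isom_of_adj f.symm fun u v => by rw [← hf.adj]; simp

/-- In a $K_4$ the vertices of a triangle share their outside neighbor. Together with
`IsK4.not_canB` this makes the base case of confluence vacuous. -/
theorem IsK4.not_canA {G : SimpleGraph V} (h : IsK4 G) (p q r : V) : ¬ CanA G p q r := by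
  intro hc
  obtain ⟨A, hA, h⟩ := h
  obtain ⟨p', q', r', hc⟩ := canA_iff.1 hc
  obtain ⟨np, nq, nr, pq, pr, qr, pp, qq, rr, pq', pr', qr'⟩ := hc
  have h1 := (nq p').1
  have h2 := (np p').2 (by simp)
  have h3 := (nq p).2 (by simp)
  rw [h] at h1 h2 h3
  grind

theorem IsK4.not_canB {G : SimpleGraph V} (h : IsK4 G) (p q r : V) : ¬ CanB G p q r := by
  intro hc
  obtain ⟨A, hA, h⟩ := h
  have h1 := hc.not_adj_pr
  have h2 := hc.adj_pq
  have h3 := hc.adj_qr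
  rw [h] at h1 h2 h3
  exact h1 ⟨h2.1, h3.2.1, hc.ne_pr⟩

/-- The two sides differ only in the name of the contracted vertex, so the transposition of `p` and
`q` is an isomorphism. -/
theorem isom_opA_swap {G : SimpleGraph V} {p q r : V} (pq : p ≠ q) (pr : p ≠ r) (qr : q ≠ r) :
    Isom (opA G p q r) (opA G q p r) := by
  classical
  refine isom_of_adj (Equiv.swap p q) fun u v => ?_
  have := G.adj_comm
  by_cases u1 : u = p <;> by_cases u2 : u = q <;> by_cases v1 : v = p <;> by_cases v2 : v = q <;>
    simp_all [opA_adj, Equiv.swap_apply_def] <;> grind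

theorem IsA.opA_nbrs {G : SimpleGraph V} {p q r p' q' r' : V} (h : IsA G p q r p' q' r') {u : V}
    (h1 : u ≠ p) (h2 : u ≠ q) (h3 : u ≠ r) (w : V) : (opA G p q r).Adj u w ↔
      (G.Adj u w ∧ w ≠ q ∧ w ≠ r) ∨ (w = p ∧ (u = q' ∨ u = r')) := by
  obtain ⟨np, nq, nr, pq, pr, qr, pp, qq, rr, pq', pr', qr'⟩ := h
  have := G.adj_comm u
  have : G.Adj u w → u ≠ w := fun h => h.ne
  rw [opA_adj]
  grind

theorem Isom.trans {G H K : SimpleGraph V} (h : Isom G H) (h' : Isom H K) : Isom G K := by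
  obtain ⟨f, hf⟩ := h
  obtain ⟨g, hg⟩ := h'
  exact ⟨f.trans g, hg.comp hf⟩

/-- The vertices of the triangle of a D3a reduction can be listed in any order. -/
theorem IsA.arrange {G : SimpleGraph V} {p q r p' q' r' x y : V} (h : IsA G p q r p' q' r')
    (hx : x = p ∨ x = q ∨ x = r) (hy : y = p ∨ y = q ∨ y = r) (hxy : x ≠ y) :
    ∃ z x' y' z', IsA G x y z x' y' z' ∧ Isom (opA G p q r) (opA G x y z) ∧
      (z = p ∨ z = q ∨ z = r) := by
  have i1 := isom_opA_swap (G := G) h.pq h.pr h.qr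
  have i2 := isom_opA_swap (G := G) h.pr h.pq h.qr.symm
  rw [opA_swap_qr] at i2
  rcases hx with rfl | rfl | rfl <;> rcases hy with rfl | rfl | rfl <;>
    first | exact absurd rfl hxy | skip
  · exact ⟨_, _, _, _, h, .refl _, by simp⟩
  · exact ⟨_, _, _, _, h.swap_qr, by rw [opA_swap_qr]; exact .refl _, by simp⟩
  · exact ⟨_, _, _, _, h.swap_pq, i1, by simp⟩
  · exact ⟨_, _, _, _, h.swap_pq.swap_qr, by rw [opA_swap_qr G x]; exact i1, by simp⟩
  · exact ⟨_, _, _, _, h.swap_qr.swap_pq, i2, by simp⟩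
  · exact ⟨_, _, _, _, h.swap_qr.swap_pq.swap_qr, by rw [opA_swap_qr G x]; exact i2, by simp⟩

/-- A different triangle through `p` would contain `p'` and one of `q`, `r`; that vertex would then
also have `p'` as its outside neighbor, against distinctness. -/
theorem IsA.eq_of_shared {G : SimpleGraph V} {p q r p' q' r' b c a' b' c' : V}
    (h1 : IsA G p q r p' q' r') (h2 : IsA G p b c a' b' c') :
    opA G p q r = opA G p b c := by
  obtain ⟨np, nq, nr, pq, pr, qr, pp, qq, rr, pq', pr', qr'⟩ := h1
  obtain ⟨na, nb, nc, ab, ac, bc, aa, bb, cc, ab', ac', bc'⟩ := h2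
  have e := G.adj_comm
  have h1 := (np b).1 ((na b).2 (by simp))
  have h2 := (np c).1 ((na c).2 (by simp))
  have h3 := (nb c).2 (by simp)
  have : (b = q ∧ c = r) ∨ (b = r ∧ c = q) := by grind
  rcases this with ⟨rfl, rfl⟩ | ⟨rfl, rfl⟩
  · rfl
  · exact opA_swap_qr _ _ _ _

theorem IsA.isom_of_shared {G : SimpleGraph V} {p q r p' q' r' a b c a' b' c' x : V}
    (h1 : IsA G p q r p' q' r') (h2 : IsA G a b c a' b' c')
    (hx : x = p ∨ x = q ∨ x = r) (hx' : x = a ∨ x = b ∨ x = c) :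
    Isom (opA G p q r) (opA G a b c) := by
  obtain ⟨y, hy, hxy⟩ : ∃ y, (y = p ∨ y = q ∨ y = r) ∧ x ≠ y := by
    rcases hx with rfl | rfl | rfl
    · exact ⟨q, by simp, h1.pq⟩
    · exact ⟨p, by simp, h1.pq.symm⟩
    · exact ⟨p, by simp, h1.pr.symm⟩
  obtain ⟨y', hy', hxy'⟩ : ∃ y, (y = a ∨ y = b ∨ y = c) ∧ x ≠ y := by
    rcases hx' with rfl | rfl | rfl
    · exact ⟨b, by simp, h2.pq⟩
    · exact ⟨a, by simp, h2.pq.symm⟩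
    · exact ⟨a, by simp, h2.pr.symm⟩
  obtain ⟨z, _, _, _, k1, i1, -⟩ := h1.arrange hx hy hxy
  obtain ⟨z', _, _, _, k2, i2, -⟩ := h2.arrange hx' hy' hxy'
  exact i1.trans (by rw [k1.eq_of_shared k2]; exact i2.symm)

/-- The triangles are joined by the edges `pa` and `qb`. Call the contracted vertex `r` or `c`,
respectively. Either contraction then leaves `r` and `c` with two adjacent common neighbors, namely
`a`, `b` or `p`, `q`, and exchanging these pairs is an isomorphism. -/
theorem isom_of_two_edges {G : SimpleGraph V} {p q r r' a b c c' : V}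
    (h1 : IsA G p q r a b r') (h2 : IsA G a b c p q c') :
    Isom (opA G p q r) (opA G a b c) := by
  classical
  have j1 : Isom (opA G p q r) (opA G r p q) := by
    have := isom_opA_swap (G := G) h1.pr h1.pq h1.qr.symm
    rwa [opA_swap_qr] at this
  have j2 : Isom (opA G a b c) (opA G c a b) := by
    have := isom_opA_swap (G := G) h2.pr h2.pq h2.qr.symm
    rwa [opA_swap_qr] at this
  refine (j1.trans ?_).trans j2.symm
  refine isom_of_adj (Equiv.swap a p * Equiv.swap b q) fun u v => ?_
  have e := G.adj_comm
  have e' : ∀ u, ¬ G.Adj u u := fun u => G.irrefl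
  obtain ⟨np, nq, nr, pq, pr, qr, pp, qq, rr, pq', pr', qr'⟩ := h1
  obtain ⟨na, nb, nc, ab, ac, bc, aa, bb, cc, ab', ac', bc'⟩ := h2
  have key : ∀ u, (Equiv.swap a p * Equiv.swap b q) u =
      if u = a then p else if u = p then a else if u = b then q else if u = q then b else u := by
    intro u
    simp only [Equiv.Perm.mul_apply, Equiv.swap_apply_def]
    grind
  rw [key u, key v, opA_adj, opA_adj]
  have r1 := fun w => e w p
  have r2 := fun w => e w q
  have r3 := fun w => e w r
  have r4 := fun w => e w a
  have r5 := fun w => e w b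
  have r6 := fun w => e w c
  by_cases u1 : u = a
  · grind
  by_cases u2 : u = p
  · grind
  by_cases u3 : u = b
  · grind
  by_cases u4 : u = q
  · grind
  simp only [u1, u2, u3, u4, if_false]
  by_cases v1 : v = a
  · grind
  by_cases v2 : v = p
  · grind
  by_cases v3 : v = b
  · grind
  by_cases v4 : v = q
  · grind
  grind

/-- Two vertex-disjoint applications of D3a commute. -/
theorem opA_opA_comm (G : SimpleGraph V) {p q r a b c : V}
    (ha : a ≠ p ∧ a ≠ q ∧ a ≠ r) (hb : b ≠ p ∧ b ≠ q ∧ b ≠ r) (hc : c ≠ p ∧ c ≠ q ∧ c ≠ r) :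
    opA (opA G p q r) a b c = opA (opA G a b c) p q r := by
  have e := G.adj_comm
  ext u v
  simp only [opA_adj]
  by_cases u1 : u = p
  · by_cases v1 : v = a <;> grind
  by_cases u2 : u = a
  · by_cases v1 : v = p <;> grind
  by_cases v1 : v = p
  · grind
  by_cases v2 : v = a
  · grind
  · grind

/-- Contracting `p`, `q`, `r` can identify two outside neighbors of the other triangle only if both
lie in `{p, q, r}`, which the last three hypotheses exclude. -/
theorem IsA.canA_opA {G : SimpleGraph V} {p q r p' q' r' a b c a' b' c' : V}
    (h1 : IsA G p q r p' q' r') (h2 : IsA G a b c a' b' c')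
    (ha : a ≠ p ∧ a ≠ q ∧ a ≠ r) (hb : b ≠ p ∧ b ≠ q ∧ b ≠ r) (hc : c ≠ p ∧ c ≠ q ∧ c ≠ r)
    (hab : ¬ ((a' = p ∨ a' = q ∨ a' = r) ∧ (b' = p ∨ b' = q ∨ b' = r)))
    (hac : ¬ ((a' = p ∨ a' = q ∨ a' = r) ∧ (c' = p ∨ c' = q ∨ c' = r)))
    (hbc : ¬ ((b' = p ∨ b' = q ∨ b' = r) ∧ (c' = p ∨ c' = q ∨ c' = r))) :
    CanA (opA G p q r) a b c := by
  classical
  -- `π` is the contraction map; it sends the old outside neighbors to the new ones.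
  let π : V → V := fun x => if x = p ∨ x = q ∨ x = r then p else x
  have hπ : ∀ x, π x = if x = p ∨ x = q ∨ x = r then p else x := fun _ => rfl
  clear_value π
  have e := G.adj_comm
  have n1 := h1.opA_nbrs ha.1 ha.2.1 ha.2.2
  have n2 := h1.opA_nbrs hb.1 hb.2.1 hb.2.2
  have n3 := h1.opA_nbrs hc.1 hc.2.1 hc.2.2
  obtain ⟨np, nq, nr, pq, pr, qr, pp, qq, rr, pq', pr', qr'⟩ := h1
  obtain ⟨na, nb, nc, ab, ac, bc, aa, bb, cc, ab', ac', bc'⟩ := h2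
  have f1 := na p
  have f2 := na q
  have f3 := na r
  have f4 := nb p
  have f5 := nb q
  have f6 := nb r
  have f7 := nc p
  have f8 := nc q
  have f9 := nc r
  rw [e] at f1 f2 f3 f4 f5 f6 f7 f8 f9
  rw [np] at f1 f4 f7
  rw [nq] at f2 f5 f8
  rw [nr] at f3 f6 f9
  refine canA_iff.2 ⟨π a', π b', π c', ?_, ?_, ?_, ab, ac, bc, ?_, ?_, ?_, ?_, ?_, ?_⟩
  · intro w
    rw [n1, na, hπ]
    grind
  · intro w
    rw [n2, nb, hπ]
    grind
  · intro w
    rw [n3, nc, hπ]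
    grind
  all_goals simp only [hπ]; grind

end D3

/-! ### Interaction of D3b with D3a and with itself, and confluence -/

namespace D3

variable {V : Type}

theorem IsB.not_adj {G : SimpleGraph V} {p q r s p' r' : V} (h : IsB G p q r s p' r') :
    ¬ G.Adj p r :=
  (canB_iff.2 ⟨_, _, _, h⟩).not_adj_pr

/-- By distinctness no edge of the triangle `pqr` lies in a second triangle. The D3b configuration
consists of the triangles `xys` and `yzs` with the common edge `ys`, and `p` has degree three, so
`p` cannot be one of its vertices. -/
theorem IsA.disjoint_isB {G : SimpleGraph V} {p q r p' q' r' x y z s x' z' : V}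
    (h1 : IsA G p q r p' q' r') (h2 : IsB G x y z s x' z') :
    p ≠ x ∧ p ≠ y ∧ p ≠ z ∧ p ≠ s := by
  have e := G.adj_comm
  obtain ⟨np, nq, nr, pq, pr, qr, pp, qq, rr, pq', pr', qr'⟩ := h1
  obtain ⟨ny, nx, nz, xz, xy, yz, sx, sy, sz, xx, zz⟩ := h2
  have g1 : G.Adj y s := (ny s).2 (by simp)
  have g2 : G.Adj x s := (nx s).2 (by simp)
  have g3 : G.Adj z s := (nz s).2 (by simp)
  have g4 : G.Adj y x := (ny x).2 (by simp)
  have g5 : G.Adj y z := (ny z).2 (by simp)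
  have g6 := g1.symm
  have g7 := g2.symm
  have g8 := g3.symm
  have g9 := g4.symm
  have g0 := g5.symm
  refine ⟨?_, ?_, ?_, ?_⟩ <;> intro h <;> grind

theorem opB_opA_comm (G : SimpleGraph V) {p q r x y z : V} (hp : p ≠ x ∧ p ≠ y ∧ p ≠ z)
    (hq : q ≠ x ∧ q ≠ y ∧ q ≠ z) (hr : r ≠ x ∧ r ≠ y ∧ r ≠ z) :
    opB (opA G p q r) x y z = opA (opB G x y z) p q r := by
  ext u v
  simp only [opA_adj, opB_adj]
  by_cases u1 : u = p
  · grind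
  by_cases v1 : v = p
  · grind
  grind

/-- The contracted triangle avoids `x`, `y`, `z` and `s`, so only `x'` and `z'` can be affected.
Both may become the new vertex, which is harmless since rule D3b does not require them to differ. -/
theorem IsA.canB_opA {G : SimpleGraph V} {p q r p' q' r' x y z s x' z' : V}
    (h1 : IsA G p q r p' q' r') (h2 : IsB G x y z s x' z') : CanB (opA G p q r) x y z := by
  classical
  have hp := h1.disjoint_isB h2
  have hq := h1.swap_pq.disjoint_isB h2
  have hr := h1.swap_qr.swap_pq.disjoint_isB h2
  let π : V → V := fun x => if x = p ∨ x = q ∨ x = r then p else x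
  have hπ : ∀ x, π x = if x = p ∨ x = q ∨ x = r then p else x := fun _ => rfl
  clear_value π
  have e := G.adj_comm
  have n1 := h1.opA_nbrs hp.1.symm hq.1.symm hr.1.symm
  have n2 := h1.opA_nbrs hp.2.1.symm hq.2.1.symm hr.2.1.symm
  have n3 := h1.opA_nbrs hp.2.2.1.symm hq.2.2.1.symm hr.2.2.1.symm
  obtain ⟨np, nq, nr, pq, pr, qr, pp, qq, rr, pq', pr', qr'⟩ := h1
  obtain ⟨ny, nx, nz, xz, xy, yz, sx, sy, sz, xx, zz⟩ := h2
  have f1 := nx p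
  have f2 := nx q
  have f3 := nx r
  have f4 := ny p
  have f5 := ny q
  have f6 := ny r
  have f7 := nz p
  have f8 := nz q
  have f9 := nz r
  rw [e] at f1 f2 f3 f4 f5 f6 f7 f8 f9
  rw [np] at f1 f4 f7
  rw [nq] at f2 f5 f8
  rw [nr] at f3 f6 f9
  refine canB_iff.2 ⟨s, π x', π z', ?_, ?_, ?_, xz, xy, yz, sx, sy, sz, ?_, ?_⟩
  · intro w
    rw [n2, ny]
    grind
  · intro w
    rw [n1, nx, hπ]
    grind
  · intro w
    rw [n3, nz, hπ]
    grind
  all_goals simp only [hπ]; grind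

theorem IsA.canA_opB {G : SimpleGraph V} {p q r p' q' r' x y z s x' z' : V}
    (h1 : IsA G p q r p' q' r') (h2 : IsB G x y z s x' z') : CanA (opB G x y z) p q r := by
  have hp := h1.disjoint_isB h2
  have hq := h1.swap_pq.disjoint_isB h2
  have hr := h1.swap_qr.swap_pq.disjoint_isB h2
  have e := G.adj_comm
  obtain ⟨np, nq, nr, pq, pr, qr, pp, qq, rr, pq', pr', qr'⟩ := h1
  obtain ⟨ny, nx, nz, xz, xy, yz, sx, sy, sz, xx, zz⟩ := h2
  refine canA_iff.2 ⟨p', q', r', ?_, ?_, ?_, pq, pr, qr, pp, qq, rr, pq', pr', qr'⟩ <;>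
  · intro w
    rw [opB_adj]
    grind

/-- The configurations overlap in a path `p'`, `p`, `q`, `r` with common apex `s`. Deleting either
inner vertex joins the other one to `p'` and `r`, so `p` and `q` can be exchanged. -/
theorem isom_opB_adjacent {G : SimpleGraph V} {q r s p' r' x z t x' z' p : V}
    (h1 : IsB G p q r s p' r') (h2 : IsB G x p z t x' z') : Isom (opB G p q r) (opB G x p z) := by
  classical
  have e := G.adj_comm
  obtain ⟨nq, np, nr, pr, pq, qr, sp, sq, sr, pp, rr⟩ := h1
  obtain ⟨ny, nx, nz, xz, xy, yz, sx, sy, sz, xx, zz⟩ := h2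
  refine isom_of_adj (Equiv.swap p q) fun u v => ?_
  have h1 := (np x).1 ((ny x).2 (by simp))
  have h2 := (np z).1 ((ny z).2 (by simp))
  have h3 := (np t).1 ((ny t).2 (by simp))
  have g1 : G.Adj q s := (nq s).2 (by simp)
  have g2 : G.Adj x t := (nx t).2 (by simp)
  have g3 : G.Adj z t := (nz t).2 (by simp)
  have g4 := g1.symm
  have g5 := g2.symm
  have g6 := g3.symm
  have : t = s ∧ ((x = q ∧ z = p') ∨ (z = q ∧ x = p')) := by grind
  obtain ⟨rfl, h⟩ := this
  have eu : ∀ u, ¬ G.Adj u u := fun u => G.irrefl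
  have e1 := fun w => e w p
  have e2 := fun w => e w q
  rw [Equiv.swap_apply_def, Equiv.swap_apply_def, opB_adj, opB_adj]
  by_cases u1 : u = p
  · grind
  by_cases u2 : u = q
  · grind
  by_cases v1 : v = p
  · grind
  by_cases v2 : v = q
  · grind
  grind

/-- Here `q` and `s` are adjacent, and the other neighbors of both are `p` and `r`; the
transposition of these twins is an isomorphism. -/
theorem isom_opB_apex {G : SimpleGraph V} {q r s p' r' x z t x' z' p : V}
    (h1 : IsB G p q r s p' r') (h2 : IsB G x s z t x' z') : Isom (opB G p q r) (opB G x s z) := by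
  classical
  have e := G.adj_comm
  obtain ⟨nq, np, nr, pr, pq, qr, sp, sq, sr, pp, rr⟩ := h1
  obtain ⟨ny, nx, nz, xz, xy, yz, sx, sy, sz, xx, zz⟩ := h2
  refine isom_of_adj (Equiv.swap s q) fun u v => ?_
  have h1 := (ny p).1 (by grind)
  have h2 := (ny q).1 (by grind)
  have h3 := (ny r).1 (by grind)
  have g1 : G.Adj q p := (nq p).2 (by simp)
  have g2 : G.Adj q r := (nq r).2 (by simp)
  have g3 := g1.symm
  have g4 := g2.symm
  have : t = q ∧ ((x = p ∧ z = r) ∨ (z = p ∧ x = r)) := by grind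
  obtain ⟨rfl, h⟩ := this
  have eu : ∀ u, ¬ G.Adj u u := fun u => G.irrefl
  have e1 := fun w => e w s
  have e2 := fun w => e w t
  rw [Equiv.swap_apply_def, Equiv.swap_apply_def, opB_adj, opB_adj]
  by_cases u1 : u = s
  · grind
  by_cases u2 : u = t
  · grind
  by_cases v1 : v = s
  · grind
  by_cases v2 : v = t
  · grind
  grind

/-- The vertices `p`, `q`, `r`, `y` form a 4-cycle all of whose vertices are adjacent to `s`. The
opposite vertices `q` and `y` have the same neighbors `p`, `r`, `s` and can be exchanged. -/
theorem isom_opB_opposite {G : SimpleGraph V} {q r s p' r' y t x' z' p : V}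
    (h1 : IsB G p q r s p' r') (h2 : IsB G p y r t x' z')
    (hy : y ≠ q) (hys : y ≠ s) : Isom (opB G p q r) (opB G p y r) := by
  classical
  have e := G.adj_comm
  obtain ⟨nq, np, nr, pr, pq, qr, sp, sq, sr, pp, rr⟩ := h1
  obtain ⟨ny, nx, nz, xz, xy, yz, sx, sy, sz, xx, zz⟩ := h2
  refine isom_of_adj (Equiv.swap q y) fun u v => ?_
  have h1 := (np y).1 ((nx y).2 (by simp))
  have h2 := (np t).1 ((nx t).2 (by simp))
  have h3 : ¬ G.Adj q y := by rw [nq]; grind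
  have h4 : t = s := by
    have := (ny t).2 (by simp)
    grind
  subst h4
  have eu : ∀ u, ¬ G.Adj u u := fun u => G.irrefl
  have e1 := fun w => e w q
  have e2 := fun w => e w y
  rw [Equiv.swap_apply_def, Equiv.swap_apply_def, opB_adj, opB_adj]
  by_cases u1 : u = q
  · grind
  by_cases u2 : u = y
  · grind
  by_cases v1 : v = q
  · grind
  by_cases v2 : v = y
  · grind
  grind

theorem opB_opB_comm (G : SimpleGraph V) {p q r x y z : V} (hq : q ≠ x ∧ q ≠ y ∧ q ≠ z)
    (hy : y ≠ p ∧ y ≠ r) : opB (opB G p q r) x y z = opB (opB G x y z) p q r := by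
  ext u v
  simp only [opB_adj]
  grind

/-- The first reduction changes the degree only of `q` and `s`, and neither is one of `x`, `y`, `z`.
The new edge `pr` spoils the induced path only if `x` and `z` are its ends, which is excluded. -/
theorem IsB.canB_opB {G : SimpleGraph V} {p q r s p' r' x y z t x' z' : V}
    (h1 : IsB G p q r s p' r') (h2 : IsB G x y z t x' z')
    (hy : y ≠ p ∧ y ≠ q ∧ y ≠ r ∧ y ≠ s) (hxz : ¬ ((x = p ∧ z = r) ∨ (x = r ∧ z = p))) :
    CanB (opB G p q r) x y z := by
  classical
  have e := G.adj_comm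
  have e' : ∀ u, ¬ G.Adj u u := fun u => G.irrefl
  obtain ⟨nq, np, nr, pr, pq, qr, sp, sq, sr, pp, rr⟩ := h1
  obtain ⟨ny, nx, nz, xz, xy, yz, sx, sy, sz, xx, zz⟩ := h2
  -- If `q` is the further neighbor of an end `x`, then `x` is `p` or `r`, and the new edge replaces
  -- `q` by the other of these two.
  let π : V → V → V := fun x w => if w = q then if x = p then r else p else w
  have hπ : ∀ x w, π x w = if w = q then if x = p then r else p else w := fun _ _ => rfl
  clear_value π
  have h3 : ¬ G.Adj q y := by rw [nq]; grind
  have h4 : q ≠ x ∧ q ≠ z ∧ q ≠ t := by grind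
  have f1 := nx q
  have f2 := nz q
  have f3 := nx p
  have f4 := nz p
  have f5 := nx r
  have f6 := nz r
  rw [e] at f1 f2 f3 f4 f5 f6
  rw [nq] at f1 f2
  rw [np] at f3 f4
  rw [nr] at f5 f6
  have hs : s ≠ x ∧ s ≠ z := by grind
  refine canB_iff.2 ⟨t, π x x', π z z', ?_, ?_, ?_, xz, xy, yz, sx, sy, sz, ?_, ?_⟩
  · intro w
    rw [opB_adj, ny]
    grind
  · intro w
    rw [opB_adj, nx, hπ]
    grind
  · intro w
    rw [opB_adj, nz, hπ]
    grind
  all_goals simp only [hπ]; grind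

/-- Two reductions of the same graph lead to isomorphic graphs, or to graphs that can be reduced
to the same graph by one more step each. -/
theorem CRed.of_step {G : SimpleGraph V} {k : ℕ} (h : CRed G k) :
    (∀ p q r, CanA G p q r → CRed (opA G p q r) (k - 2)) ∧
    (∀ p q r, CanB G p q r → CRed (opB G p q r) (k - 1)) := by
  induction h with
  | base h => exact ⟨fun p q r hc => absurd hc (h.not_canA p q r),
      fun p q r hc => absurd hc (h.not_canB p q r)⟩
  | @stepA G k p q r h hr ih =>
    obtain ⟨p', q', r', h⟩ := canA_iff.1 h
    constructor
    · intro a b c h2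
      obtain ⟨a', b', c', h2⟩ := canA_iff.1 h2
      by_cases hs : ∃ x, (x = p ∨ x = q ∨ x = r) ∧ (x = a ∨ x = b ∨ x = c)
      · obtain ⟨x, hx, hx'⟩ := hs
        exact hr.isom (h.isom_of_shared h2 hx hx')
      have s1 := not_exists.1 hs p
      have s2 := not_exists.1 hs q
      have s3 := not_exists.1 hs r
      have ha : a ≠ p ∧ a ≠ q ∧ a ≠ r := by grind
      have hb : b ≠ p ∧ b ≠ q ∧ b ≠ r := by grind
      have hc : c ≠ p ∧ c ≠ q ∧ c ≠ r := by grind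
      -- This treats disjoint triangles joined by at least two edges; both triangles are listed so
      -- that these edges join their first and second vertices.
      have main : ∀ x y z x' y' z', IsA G x y z x' y' z' → x ≠ p ∧ x ≠ q ∧ x ≠ r →
          y ≠ p ∧ y ≠ q ∧ y ≠ r →
          (x' = p ∨ x' = q ∨ x' = r) ∧ (y' = p ∨ y' = q ∨ y' = r) →
          CRed (opA G x y z) (k - 2) := by
        intro x y z x' y' z' h3 hx hy ⟨hx', hy'⟩
        obtain ⟨w, a1, b1, c1, h4, i, hw⟩ := h.arrange hx' hy' h3.pq'
        have e1 : a1 = x := by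
          have := (h4.np x).1 ((h3.np x').2 (by simp)).symm
          grind
        have e2 : b1 = y := by
          have := (h4.nq y).1 ((h3.nq y').2 (by simp)).symm
          grind
        subst e1 e2
        exact hr.isom (i.trans (isom_of_two_edges h4 h3))
      by_cases hab : (a' = p ∨ a' = q ∨ a' = r) ∧ (b' = p ∨ b' = q ∨ b' = r)
      · exact main _ _ _ _ _ _ h2 ha hb hab
      by_cases hac : (a' = p ∨ a' = q ∨ a' = r) ∧ (c' = p ∨ c' = q ∨ c' = r)
      · have := main _ _ _ _ _ _ h2.swap_qr ha hc hac
        rwa [opA_swap_qr] at this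
      by_cases hbc : (b' = p ∨ b' = q ∨ b' = r) ∧ (c' = p ∨ c' = q ∨ c' = r)
      · have := main _ _ _ _ _ _ h2.swap_pq.swap_qr hb hc hbc
        rw [opA_swap_qr] at this
        exact this.isom (isom_opA_swap h2.pq h2.pr h2.qr).symm
      -- At most one edge joins the triangles. The induction hypothesis performs the second
      -- reduction after the first, and commuting exhibits the first as a step after the second.
      have key := ih.1 a b c (h.canA_opA h2 ha hb hc hab hac hbc)
      rw [opA_opA_comm G ha hb hc] at key
      refine .stepA p q r (h2.canA_opA h ?_ ?_ ?_ ?_ ?_ ?_) key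
      · grind
      · grind
      · grind
      -- The edges between the triangles are the same seen from either side, so `p'`, `q'`, `r'`
      -- inherit the condition on `a'`, `b'`, `c'`.
      all_goals
        intro hcon
        have f1 := fun w => G.adj_comm w p
        have f2 := fun w => G.adj_comm w q
        have f3 := fun w => G.adj_comm w r
        obtain ⟨np, nq, nr, pq, pr, qr, pp, qq, rr, pq', pr', qr'⟩ := h
        obtain ⟨na, nb, nc, ab, ac, bc, aa, bb, cc, ab', ac', bc'⟩ := h2
        have g1 := (np p').2 (by simp)
        have g2 := (nq q').2 (by simp)
        have g3 := (nr r').2 (by simp)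
        have g1 := g1.symm
        have g2 := g2.symm
        have g3 := g3.symm
        grind
    · intro x y z h2
      obtain ⟨s, x', z', h2⟩ := canB_iff.1 h2
      have hp := h.disjoint_isB h2
      have hq := h.swap_pq.disjoint_isB h2
      have hr := h.swap_qr.swap_pq.disjoint_isB h2
      have key := ih.2 x y z (h.canB_opA h2)
      rw [opB_opA_comm G ⟨hp.1, hp.2.1, hp.2.2.1⟩ ⟨hq.1, hq.2.1, hq.2.2.1⟩
        ⟨hr.1, hr.2.1, hr.2.2.1⟩, Nat.sub_right_comm] at key
      exact .stepA p q r (h.canA_opB h2) key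
  | @stepB G k p q r h hr ih =>
    obtain ⟨s, p', r', h⟩ := canB_iff.1 h
    constructor
    · intro a b c h2
      obtain ⟨a', b', c', h2⟩ := canA_iff.1 h2
      have hp := h2.disjoint_isB h
      have hq := h2.swap_pq.disjoint_isB h
      have hr := h2.swap_qr.swap_pq.disjoint_isB h
      have key := ih.1 a b c (h2.canA_opB h)
      rw [← opB_opA_comm G ⟨hp.1, hp.2.1, hp.2.2.1⟩ ⟨hq.1, hq.2.1, hq.2.2.1⟩
        ⟨hr.1, hr.2.1, hr.2.2.1⟩, Nat.sub_right_comm] at key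
      exact .stepB p q r (h2.canB_opA h) key
    · intro x y z h2
      obtain ⟨t, x', z', h2⟩ := canB_iff.1 h2
      by_cases y1 : y = q
      · subst y1
        have g1 := (h.nq x).1 ((h2.nq x).2 (by simp))
        have g2 := (h.nq z).1 ((h2.nq z).2 (by simp))
        have g3 : G.Adj p s := (h.np s).2 (by simp)
        have g4 : G.Adj r s := (h.nr s).2 (by simp)
        have g5 := g3.symm
        have g6 := g4.symm
        have g7 := h2.not_adj
        have g8 := h2.swap.not_adj
        have g9 := h2.pr
        have : (x = p ∧ z = r) ∨ (x = r ∧ z = p) := by grind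
        rcases this with ⟨rfl, rfl⟩ | ⟨rfl, rfl⟩
        · exact hr
        · rwa [opB_swap]
      by_cases y2 : y = p
      · subst y2
        exact hr.isom (isom_opB_adjacent h h2)
      by_cases y3 : y = r
      · subst y3
        rw [← opB_swap] at hr
        exact hr.isom (isom_opB_adjacent h.swap h2)
      by_cases y4 : y = s
      · subst y4
        exact hr.isom (isom_opB_apex h h2)
      -- The last case of interference: both reductions would add the same edge.
      by_cases hxz : (x = p ∧ z = r) ∨ (x = r ∧ z = p)
      · rcases hxz with ⟨rfl, rfl⟩ | ⟨rfl, rfl⟩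
        · exact hr.isom (isom_opB_opposite h h2 y1 y4)
        · have := hr.isom (isom_opB_opposite h h2.swap y1 y4)
          rwa [opB_swap] at this
      have hq : q ≠ x ∧ q ≠ z ∧ q ≠ t := by
        have := h.nq y
        have g1 := (h2.nq x).2 (by simp)
        have g2 := (h2.nq z).2 (by simp)
        have g3 := (h2.nq t).2 (by simp)
        have g1 := g1.symm
        have g2 := g2.symm
        have g3 := g3.symm
        grind
      have key := ih.2 x y z (h.canB_opB h2 ⟨y2, y1, y3, y4⟩ hxz)
      rw [opB_opB_comm G ⟨hq.1, Ne.symm y1, hq.2.1⟩ ⟨y2, y3⟩] at key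
      exact .stepB p q r (h2.canB_opB h ⟨hq.1, Ne.symm y1, hq.2.1, hq.2.2⟩ (by grind)) key

end D3

/-! ### Agreement with reducibility by steps that change the vertex type -/

namespace D3

theorem card_resultA {V : Type} [Finite V] {p q r : V} (hpq : p ≠ q) (hpr : p ≠ r)
    (hqr : q ≠ r) :
    Nat.card (Option {v : V // v ≠ p ∧ v ≠ q ∧ v ≠ r}) = Nat.card V - 2 := by
  have h : Nat.card {v : V // v ≠ p ∧ v ≠ q ∧ v ≠ r} = Nat.card V - 3 := by
    have h1 : ({v : V | v ≠ p ∧ v ≠ q ∧ v ≠ r} : Set V) = ({p, q, r} : Set V)ᶜ := by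
      ext v; simp
    have h2 := Set.ncard_add_ncard_compl ({p, q, r} : Set V)
    rw [Set.ncard_eq_three.2 ⟨p, q, r, hpq, hpr, hqr, rfl⟩, ← h1] at h2
    change ({v : V | v ≠ p ∧ v ≠ q ∧ v ≠ r} : Set V).ncard = _
    omega
  have h3 : 3 ≤ Nat.card V := by
    have := Set.ncard_le_card ({p, q, r} : Set V)
    rwa [Set.ncard_eq_three.2 ⟨p, q, r, hpq, hpr, hqr, rfl⟩] at this
  rw [Finite.card_option, h]
  omega

theorem card_resultB {V : Type} [Finite V] (q : V) :
    Nat.card {v : V // v ≠ q} = Nat.card V - 1 := by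
  have h1 : ({v : V | v ≠ q} : Set V) = ({q} : Set V)ᶜ := by
    ext v; simp
  have h2 := Set.ncard_add_ncard_compl ({q} : Set V)
  rw [Set.ncard_singleton, ← h1] at h2
  change ({v : V | v ≠ q} : Set V).ncard = _
  omega

theorem isK4_of_iso {V : Type} {G : SimpleGraph V} (e : G ≃g (⊤ : SimpleGraph (Fin 4))) :
    IsK4 G := by
  refine ⟨Finset.univ.map e.symm.toEquiv.toEmbedding, by simp, fun u v => ?_⟩
  rw [← e.map_adj_iff]
  simp

theorem iso_of_isK4 {V : Type} {G : SimpleGraph V} (hV : Nat.card V = 4) (h : IsK4 G) :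
    Nonempty (G ≃g (⊤ : SimpleGraph (Fin 4))) := by
  have : Finite V := Nat.finite_of_card_ne_zero (by omega)
  have := Fintype.ofFinite V
  obtain ⟨A, hA, h⟩ := h
  have hA' : A = Finset.univ := by
    apply Finset.eq_univ_of_card
    rw [hA, ← hV, Nat.card_eq_fintype_card]
  subst hA'
  have hG : G = ⊤ := by
    ext u v
    simp [h]
  subst hG
  exact ⟨SimpleGraph.Iso.completeGraph (Finite.equivFinOfCardEq hV)⟩

/-- `IsK4` tolerates isolated vertices. The counter excludes them: when it reaches 4, the actual
graph has just four vertices, which are those of the $K_4$. -/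
theorem CRed.reducible {V : Type} {G : SimpleGraph V} {k : ℕ} (h : CRed G k) :
    ∀ {V' : Type} {f : V' → V} {H : SimpleGraph V'}, Finite V' → Emb f H G → Nat.card V' = k →
      Reducible H := by
  induction h with
  | base h =>
    intro V' f H _ hf hk
    obtain ⟨A, hA, h⟩ := h
    have hK : IsK4 H := by
      classical
      have := Fintype.ofFinite V'
      have hsub : A ⊆ Finset.univ.map ⟨f, hf.inj⟩ := by
        intro u hu
        obtain ⟨v, hv, huv⟩ : ∃ v ∈ A, v ≠ u :=
          Finset.exists_mem_ne (by omega) u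
        obtain ⟨u', rfl⟩ := hf.range u v ((h u v).2 ⟨hu, hv, huv.symm⟩)
        simp
      have hA' := Finset.eq_of_subset_of_card_le hsub (by
        rw [Finset.card_map, hA, ← hk, Nat.card_eq_fintype_card, Finset.card_univ])
      refine ⟨Finset.univ, by rw [Finset.card_univ, ← Nat.card_eq_fintype_card, hk],
        fun u v => ?_⟩
      rw [← hf.adj, h, hA']
      simp [hf.inj.eq_iff]
    exact ⟨⟨V', H⟩, .refl, iso_of_isK4 hk hK⟩
  | stepA p q r h _ ih =>
    intro V' f H _ hf hk
    obtain ⟨p, q, r, rfl, rfl, rfl, h'⟩ := hf.exists_canA h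
    have hc := card_resultA h'.adj_pq.ne h'.adj_pr.ne h'.adj_qr.ne
    obtain ⟨K, hK, e⟩ := ih inferInstance ((hf.opA p q r).comp (emb_resultA h')) (by rw [hc, hk])
    exact ⟨K, .head (.d3a H p q r h') hK, e⟩
  | stepB p q r h _ ih =>
    intro V' f H _ hf hk
    obtain ⟨p, q, r, rfl, rfl, rfl, h'⟩ := hf.exists_canB h
    obtain ⟨K, hK, e⟩ := ih inferInstance ((hf.opB p q r).comp (emb_resultB h'))
      (by rw [card_resultB, hk])
    exact ⟨K, .head (.d3b H p q r h') hK, e⟩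

theorem Reducible.cRed {V V' : Type} [Finite V'] {f : V' → V} {H : SimpleGraph V'}
    {G : SimpleGraph V} (hf : Emb f H G) (h : Reducible H) : CRed G (Nat.card V') := by
  obtain ⟨K, hK, ⟨e⟩⟩ := h
  suffices ∀ X : Graph, Relation.ReflTransGen Step X K → Finite X.1 →
      ∀ (f : X.1 → V) (G : SimpleGraph V), Emb f X.2 G → CRed G (Nat.card X.1) from
    this ⟨V', H⟩ hK ‹_› f G hf
  intro X hX
  induction hX using Relation.ReflTransGen.head_induction_on with
  | refl =>
    intro _ f G hf
    rw [Nat.card_congr e.toEquiv, Nat.card_fin]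
    exact .base ((isK4_of_iso e).map hf)
  | head hstep _ ih =>
    intro hfin f G hf
    cases hstep with
    | d3a H p q r h =>
      have : Finite _ := hfin
      have := ih inferInstance _ _ ((hf.opA p q r).comp (emb_resultA h))
      rw [card_resultA h.adj_pq.ne h.adj_pr.ne h.adj_qr.ne] at this
      exact .stepA _ _ _ (hf.canA h) this
    | d3b H p q r h =>
      have : Finite _ := hfin
      have := ih inferInstance _ _ ((hf.opB p q r).comp (emb_resultB h))
      rw [card_resultB] at this
      exact .stepB _ _ _ (hf.canB h) this

theorem reducible_iff_cRed {V V' : Type} [Finite V'] {f : V' → V} {H : SimpleGraph V'}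
    {G : SimpleGraph V} (hf : Emb f H G) : Reducible H ↔ CRed G (Nat.card V') :=
  ⟨fun h => h.cRed hf, fun h => h.reducible inferInstance hf rfl⟩

/-- This equivalence and `CRed.iff_opB` are what justifies greedy reduction. -/
theorem CRed.iff_opA {V : Type} {G : SimpleGraph V} {k : ℕ} {p q r : V} (h : CanA G p q r) :
    CRed G k ↔ CRed (opA G p q r) (k - 2) :=
  ⟨fun hG => hG.of_step.1 p q r h, .stepA p q r h⟩

theorem CRed.iff_opB {V : Type} {G : SimpleGraph V} {k : ℕ} {p q r : V} (h : CanB G p q r) :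
    CRed G k ↔ CRed (opB G p q r) (k - 1) :=
  ⟨fun hG => hG.of_step.2 p q r h, .stepB p q r h⟩

/-! ### Neighborhoods as finite sets -/

/-- `F u` is the neighborhood of `u`. -/
def Nbhd {V : Type} (G : SimpleGraph V) (F : V → Finset V) : Prop := ∀ u w, w ∈ F u ↔ G.Adj u w

theorem Nbhd.degThree_iff {V : Type} {G : SimpleGraph V} {F : V → Finset V} (hF : Nbhd G F)
    {u : V} : DegThree G u ↔ (F u).card = 3 := by
  have : G.neighborSet u = F u := by
    ext w
    simp [hF u w]
  rw [DegThree, this, Set.ncard_coe_finset]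

/-- The neighborhoods after rule D3a. -/
def nbhdA (F : ℕ → Finset ℕ) (p q r p' q' r' : ℕ) (u : ℕ) : Finset ℕ :=
  if u = p then {p', q', r'} else if u = q ∨ u = r then ∅
  else if u = q' then insert p ((F u).erase q) else if u = r' then insert p ((F u).erase r)
  else F u

/-- The neighborhoods after rule D3b. -/
def nbhdB (F : ℕ → Finset ℕ) (p q r s : ℕ) (u : ℕ) : Finset ℕ :=
  if u = q then ∅ else if u = p then insert r ((F u).erase q)
  else if u = r then insert p ((F u).erase q) else if u = s then (F u).erase q
  else F u

section

variable {G : SimpleGraph ℕ} {F : ℕ → Finset ℕ} {p q r s p' q' r' n : ℕ}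

theorem Nbhd.opA (hF : Nbhd G F) (h : IsA G p q r p' q' r') :
    Nbhd (opA G p q r) (nbhdA F p q r p' q' r') := by
  intro u w
  have e := G.adj_comm u
  have e' : ∀ u, ¬ G.Adj u u := fun u => G.irrefl
  obtain ⟨np, nq, nr, pq, pr, qr, pp, qq, rr, pq', pr', qr'⟩ := h
  rw [nbhdA, opA_adj]
  have hF' := hF u w
  split_ifs with h1 h2 h3 h4
  · subst h1
    simp only [Finset.mem_insert, Finset.mem_singleton]
    grind
  · simp only [Finset.notMem_empty]
    grind
  · simp only [Finset.mem_insert, Finset.mem_erase]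
    grind
  · simp only [Finset.mem_insert, Finset.mem_erase]
    grind
  · grind

theorem Nbhd.opB (hF : Nbhd G F) (h : IsB G p q r s p' r') :
    Nbhd (opB G p q r) (nbhdB F p q r s) := by
  intro u w
  have e := G.adj_comm u
  have e' : ∀ u, ¬ G.Adj u u := fun u => G.irrefl
  obtain ⟨nq, np, nr, pr, pq, qr, sp, sq, sr, pp, rr⟩ := h
  rw [nbhdB, opB_adj]
  have hF' := hF u w
  split_ifs with h1 h2 h3 h4
  · simp only [Finset.notMem_empty]
    grind
  · simp only [Finset.mem_insert, Finset.mem_erase]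
    grind
  · simp only [Finset.mem_insert, Finset.mem_erase]
    grind
  · simp only [Finset.mem_erase]
    grind
  · grind

/-- The outside neighbors of `q` and `r` only exchange a neighbor for `p`, and `p` again has three
neighbors, so no surviving vertex changes its degree. -/
theorem IsA.card_nbhdA (h : IsA G p q r p' q' r') (hF : Nbhd G F) (u : ℕ) :
    (nbhdA F p q r p' q' r' u).card = if u = q ∨ u = r then 0 else (F u).card := by
  have h3 : (F p).card = 3 := hF.degThree_iff.1 (canA_iff.2 ⟨_, _, _, h⟩).deg_p
  obtain ⟨np, nq, nr, pq, pr, qr, pp, qq, rr, pq', pr', qr'⟩ := h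
  rw [nbhdA]
  by_cases h1 : u = p
  · subst h1
    simp only [if_true, pq, pr, or_self, if_false, h3]
    exact Finset.card_eq_three.2 ⟨_, _, _, pq', pr', qr', rfl⟩
  rw [if_neg h1]
  split_ifs with h2 h4 h5
  · rfl
  · rw [Finset.card_insert_of_notMem, Finset.card_erase_of_mem]
    · have := Finset.card_pos.2 ⟨q, (hF u q).2 (by rw [G.adj_comm, nq]; simp [h4])⟩
      omega
    · rw [hF, G.adj_comm, nq]; simp [h4]
    · rw [Finset.mem_erase, hF, G.adj_comm, np]; grind
  · rw [Finset.card_insert_of_notMem, Finset.card_erase_of_mem]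
    · have := Finset.card_pos.2 ⟨r, (hF u r).2 (by rw [G.adj_comm, nr]; simp [h5])⟩
      omega
    · rw [hF, G.adj_comm, nr]; simp [h5]
    · rw [Finset.mem_erase, hF, G.adj_comm, np]; grind
  · rfl

/-- Each end exchanges `q` for the other end. The apex loses `q` without replacement. -/
theorem IsB.card_nbhdB (h : IsB G p q r s p' r') (hF : Nbhd G F) (u : ℕ) :
    (nbhdB F p q r s u).card =
      if u = q then 0 else if u = s then (F u).card - 1 else (F u).card := by
  obtain ⟨nq, np, nr, pr, pq, qr, sp, sq, sr, pp, rr⟩ := h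
  rw [nbhdB]
  by_cases h1 : u = q
  · simp [h1]
  rw [if_neg h1, if_neg h1]
  split_ifs with h2 h3 h4 h5 h6
  · omega
  · rw [Finset.card_insert_of_notMem, Finset.card_erase_of_mem]
    · have := Finset.card_pos.2 ⟨q, (hF u q).2 (by rw [h2, np]; simp)⟩
      omega
    · rw [hF, h2, np]; simp
    · rw [Finset.mem_erase, hF, h2, np]; grind
  · omega
  · rw [Finset.card_insert_of_notMem, Finset.card_erase_of_mem]
    · have := Finset.card_pos.2 ⟨q, (hF u q).2 (by rw [h4, nr]; simp)⟩
      omega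
    · rw [hF, h4, nr]; simp
    · rw [Finset.mem_erase, hF, h4, nr]; grind
  · rw [Finset.card_erase_of_mem]
    rw [hF, G.adj_comm, nq]; simp [h6]
  · rfl

theorem sum_card_nbhdA (h : IsA G p q r p' q' r') (hF : Nbhd G F)
    (hn : ∀ u w, G.Adj u w → u < n) :
    ∑ u ∈ Finset.range n, (nbhdA F p q r p' q' r' u).card + 6 =
      ∑ u ∈ Finset.range n, (F u).card := by
  have hc := canA_iff.2 ⟨_, _, _, h⟩
  have hq : (F q).card = 3 := hF.degThree_iff.1 hc.deg_q
  have hr : (F r).card = 3 := hF.degThree_iff.1 hc.deg_r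
  have hqn := Finset.mem_range.2 (hn _ _ hc.adj_qr)
  have hrn : r ∈ (Finset.range n).erase q :=
    Finset.mem_erase.2 ⟨h.qr.symm, Finset.mem_range.2 (hn _ _ hc.adj_qr.symm)⟩
  rw [← Finset.add_sum_erase _ _ hqn, ← Finset.add_sum_erase _ _ hrn,
    ← Finset.add_sum_erase (Finset.range n) (fun u => (F u).card) hqn,
    ← Finset.add_sum_erase _ (fun u => (F u).card) hrn]
  have : ∑ x ∈ ((Finset.range n).erase q).erase r, (nbhdA F p q r p' q' r' x).card =
      ∑ x ∈ ((Finset.range n).erase q).erase r, (F x).card := by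
    refine Finset.sum_congr rfl fun x hx => ?_
    simp only [Finset.mem_erase] at hx
    rw [h.card_nbhdA hF, if_neg]
    tauto
  rw [this, h.card_nbhdA hF, h.card_nbhdA hF, hq, hr]
  simp only [true_or, or_true, if_true]
  omega

theorem sum_card_nbhdB (h : IsB G p q r s p' r') (hF : Nbhd G F)
    (hn : ∀ u w, G.Adj u w → u < n) :
    ∑ u ∈ Finset.range n, (nbhdB F p q r s u).card + 4 =
      ∑ u ∈ Finset.range n, (F u).card := by
  have hc := canB_iff.2 ⟨_, _, _, h⟩
  have hq : (F q).card = 3 := hF.degThree_iff.1 hc.deg_q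
  have hs' : G.Adj s q := by rw [G.adj_comm, h.nq]; simp
  have hs : 0 < (F s).card := Finset.card_pos.2 ⟨q, (hF s q).2 hs'⟩
  have hqn := Finset.mem_range.2 (hn _ _ hc.adj_qr)
  have hsn : s ∈ (Finset.range n).erase q :=
    Finset.mem_erase.2 ⟨h.sq, Finset.mem_range.2 (hn _ _ hs')⟩
  rw [← Finset.add_sum_erase _ _ hqn, ← Finset.add_sum_erase _ _ hsn,
    ← Finset.add_sum_erase (Finset.range n) (fun u => (F u).card) hqn,
    ← Finset.add_sum_erase _ (fun u => (F u).card) hsn]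
  have : ∑ x ∈ ((Finset.range n).erase q).erase s, (nbhdB F p q r s x).card =
      ∑ x ∈ ((Finset.range n).erase q).erase s, (F x).card := by
    refine Finset.sum_congr rfl fun x hx => ?_
    simp only [Finset.mem_erase] at hx
    rw [h.card_nbhdB hF, if_neg (by tauto), if_neg (by tauto)]
  rw [this, h.card_nbhdB hF, h.card_nbhdB hF, hq]
  simp only [if_true, h.sq, if_false]
  omega

theorem opA_lt (hn : ∀ u w, G.Adj u w → u < n) (h : IsA G p q r p' q' r') (u w : ℕ)
    (huw : (opA G p q r).Adj u w) : u < n := by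
  rw [opA_adj] at huw
  obtain ⟨-, -, -, -, -, h1 | ⟨rfl, -⟩ | ⟨-, h1 | h1⟩⟩ := huw
  · exact hn _ _ h1
  · exact hn _ q ((h.np q).2 (by simp))
  · exact hn _ _ h1.symm
  · exact hn _ _ h1.symm

theorem opB_lt (hn : ∀ u w, G.Adj u w → u < n) (h : IsB G p q r s p' r') (u w : ℕ)
    (huw : (opB G p q r).Adj u w) : u < n := by
  rw [opB_adj] at huw
  obtain ⟨-, -, -, h1 | ⟨rfl, -⟩ | ⟨rfl, -⟩⟩ := huw
  · exact hn _ _ h1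
  · exact hn _ q ((h.np q).2 (by simp))
  · exact hn _ q ((h.nr q).2 (by simp))

theorem IsK4.sum_card (h : IsK4 G) (hF : Nbhd G F) (hn : ∀ u w, G.Adj u w → u < n) :
    ∑ u ∈ Finset.range n, (F u).card = 12 := by
  obtain ⟨A, hA, h⟩ := h
  have hsub : A ⊆ Finset.range n := by
    intro u hu
    obtain ⟨v, hv, huv⟩ : ∃ v ∈ A, v ≠ u := Finset.exists_mem_ne (by omega) u
    exact Finset.mem_range.2 (hn u v ((h u v).2 ⟨hu, hv, huv.symm⟩))
  have h1 : ∀ u ∈ A, (F u).card = 3 := by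
    intro u hu
    have : F u = A.erase u := by
      ext w
      rw [hF, h, Finset.mem_erase]
      exact ⟨fun h => ⟨h.2.2.symm, h.2.1⟩, fun h => ⟨hu, h.2, h.1.symm⟩⟩
    rw [this, Finset.card_erase_of_mem hu, hA]
  rw [← Finset.sum_subset hsub, Finset.sum_congr rfl h1, Finset.sum_const, hA]
  · rfl
  · intro u _ hu
    rw [Finset.card_eq_zero, Finset.eq_empty_iff_forall_notMem]
    intro w hw
    exact hu ((h u w).1 ((hF u w).1 hw)).1

/-- Each of the four vertices has degree at most 3, so degree sum 12 forces equality everywhere. -/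
theorem isK4_of_sum_card {A : Finset ℕ} (hA : A.card = 4) (hF : Nbhd G F)
    (hGA : ∀ u w, G.Adj u w → u ∈ A) (hAn : ∀ u ∈ A, u < n)
    (hs : ∑ u ∈ Finset.range n, (F u).card = 12) : IsK4 G := by
  have hsub : A ⊆ Finset.range n := fun u hu => Finset.mem_range.2 (hAn u hu)
  rw [← Finset.sum_subset hsub] at hs
  · have hFs : ∀ u ∈ A, F u ⊆ A.erase u := by
      intro u _ w hw
      have := (hF u w).1 hw
      exact Finset.mem_erase.2 ⟨this.ne', hGA _ _ this.symm⟩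
    have hle : ∀ u ∈ A, (F u).card ≤ 3 := by
      intro u hu
      have := Finset.card_le_card (hFs u hu)
      rwa [Finset.card_erase_of_mem hu, hA] at this
    have heq : ∀ u ∈ A, (F u).card = 3 := by
      refine (Finset.sum_eq_sum_iff_of_le hle).1 ?_
      rw [hs, Finset.sum_const, hA]
      rfl
    refine ⟨A, hA, fun u v => ⟨fun h => ⟨hGA _ _ h, hGA _ _ h.symm, h.ne⟩, ?_⟩⟩
    rintro ⟨hu, hv, huv⟩
    have := Finset.eq_of_subset_of_card_le (hFs u hu) (by
      rw [Finset.card_erase_of_mem hu, hA, heq u hu])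
    rw [← hF, this]
    exact Finset.mem_erase.2 ⟨huv.symm, hv⟩
  · intro u _ hu
    rw [Finset.card_eq_zero, Finset.eq_empty_iff_forall_notMem]
    intro w hw
    exact hu (hGA u w ((hF u w).1 hw))

/-- A $K_4$ satisfies $12 \le 16$, and undoing a step adds 6 to the degree sum for two vertices or 4
for one vertex. The bound `4 ≤ k` is carried along because it shows that the subtractions from the
counter were not truncated. -/
theorem CRed.sum_card_le {k : ℕ} (h : CRed G k) :
    ∀ {F : ℕ → Finset ℕ}, Nbhd G F → (∀ u w, G.Adj u w → u < n) →
      4 ≤ k ∧ ∑ u ∈ Finset.range n, (F u).card ≤ 4 * k := by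
  induction h with
  | base h =>
    intro F hF hn
    rw [h.sum_card hF hn]
    omega
  | stepA p q r h _ ih =>
    intro F hF hn
    obtain ⟨_, _, _, h⟩ := canA_iff.1 h
    have h1 := ih (hF.opA h) (opA_lt hn h)
    have h2 := sum_card_nbhdA h hF hn
    omega
  | stepB p q r h _ ih =>
    intro F hF hn
    obtain ⟨_, _, _, h⟩ := canB_iff.1 h
    have h1 := ih (hF.opB h) (opB_lt hn h)
    have h2 := sum_card_nbhdB h hF hn
    omega

end

end D3

/-! ### A small array language, compiled to the random access machine -/

namespace ArrayLang

/-- The registers. -/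
inductive Reg
  | n | sp | alive | dsum | v | x | y | z | x' | y' | done | t₁ | t₂ | t₃ | tmp | ptr | out
  deriving DecidableEq

/-- The arrays: degrees, the three neighbors of a vertex of degree three, sums of neighbors, and a
stack of vertices. -/
inductive Field
  | deg | nb₁ | nb₂ | nb₃ | sum | stack
  deriving DecidableEq

/-- The number of the machine register that holds a register. -/
def Reg.idx : Reg → ℕ
  | n => 1 | sp => 2 | alive => 3 | dsum => 4 | v => 5 | x => 6 | y => 7 | z => 8 | x' => 9
  | y' => 10 | done => 11 | t₁ => 12 | t₂ => 13 | t₃ => 14 | tmp => 15 | ptr => 16 | out => 17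

/-- The offset of an array within the records of eight words that hold one entry of each array. -/
def Field.idx : Field → ℕ
  | deg => 0 | nb₁ => 1 | nb₂ => 2 | nb₃ => 3 | sum => 4 | stack => 5

theorem Reg.idx_injective : Function.Injective Reg.idx := by
  intro a b h
  cases a <;> cases b <;> first | rfl | exact absurd h (by decide)

theorem Reg.idx_pos (r : Reg) : 0 < r.idx := by
  cases r <;> decide

theorem Field.idx_injective : Function.Injective Field.idx := by
  intro a b h
  cases a <;> cases b <;> first | rfl | exact absurd h (by decide)

theorem Field.idx_lt (f : Field) : f.idx < 8 := by
  cases f <;> decide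

/-- States. -/
structure St where
  reg : Reg → ℕ
  arr : Field → ℕ → ℕ

/-- Expressions; `inp r` is the input word whose address is in register `r`. -/
inductive Ex
  | const (k : ℕ)
  | reg (r : Reg)
  | arr (f : Field) (r : Reg)
  | inp (r : Reg)
  | add (a b : Ex)
  | sub (a b : Ex)
  | lt (a b : Ex)
  | eq (a b : Ex)
  | or (a b : Ex)

/-- Programs. -/
inductive Pr
  | skip
  | set (r : Reg) (e : Ex)
  | put (f : Field) (r : Reg) (e : Ex)
  | seq (c d : Pr)
  | ite (e : Ex) (c d : Pr)
  | loop (e : Ex) (c : Pr)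

/-- An input of `N` words, a bound `M` for all values in registers and arrays, and a word bound
`W` that is large enough for addresses. -/
structure Env where
  inp : ℕ → ℕ
  N : ℕ
  M : ℕ
  W : ℕ
  N_lt : N < M
  inp_lt : ∀ a < N, inp a < M
  le_M : 16 ≤ M
  le_W : N + 8 * M + 8 ≤ W

/-- The value of an expression. -/
def Ex.val (E : Env) (h : St) : Ex → ℕ
  | const k => k
  | reg r => h.reg r
  | arr f r => h.arr f (h.reg r)
  | inp r => E.inp (h.reg r)
  | add a b => a.val E h + b.val E h
  | sub a b => a.val E h - b.val E h
  | lt a b => if a.val E h < b.val E h then 1 else 0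
  | eq a b => if a.val E h = b.val E h then 1 else 0
  | or a b => if a.val E h = 0 ∧ b.val E h = 0 then 0 else 1

/-- No sum that occurs in the evaluation exceeds the bound, and only the input is read as input. -/
def Ex.Safe (E : Env) (h : St) : Ex → Prop
  | const k => k < 16
  | reg _ => True
  | arr _ _ => True
  | inp r => h.reg r < E.N
  | add a b => a.Safe E h ∧ b.Safe E h ∧ a.val E h + b.val E h < E.M
  | sub a b => a.Safe E h ∧ b.Safe E h
  | lt a b => a.Safe E h ∧ b.Safe E h
  | eq a b => a.Safe E h ∧ b.Safe E h
  | or a b => a.Safe E h ∧ b.Safe E h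

/-- The state after an assignment to a register. -/
def St.setReg (h : St) (r : Reg) (a : ℕ) : St := { h with reg := Function.update h.reg r a }

/-- The state after an assignment to an array entry. -/
def St.setArr (h : St) (f : Field) (i a : ℕ) : St :=
  { h with arr := Function.update h.arr f (Function.update (h.arr f) i a) }

@[simp] theorem St.setReg_reg (h : St) (r r' : Reg) (a : ℕ) :
    (h.setReg r a).reg r' = if r' = r then a else h.reg r' := by
  simp [St.setReg, Function.update_apply]

@[simp] theorem St.setReg_arr (h : St) (r : Reg) (a : ℕ) : (h.setReg r a).arr = h.arr := rfl

@[simp] theorem St.setArr_reg (h : St) (f : Field) (i a : ℕ) : (h.setArr f i a).reg = h.reg := rfl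

@[simp] theorem St.setArr_arr (h : St) (f f' : Field) (i j a : ℕ) :
    (h.setArr f i a).arr f' j = if f' = f ∧ j = i then a else h.arr f' j := by
  by_cases hf : f' = f
  · subst hf
    simp [St.setArr, Function.update_apply]
  · simp [St.setArr, hf]

/-- Weakest preconditions of loop-free programs. -/
def wp (E : Env) : Pr → (St → Prop) → St → Prop
  | .skip, Q, h => Q h
  | .set r e, Q, h => e.Safe E h ∧ Q (h.setReg r (e.val E h))
  | .put f r e, Q, h => e.Safe E h ∧ Q (h.setArr f (h.reg r) (e.val E h))
  | .seq c d, Q, h => wp E c (wp E d Q) h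
  | .ite e c d, Q, h => e.Safe E h ∧ (e.val E h ≠ 0 → wp E c Q h) ∧ (e.val E h = 0 → wp E d Q h)
  | .loop _ _, _, _ => False

theorem wp_mono {E : Env} {c : Pr} {Q Q' : St → Prop} {h : St} (hc : wp E c Q h)
    (hQ : ∀ h', Q h' → Q' h') : wp E c Q' h := by
  induction c generalizing Q Q' h with
  | skip => exact hQ _ hc
  | set r e => exact ⟨hc.1, hQ _ hc.2⟩
  | put f r e => exact ⟨hc.1, hQ _ hc.2⟩
  | seq c d ihc ihd => exact ihc hc fun h' hd => ihd hd hQ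
  | ite e c d ihc ihd => exact ⟨hc.1, fun he => ihc (hc.2.1 he) hQ, fun he => ihd (hc.2.2 he) hQ⟩
  | loop e c => exact hc

/-- The address of an array entry whose index is in register `r`. -/
def addr (f : Field) (r : Reg) : RAM.Expr :=
  let r₁ : RAM.Expr := .reg r.idx
  let r₂ := r₁.add r₁
  let r₄ := r₂.add r₂
  (RAM.Expr.reg 0).add ((r₄.add r₄).add (.const f.idx))

/-- Compilation of expressions; machine register `0` holds the length of the input. -/
def Ex.compile : Ex → RAM.Expr
  | const k => .const k
  | reg r => .reg r.idx
  | arr f r => .load (addr f r)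
  | inp r => .load (.reg r.idx)
  | add a b => .add a.compile b.compile
  | sub a b => .sub a.compile b.compile
  | lt a b => .lt a.compile b.compile
  | eq a b => .eq a.compile b.compile
  | or a b => .lt (.const 0) (.add a.compile b.compile)

/-- Compilation of programs. -/
def Pr.compile : Pr → RAM.Prog
  | skip => .skip
  | set r e => .assign r.idx e.compile
  | put f r e => .store (addr f r) e.compile
  | seq c d => .seq c.compile d.compile
  | ite e c d => .cond e.compile c.compile d.compile
  | .loop e c => .loop e.compile c.compile

/-- An upper bound for the running time of a loop-free program. -/
def Pr.cost : Pr → ℕ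
  | skip => 1
  | set _ e => e.compile.cost + 1
  | put f r e => (addr f r).cost + e.compile.cost + 1
  | seq c d => c.cost + d.cost
  | ite e c d => e.compile.cost + 1 + (c.cost + d.cost)
  | .loop _ _ => 0

/-- The machine state `σ` represents the state `h`. -/
structure Rel (E : Env) (σ : RAM.State) (h : St) : Prop where
  base : σ.reg 0 = E.N
  reg : ∀ r : Reg, σ.reg r.idx = h.reg r
  arr : ∀ (f : Field) (i : ℕ), σ.mem (E.N + (8 * i + f.idx)) = h.arr f i
  inp : ∀ a < E.N, σ.mem a = E.inp a
  reg_lt : ∀ r, h.reg r < E.M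
  arr_lt : ∀ f i, h.arr f i < E.M

theorem Rel.addr {E : Env} {σ : RAM.State} {h : St} (hr : Rel E σ h) (f : Field) (r : Reg) :
    (addr f r).Fits E.W σ ∧ (addr f r).val σ = E.N + (8 * h.reg r + f.idx) := by
  have h1 := hr.reg_lt r
  have h2 := f.idx_lt
  have h3 := E.le_W
  have h4 := E.le_M
  simp only [ArrayLang.addr, RAM.Expr.Fits, RAM.Expr.val, hr.reg, hr.base]
  and_intros <;> omega

/-- Safe values stay below `E.M`. An address is then below `E.N + 8 * E.M + 8`, and the sum that
implements `or` is below `2 * E.M`, so everything fits below `E.W`. -/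
theorem Rel.expr {E : Env} {σ : RAM.State} {h : St} (hr : Rel E σ h) (e : Ex)
    (he : e.Safe E h) :
    e.compile.Fits E.W σ ∧ e.compile.val σ = e.val E h ∧ e.val E h < E.M := by
  have h3 := E.le_W
  have h4 := E.le_M
  induction e with
  | const k =>
    simp only [Ex.Safe] at he
    simp only [Ex.compile, RAM.Expr.Fits, RAM.Expr.val, Ex.val]
    exact ⟨by omega, trivial, by omega⟩
  | reg r =>
    have := hr.reg_lt r
    simp only [Ex.compile, RAM.Expr.Fits, RAM.Expr.val, Ex.val, hr.reg]
    exact ⟨by omega, trivial, by omega⟩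
  | arr f r =>
    obtain ⟨h1, h2⟩ := hr.addr f r
    have := hr.arr_lt f (h.reg r)
    simp only [Ex.compile, RAM.Expr.Fits, RAM.Expr.val, Ex.val, h2, hr.arr]
    exact ⟨⟨h1, by omega⟩, trivial, this⟩
  | inp r =>
    have h1 := E.inp_lt _ he
    have h2 := hr.reg_lt r
    simp only [Ex.compile, RAM.Expr.Fits, RAM.Expr.val, Ex.val, hr.reg, hr.inp _ he]
    exact ⟨⟨by omega, by omega⟩, trivial, by omega⟩
  | add a b iha ihb =>
    obtain ⟨ha, hb, hab⟩ := he
    obtain ⟨a1, a2, a3⟩ := iha ha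
    obtain ⟨b1, b2, b3⟩ := ihb hb
    simp only [Ex.compile, RAM.Expr.Fits, RAM.Expr.val, Ex.val, a2, b2]
    exact ⟨⟨a1, b1, by omega⟩, trivial, hab⟩
  | sub a b iha ihb =>
    obtain ⟨a1, a2, a3⟩ := iha he.1
    obtain ⟨b1, b2, b3⟩ := ihb he.2
    simp only [Ex.compile, RAM.Expr.Fits, RAM.Expr.val, Ex.val, a2, b2]
    exact ⟨⟨a1, b1⟩, trivial, by omega⟩
  | lt a b iha ihb =>
    obtain ⟨a1, a2, a3⟩ := iha he.1
    obtain ⟨b1, b2, b3⟩ := ihb he.2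
    simp only [Ex.compile, RAM.Expr.Fits, RAM.Expr.val, Ex.val, a2, b2]
    exact ⟨⟨a1, b1, by omega⟩, trivial, by split_ifs <;> omega⟩
  | eq a b iha ihb =>
    obtain ⟨a1, a2, a3⟩ := iha he.1
    obtain ⟨b1, b2, b3⟩ := ihb he.2
    simp only [Ex.compile, RAM.Expr.Fits, RAM.Expr.val, Ex.val, a2, b2]
    exact ⟨⟨a1, b1, by omega⟩, trivial, by split_ifs <;> omega⟩
  | or a b iha ihb =>
    obtain ⟨a1, a2, a3⟩ := iha he.1
    obtain ⟨b1, b2, b3⟩ := ihb he.2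
    simp only [Ex.compile, RAM.Expr.Fits, RAM.Expr.val, Ex.val, a2, b2]
    exact ⟨⟨by omega, ⟨a1, b1, by omega⟩, by omega⟩, by split_ifs <;> omega,
      by split_ifs <;> omega⟩

theorem Rel.setReg {E : Env} {σ : RAM.State} {h : St} (hr : Rel E σ h) (r : Reg) {a : ℕ}
    (ha : a < E.M) :
    Rel E { σ with reg := Function.update σ.reg r.idx a } (h.setReg r a) where
  base := by
    rw [← hr.base]
    exact Function.update_of_ne r.idx_pos.ne _ _
  reg r' := by
    simp only [St.setReg_reg, Function.update_apply, Reg.idx_injective.eq_iff, hr.reg]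
  arr := hr.arr
  inp := hr.inp
  reg_lt r' := by
    rw [St.setReg_reg]
    split_ifs
    · exact ha
    · exact hr.reg_lt r'
  arr_lt := hr.arr_lt

/-- Offsets are below the record size 8, so distinct entries have distinct addresses, and all of
them lie behind the input. -/
theorem Rel.setArr {E : Env} {σ : RAM.State} {h : St} (hr : Rel E σ h) (f : Field) (i : ℕ)
    {a : ℕ} (ha : a < E.M) :
    Rel E { σ with mem := Function.update σ.mem (E.N + (8 * i + f.idx)) a } (h.setArr f i a) where
  base := hr.base
  reg := hr.reg
  arr f' j := by
    have h1 := f.idx_lt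
    have h2 := f'.idx_lt
    simp only [St.setArr_arr, Function.update_apply, hr.arr]
    by_cases e : f' = f ∧ j = i
    · simp [e]
    · rw [if_neg e, if_neg]
      intro e'
      exact e ⟨Field.idx_injective (by omega), by omega⟩
  inp b hb := by
    simp only [Function.update_apply]
    rw [if_neg (by omega)]
    exact hr.inp b hb
  reg_lt := hr.reg_lt
  arr_lt f' j := by
    rw [St.setArr_arr]
    split_ifs
    · exact ha
    · exact hr.arr_lt f' j

/-- Total correctness with a time bound. -/
def Triple (E : Env) (P : St → Prop) (c : Pr) (T : ℕ) (Q : St → Prop) : Prop :=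
  ∀ σ h, Rel E σ h → P h → ∃ t τ h', RAM.Exec E.W c.compile σ t τ ∧ t ≤ T ∧ Rel E τ h' ∧ Q h'

theorem Triple.of_wp {E : Env} {P Q : St → Prop} {c : Pr} (h : ∀ s, P s → wp E c Q s) :
    Triple E P c c.cost Q := by
  intro σ s hr hP
  have := h s hP
  clear h hP P
  induction c generalizing σ s Q with
  | skip => exact ⟨_, σ, s, .skip σ, le_rfl, hr, this⟩
  | set r e =>
    obtain ⟨h1, h2, h3⟩ := hr.expr e this.1
    refine ⟨_, _, _, .assign _ _ _ h1, le_rfl, ?_, this.2⟩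
    rw [h2]
    exact hr.setReg r h3
  | put f r e =>
    obtain ⟨h1, h2, h3⟩ := hr.expr e this.1
    obtain ⟨h4, h5⟩ := hr.addr f r
    refine ⟨_, _, _, .store _ _ _ h4 h1, le_rfl, ?_, this.2⟩
    rw [h2, h5]
    exact hr.setArr f _ h3
  | seq c d ihc ihd =>
    obtain ⟨t, τ, s', h1, h2, h3, h4⟩ := ihc σ s hr this
    obtain ⟨t', τ', s'', h5, h6, h7, h8⟩ := ihd τ s' h3 h4
    exact ⟨_, _, _, .seq h1 h5, Nat.add_le_add h2 h6, h7, h8⟩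
  | ite e c d ihc ihd =>
    obtain ⟨h1, h2, h3⟩ := hr.expr e this.1
    by_cases he : e.val E s = 0
    · obtain ⟨t, τ, s', h4, h5, h6, h7⟩ := ihd σ s hr (this.2.2 he)
      refine ⟨_, _, _, .cond_false h1 (h2.trans he) h4, ?_, h6, h7⟩
      simp only [Pr.cost]
      omega
    · obtain ⟨t, τ, s', h4, h5, h6, h7⟩ := ihc σ s hr (this.2.1 he)
      refine ⟨_, _, _, .cond_true h1 (h2 ▸ he) h4, ?_, h6, h7⟩
      simp only [Pr.cost]
      omega
  | loop e c => exact this.elim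

theorem Triple.seq {E : Env} {P Q R : St → Prop} {c d : Pr} {T U : ℕ} (h : Triple E P c T Q)
    (h' : Triple E Q d U R) : Triple E P (.seq c d) (T + U) R := by
  intro σ s hr hP
  obtain ⟨t, τ, s', h1, h2, h3, h4⟩ := h σ s hr hP
  obtain ⟨t', τ', s'', h5, h6, h7, h8⟩ := h' τ s' h3 h4
  exact ⟨_, _, _, .seq h1 h5, Nat.add_le_add h2 h6, h7, h8⟩

theorem Triple.ite {E : Env} {P Q : St → Prop} {e : Ex} {c d : Pr} {T : ℕ}
    (he : ∀ h, P h → e.Safe E h) (hc : Triple E (fun h => P h ∧ e.val E h ≠ 0) c T Q)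
    (hd : Triple E (fun h => P h ∧ e.val E h = 0) d T Q) :
    Triple E P (.ite e c d) (e.compile.cost + 1 + T) Q := by
  intro σ s hr hP
  obtain ⟨h1, h2, h3⟩ := hr.expr e (he s hP)
  by_cases hv : e.val E s = 0
  · obtain ⟨t, τ, s', h4, h5, h6, h7⟩ := hd σ s hr ⟨hP, hv⟩
    exact ⟨_, _, _, .cond_false h1 (h2.trans hv) h4, by omega, h6, h7⟩
  · obtain ⟨t, τ, s', h4, h5, h6, h7⟩ := hc σ s hr ⟨hP, hv⟩
    exact ⟨_, _, _, .cond_true h1 (h2 ▸ hv) h4, by omega, h6, h7⟩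

theorem Triple.conseq {E : Env} {P P' Q Q' : St → Prop} {c : Pr} {T T' : ℕ}
    (h : Triple E P c T Q) (hP : ∀ s, P' s → P s) (hT : T ≤ T') (hQ : ∀ s, Q s → Q' s) :
    Triple E P' c T' Q' := by
  intro σ s hr hs
  obtain ⟨t, τ, s', h1, h2, h3, h4⟩ := h σ s hr (hP s hs)
  exact ⟨t, τ, s', h1, h2.trans hT, h3, hQ _ h4⟩

/-- A loop whose body is loop-free, with invariant `I` and decreasing quantity `Φ`. -/
theorem Triple.loop {E : Env} {I : St → Prop} {e : Ex} {c : Pr} (Φ : St → ℕ) (B : ℕ)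
    (he : ∀ h, I h → e.Safe E h)
    (hc : ∀ h, I h → e.val E h ≠ 0 → wp E c (fun h' => I h' ∧ Φ h' < Φ h) h) :
    Triple E (fun h => I h ∧ Φ h ≤ B) (.loop e c) ((B + 1) * (e.compile.cost + 1 + c.cost))
      (fun h => I h ∧ e.val E h = 0) := by
  intro σ s hr ⟨hI, hB⟩
  induction B generalizing σ s with
  | zero =>
    obtain ⟨h1, h2, h3⟩ := hr.expr e (he s hI)
    by_cases hv : e.val E s = 0
    · exact ⟨_, _, _, .loop_false h1 (h2.trans hv), by omega, hr, hI, hv⟩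
    -- With `Φ` equal to 0 the body cannot run, as it would have to decrease `Φ`.
    · obtain ⟨_, _, _, -, -, -, -, h7⟩ := Triple.of_wp (fun s h => h) σ s hr (hc s hI hv)
      omega
  | succ B ih =>
    obtain ⟨h1, h2, h3⟩ := hr.expr e (he s hI)
    by_cases hv : e.val E s = 0
    · refine ⟨_, _, _, .loop_false h1 (h2.trans hv), ?_, hr, hI, hv⟩
      nlinarith
    · obtain ⟨t, τ, s', h4, h5, h6, h7, h8⟩ := Triple.of_wp (fun s h => h) σ s hr (hc s hI hv)
      obtain ⟨t', τ', s'', g1, g2, g3, g4⟩ := ih τ s' h6 h7 (by omega)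
      refine ⟨_, _, _, .loop_true h1 (h2 ▸ hv) h4 g1, ?_, g3, g4⟩
      rw [Nat.add_right_comm B 1 1, Nat.succ_mul (B + 1)]
      omega

end ArrayLang

/-! ### Updating the data of a single vertex -/

namespace ArrayLang

/-- Sequential composition of a list of programs. -/
def block : List Pr → Pr
  | [] => .skip
  | c :: l => .seq c (block l)

@[simp] theorem wp_block_cons {E : Env} {c : Pr} {l : List Pr} {Q : St → Prop} {h : St} :
    wp E (block (c :: l)) Q h = wp E c (wp E (block l) Q) h := rfl

theorem St.setReg_self (h : St) (r : Reg) : h.setReg r (h.reg r) = h := by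
  simp [St.setReg]

theorem St.setArr_self (h : St) (f : Field) (i : ℕ) : h.setArr f i (h.arr f i) = h := by
  simp [St.setArr]

/-- Subtract `n` from `tmp` unless `tmp < n`. -/
def reduce : Pr := .ite (.lt (.reg .tmp) (.reg .n)) .skip (.set .tmp (.sub (.reg .tmp) (.reg .n)))

/-- Both branches are expressed as one assignment, so that proofs about programs that use `reduce`
do not split; `wp_replaceIn` does the same. -/
theorem wp_reduce {E : Env} {Q : St → Prop} {h : St}
    (hQ : Q (h.setReg .tmp
      (if h.reg .tmp < h.reg .n then h.reg .tmp else h.reg .tmp - h.reg .n))) :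
    wp E reduce Q h := by
  simp only [reduce, wp, Ex.Safe, Ex.val]
  refine ⟨⟨trivial, trivial⟩, fun hv => ?_, fun hv => ⟨⟨trivial, trivial⟩, ?_⟩⟩
  · rw [if_pos (by by_contra hh; simp [hh] at hv), St.setReg_self] at hQ
    exact hQ
  · rw [if_neg (by by_contra hh; simp [hh] at hv)] at hQ
    exact hQ

/-- Replace the neighbor `old` of `u` in one array by `new`. -/
def replaceIn (f : Field) (u old new : Reg) : Pr :=
  .ite (.eq (.arr f u) (.reg old)) (.put f u (.reg new)) .skip

theorem wp_replaceIn {E : Env} {Q : St → Prop} {h : St} {f : Field} {u old new : Reg}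
    (hQ : Q (h.setArr f (h.reg u)
      (if h.arr f (h.reg u) = h.reg old then h.reg new else h.arr f (h.reg u)))) :
    wp E (replaceIn f u old new) Q h := by
  simp only [replaceIn, wp, Ex.Safe, Ex.val]
  refine ⟨⟨trivial, trivial⟩, fun hv => ⟨trivial, ?_⟩, fun hv => ?_⟩
  · rw [if_pos (by by_contra hh; simp [hh] at hv)] at hQ
    exact hQ
  · rw [if_neg (by by_contra hh; simp [hh] at hv), St.setArr_self] at hQ
    exact hQ

/-- Replace the neighbor `old` of `u` by `new`. -/
def replaceNb (u old new : Reg) : Pr := block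
  [replaceIn .nb₁ u old new, replaceIn .nb₂ u old new, replaceIn .nb₃ u old new,
    .set .tmp (.add (.add (.arr .sum u) (.reg new)) (.sub (.reg .n) (.reg old))),
    reduce, reduce, .put .sum u (.reg .tmp)]

/-- One of the arrays that hold the neighbors of the vertices of degree three. -/
def Field.IsNb (f : Field) : Prop := f = .nb₁ ∨ f = .nb₂ ∨ f = .nb₃

/-- In the data for vertex `a`, neighbor `o` has been replaced by `w`. -/
structure Replaced (h h' : St) (a o w : ℕ) : Prop where
  reg : ∀ r, r ≠ .tmp → h'.reg r = h.reg r
  deg : ∀ i, h'.arr .deg i = h.arr .deg i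
  stack : ∀ i, h'.arr .stack i = h.arr .stack i
  nb : ∀ f : Field, f.IsNb → ∀ i, h'.arr f i = if i = a ∧ h.arr f i = o then w else h.arr f i
  sum_ne : ∀ i, i ≠ a → h'.arr .sum i = h.arr .sum i
  sum_lt : h'.arr .sum a < h.reg .n
  sum_modEq : h'.arr .sum a + o ≡ h.arr .sum a + w [MOD h.reg .n]

theorem sub_mod_aux {n t : ℕ} :
    (if t < n then t else t - n) ≡ t [MOD n] := by
  split_ifs with h
  · rfl
  · have := Nat.ModEq.symm (Nat.add_modEq_right (a := t - n) (n := n))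
    rw [Nat.sub_add_cancel (not_lt.1 h)] at this
    exact this

theorem wp_replaceNb {E : Env} {h : St} {u old new : Reg} (hu : u ≠ .tmp)
    (hM : 4 * h.reg .n < E.M)
    (ho' : h.reg old < h.reg .n) (hw' : h.reg new < h.reg .n)
    (hs : h.arr .sum (h.reg u) < h.reg .n) :
    wp E (replaceNb u old new)
      (fun h' => Replaced h h' (h.reg u) (h.reg old) (h.reg new)) h := by
  simp only [replaceNb, wp_block_cons]
  apply wp_replaceIn
  apply wp_replaceIn
  apply wp_replaceIn
  refine ⟨?_, ?_⟩
  · simp [Ex.Safe, Ex.val]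
    omega
  -- The value of `tmp` is below `3 * n`, since `n - old` was added instead of subtracting `old`;
  -- two conditional subtractions bring it below `n`.
  apply wp_reduce
  apply wp_reduce
  refine ⟨trivial, ?_⟩
  simp only [Ex.val, St.setArr_reg, St.setReg_reg, St.setArr_arr, reduceCtorEq,
    false_and, if_false, if_true, hu]
  generalize ht : h.arr .sum (h.reg u) + h.reg new + (h.reg .n - h.reg old) = t
  have h1 := sub_mod_aux (n := h.reg .n) (t := t)
  have h2 := sub_mod_aux (n := h.reg .n) (t := if t < h.reg .n then t else t - h.reg .n)
  have h3 : (if (if t < h.reg .n then t else t - h.reg .n) < h.reg .n then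
      (if t < h.reg .n then t else t - h.reg .n) else
      (if t < h.reg .n then t else t - h.reg .n) - h.reg .n) < h.reg .n := by
    split_ifs <;> omega
  generalize (if (if t < h.reg .n then t else t - h.reg .n) < h.reg .n then
      (if t < h.reg .n then t else t - h.reg .n) else
      (if t < h.reg .n then t else t - h.reg .n) - h.reg .n) = t' at *
  constructor
  · intro r hr
    simp [hr]
  · intro i
    simp
  · intro i
    simp
  · rintro f (rfl | rfl | rfl) i <;> simp <;> grind
  · intro i hi
    simp [hi]
  · simpa using h3
  · simp only [St.setArr_arr, and_self, if_true]
    have h4 := ((h2.trans h1).add_right (h.reg old))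
    rw [← ht] at h4
    refine h4.trans ?_
    rw [show h.arr .sum (h.reg u) + h.reg new + (h.reg .n - h.reg old) + h.reg old =
      h.arr .sum (h.reg u) + h.reg new + h.reg .n by omega]
    exact Nat.add_modEq_right

/-- Remove the neighbor `v` of `z`, where `x` and `y` are two other neighbors of `z`. -/
def removeNb : Pr := block
  [.set .tmp (.add (.arr .sum .z) (.sub (.reg .n) (.reg .v))), reduce,
    .put .sum .z (.reg .tmp), .put .deg .z (.sub (.arr .deg .z) (.const 1)),
    .ite (.eq (.arr .deg .z) (.const 3)) (block
      [.put .nb₁ .z (.reg .x), .put .nb₂ .z (.reg .y),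
        .set .tmp (.add (.add (.arr .sum .z) (.sub (.reg .n) (.reg .x)))
          (.sub (.reg .n) (.reg .y))),
        reduce, reduce, .put .nb₃ .z (.reg .tmp)]) .skip]

/-- In the data for vertex `a`, neighbor `o` has been removed; if this leaves three neighbors, two
of them are `b` and `c`. -/
structure Removed (h h' : St) (a o b c : ℕ) : Prop where
  reg : ∀ r, r ≠ .tmp → h'.reg r = h.reg r
  deg : ∀ i, h'.arr .deg i = if i = a then h.arr .deg i - 1 else h.arr .deg i
  stack : ∀ i, h'.arr .stack i = h.arr .stack i
  nb : ∀ f : Field, f.IsNb → ∀ i, i ≠ a ∨ h.arr .deg a - 1 ≠ 3 → h'.arr f i = h.arr f i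
  nb₁ : h.arr .deg a - 1 = 3 → h'.arr .nb₁ a = b
  nb₂ : h.arr .deg a - 1 = 3 → h'.arr .nb₂ a = c
  nb₃_lt : h.arr .deg a - 1 = 3 → h'.arr .nb₃ a < h.reg .n
  nb₃ : h.arr .deg a - 1 = 3 → h'.arr .nb₃ a + b + c ≡ h'.arr .sum a [MOD h.reg .n]
  sum_ne : ∀ i, i ≠ a → h'.arr .sum i = h.arr .sum i
  sum_lt : h'.arr .sum a < h.reg .n
  sum_modEq : h'.arr .sum a + o ≡ h.arr .sum a [MOD h.reg .n]

theorem wp_removeNb {E : Env} {h : St} (hM : 4 * h.reg .n < E.M)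
    (hv : h.reg .v < h.reg .n) (hx : h.reg .x < h.reg .n) (hy : h.reg .y < h.reg .n)
    (hs : h.arr .sum (h.reg .z) < h.reg .n) :
    wp E removeNb
      (fun h' => Removed h h' (h.reg .z) (h.reg .v) (h.reg .x) (h.reg .y)) h := by
  simp only [removeNb, wp_block_cons]
  refine ⟨?_, ?_⟩
  · simp [Ex.Safe, Ex.val]
    omega
  apply wp_reduce
  simp only [Ex.val, St.setReg_reg, reduceCtorEq, if_false, if_true]
  generalize ht : h.arr .sum (h.reg .z) + (h.reg .n - h.reg .v) = t
  have h1 := sub_mod_aux (n := h.reg .n) (t := t)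
  have h3 : (if t < h.reg .n then t else t - h.reg .n) < h.reg .n := by
    split_ifs <;> omega
  generalize (if t < h.reg .n then t else t - h.reg .n) = t' at *
  have h4 : t' + h.reg .v ≡ h.arr .sum (h.reg .z) [MOD h.reg .n] := by
    have h4 := h1.add_right (h.reg .v)
    rw [← ht] at h4
    refine h4.trans ?_
    rw [show h.arr .sum (h.reg .z) + (h.reg .n - h.reg .v) + h.reg .v =
      h.arr .sum (h.reg .z) + h.reg .n by omega]
    exact Nat.add_modEq_right
  refine ⟨trivial, ⟨trivial, by simp [Ex.Safe]⟩, ?_⟩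
  refine ⟨⟨trivial, by simp [Ex.Safe]⟩, fun hd => ?_, fun hd => ?_⟩
  · simp only [Ex.val, St.setArr_reg, St.setReg_reg, St.setArr_arr, St.setReg_arr, reduceCtorEq,
      false_and, if_false, if_true, and_self, ne_eq, ite_eq_right_iff, one_ne_zero,
      imp_false, not_not] at hd
    refine ⟨trivial, trivial, ?_, ?_⟩
    · simp [Ex.Safe, Ex.val]
      omega
    apply wp_reduce
    apply wp_reduce
    refine ⟨trivial, ?_⟩
    simp only [Ex.val, St.setArr_reg, St.setReg_reg, St.setArr_arr, St.setReg_arr,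
      reduceCtorEq, false_and, if_false, if_true, and_self]
    -- Modulo `n`, this is the neighbor sum without `x` and `y`, hence the third neighbor. It is
    -- again below `3 * n`.
    generalize hs : t' + (h.reg .n - h.reg .x) + (h.reg .n - h.reg .y) = s
    have g1 := sub_mod_aux (n := h.reg .n) (t := s)
    have g2 := sub_mod_aux (n := h.reg .n) (t := if s < h.reg .n then s else s - h.reg .n)
    have g3 : (if (if s < h.reg .n then s else s - h.reg .n) < h.reg .n then
        (if s < h.reg .n then s else s - h.reg .n) else
        (if s < h.reg .n then s else s - h.reg .n) - h.reg .n) < h.reg .n := by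
      split_ifs <;> omega
    generalize (if (if s < h.reg .n then s else s - h.reg .n) < h.reg .n then
        (if s < h.reg .n then s else s - h.reg .n) else
        (if s < h.reg .n then s else s - h.reg .n) - h.reg .n) = s' at *
    constructor
    · intro r hr
      simp [hr]
    · intro i
      simp
      grind
    · intro i
      simp
    · rintro f (rfl | rfl | rfl) i hi <;> simp <;> grind
    · simp
    · simp
    · simpa using fun _ => g3
    · intro _
      simp only [St.setArr_arr, reduceCtorEq, false_and, if_false, and_self, if_true,
        St.setReg_arr]
      have := ((g2.trans g1).add_right (h.reg .x)).add_right (h.reg .y)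
      rw [← hs] at this
      refine this.trans ?_
      rw [show t' + (h.reg .n - h.reg .x) + (h.reg .n - h.reg .y) + h.reg .x + h.reg .y =
        t' + h.reg .n + h.reg .n by omega]
      exact Nat.add_modEq_right.trans Nat.add_modEq_right
    · intro i hi
      simp [hi]
    · simpa using h3
    · simpa using h4
  · simp only [Ex.val, St.setArr_reg, St.setReg_reg, St.setArr_arr, St.setReg_arr, reduceCtorEq,
      false_and, if_false, if_true, and_self, ite_eq_right_iff, one_ne_zero,
      imp_false] at hd
    simp only [wp, Ex.val, St.setArr_reg, St.setReg_reg, St.setArr_arr, St.setReg_arr,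
      reduceCtorEq, false_and, if_false, if_true]
    constructor
    · intro r hr
      simp [hr]
    · intro i
      simp
      grind
    · intro i
      simp
    · rintro f (rfl | rfl | rfl) i hi <;> simp
    · exact fun h => absurd h hd
    · exact fun h => absurd h hd
    · exact fun h => absurd h hd
    · exact fun h => absurd h hd
    · intro i hi
      simp [hi]
    · simpa using h3
    · simpa using h4

end ArrayLang

/-! ### Representation of a graph by the arrays, preserved by both rules -/

namespace ArrayLang

open D3

/-- The arrays represent the graph `G` with neighborhoods `F`, all of whose vertices that have not
been deleted are in `A`. -/
structure Good (n : ℕ) (h : St) (G : SimpleGraph ℕ) (F : ℕ → Finset ℕ) (A : Finset ℕ) :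
    Prop where
  reg_n : h.reg .n = n
  nbhd : Nbhd G F
  card : A.card = h.reg .alive
  lt : ∀ u ∈ A, u < n
  mem : ∀ u w, G.Adj u w → u ∈ A
  dsum : h.reg .dsum = ∑ u ∈ Finset.range n, (F u).card
  deg : ∀ u < n, h.arr .deg u = (F u).card
  nb : ∀ u < n, (F u).card = 3 → F u = {h.arr .nb₁ u, h.arr .nb₂ u, h.arr .nb₃ u}
  sum : ∀ u < n, 3 < (F u).card → h.arr .sum u ≡ ∑ w ∈ F u, w [MOD n]
  nb_lt : ∀ f : Field, f.IsNb → ∀ u < n, h.arr f u < n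
  sum_lt : ∀ u < n, h.arr .sum u < n

theorem insert_erase_triple {a b c o w : ℕ} (h : o ∈ ({a, b, c} : Finset ℕ)) :
    insert w (({a, b, c} : Finset ℕ).erase o) =
      {if a = o then w else a, if b = o then w else b, if c = o then w else c} := by
  ext u
  simp only [Finset.mem_insert, Finset.mem_singleton, Finset.mem_erase] at h ⊢
  grind

theorem sum_insert_erase_modEq {S : Finset ℕ} {o w n s s' : ℕ} (ho : o ∈ S) (hw : w ∉ S)
    (hs : s ≡ ∑ i ∈ S, i [MOD n]) (hs' : s' + o ≡ s + w [MOD n]) :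
    s' ≡ ∑ i ∈ insert w (S.erase o), i [MOD n] := by
  rw [Finset.sum_insert (fun h => hw (Finset.mem_of_mem_erase h))]
  have h1 := Finset.add_sum_erase S id ho
  simp only [id] at h1
  have h2 := hs'.trans (hs.add_right w)
  rw [← h1, show o + ∑ i ∈ S.erase o, i + w = (w + ∑ i ∈ S.erase o, i) + o by ring] at h2
  exact Nat.ModEq.add_right_cancel' _ h2

theorem Good.adj_lt {n : ℕ} {h : St} {G : SimpleGraph ℕ} {F : ℕ → Finset ℕ} {A : Finset ℕ}
    (hg : Good n h G F A) {u w : ℕ} (huw : G.Adj u w) : u < n :=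
  hg.lt _ (hg.mem _ _ huw)

/-- Surviving vertices keep their degrees, so each of them needs the same kind of data before and
after the step: exact neighbors in degree three, the sum above. -/
theorem Good.opA {n : ℕ} {h h' : St} {G : SimpleGraph ℕ} {F : ℕ → Finset ℕ} {A : Finset ℕ}
    (hg : Good n h G F A) {v x y z x' y' : ℕ} (ha : IsA G v x y z x' y')
    (reg_n : h'.reg .n = h.reg .n) (alive : h'.reg .alive = h.reg .alive - 2)
    (dsum : h'.reg .dsum = h.reg .dsum - 6)
    (deg : ∀ i, h'.arr .deg i = if i = x ∨ i = y then 0 else h.arr .deg i)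
    (nb : ∀ f : Field, f.IsNb → ∀ i, i ≠ v → h'.arr f i =
      if i = x' ∧ h.arr f i = x then v else if i = y' ∧ h.arr f i = y then v else h.arr f i)
    (nb₁ : h'.arr .nb₁ v = z) (nb₂ : h'.arr .nb₂ v = x') (nb₃ : h'.arr .nb₃ v = y')
    (sum : ∀ i, i ≠ x' → i ≠ y' → h'.arr .sum i = h.arr .sum i)
    (sum_lt : ∀ i, i = x' ∨ i = y' → h'.arr .sum i < n)
    (sumx : h'.arr .sum x' + x ≡ h.arr .sum x' + v [MOD n])
    (sumy : h'.arr .sum y' + y ≡ h.arr .sum y' + v [MOD n]) :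
    Good n h' (opA G v x y) (nbhdA F v x y z x' y') ((A.erase x).erase y) ∧
      2 ≤ h.reg .alive := by
  have hN := hg.nbhd
  have hc := canA_iff.2 ⟨_, _, _, ha⟩
  have hxA := hg.mem _ _ hc.adj_qr
  have hyA : y ∈ A.erase x := Finset.mem_erase.2 ⟨ha.qr.symm, hg.mem _ _ hc.adj_qr.symm⟩
  have hcard := ha.card_nbhdA hN
  have hsum := sum_card_nbhdA ha hN (fun u w h => hg.adj_lt h)
  have axx : x ∈ F x' := by rw [hN, G.adj_comm, ha.nq]; simp
  have ayy : y ∈ F y' := by rw [hN, G.adj_comm, ha.nr]; simp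
  have avx : v ∉ F x' := by
    rw [hN, G.adj_comm, ha.np]
    have := ha.qq
    have := ha.pq'
    grind
  have avy : v ∉ F y' := by
    rw [hN, G.adj_comm, ha.np]
    have := ha.rr
    have := ha.pr'
    grind
  have hvn : v < n := hg.adj_lt hc.adj_pq
  have hzn : z < n := hg.adj_lt (w := v) (by rw [G.adj_comm, ha.np]; simp)
  have hxn : x' < n := hg.adj_lt (w := x) (by rw [G.adj_comm, ha.nq]; simp)
  have hyn : y' < n := hg.adj_lt (w := y) (by rw [G.adj_comm, ha.nr]; simp)
  refine ⟨⟨reg_n.trans hg.reg_n, hN.opA ha, ?_, ?_, ?_, ?_, ?_, ?_, ?_, ?_, ?_⟩, ?_⟩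
  · rw [Finset.card_erase_of_mem hyA, Finset.card_erase_of_mem hxA, alive, hg.card]
    omega
  · exact fun u hu => hg.lt u (Finset.mem_of_mem_erase (Finset.mem_of_mem_erase hu))
  · intro u w huw
    have h1 := huw
    rw [opA_adj] at h1
    refine Finset.mem_erase.2 ⟨h1.2.2.1, Finset.mem_erase.2 ⟨h1.2.1, ?_⟩⟩
    obtain ⟨-, -, -, -, -, h1 | ⟨rfl, -⟩ | ⟨-, h1 | h1⟩⟩ := h1
    · exact hg.mem _ _ h1
    · exact hg.mem _ _ hc.adj_pq
    · exact hg.mem _ _ h1.symm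
    · exact hg.mem _ _ h1.symm
  · rw [dsum, hg.dsum, ← hsum]
    omega
  · intro u hu
    rw [deg, hcard, hg.deg u hu]
  · intro u hu hu3
    rw [hcard] at hu3
    by_cases u1 : u = v
    · subst u1
      rw [nb₁, nb₂, nb₃]
      simp [nbhdA]
    have u2 : ¬ (u = x ∨ u = y) := by
      intro hh
      simp [hh] at hu3
    rw [if_neg u2] at hu3
    have hF := hg.nb u hu hu3
    rw [nb _ (.inl rfl) u u1, nb _ (.inr (.inl rfl)) u u1, nb _ (.inr (.inr rfl)) u u1, nbhdA,
      if_neg u1, if_neg u2]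
    by_cases u3 : u = x'
    · subst u3
      have hxy : ¬ u = y' := ha.qr'
      simp only [if_true, true_and, hxy, false_and, if_false]
      rw [hF]
      exact insert_erase_triple (hF ▸ axx)
    by_cases u4 : u = y'
    · subst u4
      simp only [if_true, true_and, u3, false_and, if_false]
      rw [hF]
      exact insert_erase_triple (hF ▸ ayy)
    simp only [u3, u4, false_and, if_false]
    exact hF
  · intro u hu hu3
    rw [hcard] at hu3
    have u2 : ¬ (u = x ∨ u = y) := by
      intro hh
      simp [hh] at hu3
    rw [if_neg u2] at hu3
    have u1 : u ≠ v := by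
      rintro rfl
      have := hN.degThree_iff.1 hc.deg_p
      omega
    have hF := hg.sum u hu hu3
    rw [nbhdA, if_neg u1, if_neg u2]
    by_cases u3 : u = x'
    · subst u3
      rw [if_pos rfl]
      exact sum_insert_erase_modEq axx avx hF sumx
    rw [if_neg u3]
    by_cases u4 : u = y'
    · subst u4
      rw [if_pos rfl]
      exact sum_insert_erase_modEq ayy avy hF sumy
    rw [if_neg u4, sum u u3 u4]
    exact hF
  · intro f hf u hu
    by_cases u1 : u = v
    · subst u1
      rcases hf with rfl | rfl | rfl
      · rwa [nb₁]
      · rwa [nb₂]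
      · rwa [nb₃]
    rw [nb f hf u u1]
    have := hg.nb_lt f hf u hu
    split_ifs <;> assumption
  · intro u hu
    by_cases u1 : u = x' ∨ u = y'
    · exact sum_lt u u1
    · rw [sum u (by tauto) (by tauto)]
      exact hg.sum_lt u hu
  · have h1 := Finset.card_pos.2 ⟨y, hyA⟩
    rw [Finset.card_erase_of_mem hxA, hg.card] at h1
    omega

/-- The ends have degree three before and after, so only `z` can pass from being described by its
sum to being described by its three neighbors. -/
theorem Good.opB {n : ℕ} {h h' : St} {G : SimpleGraph ℕ} {F : ℕ → Finset ℕ} {A : Finset ℕ}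
    (hg : Good n h G F A) {v x y z x' y' : ℕ} (hb : IsB G x v y z x' y')
    (reg_n : h'.reg .n = h.reg .n) (alive : h'.reg .alive = h.reg .alive - 1)
    (dsum : h'.reg .dsum = h.reg .dsum - 4)
    (deg : ∀ i, h'.arr .deg i = if i = v then 0 else if i = z then h.arr .deg i - 1
      else h.arr .deg i)
    (nb : ∀ f : Field, f.IsNb → ∀ i, i ≠ z ∨ h.arr .deg z - 1 ≠ 3 → h'.arr f i =
      if i = x ∧ h.arr f i = v then y else if i = y ∧ h.arr f i = v then x else h.arr f i)
    (nb₁ : h.arr .deg z - 1 = 3 → h'.arr .nb₁ z = x)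
    (nb₂ : h.arr .deg z - 1 = 3 → h'.arr .nb₂ z = y)
    (nb₃_lt : h.arr .deg z - 1 = 3 → h'.arr .nb₃ z < n)
    (nb₃ : h.arr .deg z - 1 = 3 → h'.arr .nb₃ z + x + y ≡ h'.arr .sum z [MOD n])
    (sum : ∀ i, i ≠ x → i ≠ y → i ≠ z → h'.arr .sum i = h.arr .sum i)
    (sum_lt : ∀ i, i = x ∨ i = y ∨ i = z → h'.arr .sum i < n)
    (sumz : h'.arr .sum z + v ≡ h.arr .sum z [MOD n]) :
    Good n h' (opB G x v y) (nbhdB F x v y z) (A.erase v) ∧ 1 ≤ h.reg .alive := by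
  have hN := hg.nbhd
  have hc := canB_iff.2 ⟨_, _, _, hb⟩
  have hvA := hg.mem _ _ hc.adj_qr
  have hcard := hb.card_nbhdB hN
  have hsum := sum_card_nbhdB hb hN (fun u w h => hg.adj_lt h)
  have avz : v ∈ F z := by rw [hN, G.adj_comm, hb.nq]; simp
  have axz : x ∈ F z := by rw [hN, G.adj_comm, hb.np]; simp
  have ayz : y ∈ F z := by rw [hN, G.adj_comm, hb.nr]; simp
  have avx : v ∈ F x := by rw [hN, hb.np]; simp
  have avy : v ∈ F y := by rw [hN, hb.nr]; simp
  have hzn : z < n := hg.adj_lt ((hN _ _).1 avz)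
  have hxn : x < n := hg.adj_lt ((hN _ _).1 avx)
  have hyn : y < n := hg.adj_lt ((hN _ _).1 avy)
  have hx3 := hN.degThree_iff.1 hc.deg_p
  have hy3 := hN.degThree_iff.1 hc.deg_r
  have hdz := hg.deg z hzn
  refine ⟨⟨reg_n.trans hg.reg_n, hN.opB hb, ?_, ?_, ?_, ?_, ?_, ?_, ?_, ?_, ?_⟩, ?_⟩
  · rw [Finset.card_erase_of_mem hvA, alive, hg.card]
  · exact fun u hu => hg.lt u (Finset.mem_of_mem_erase hu)
  · intro u w huw
    have h1 := huw
    rw [opB_adj] at h1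
    refine Finset.mem_erase.2 ⟨h1.2.1, ?_⟩
    obtain ⟨-, -, -, h1 | ⟨rfl, -⟩ | ⟨rfl, -⟩⟩ := h1
    · exact hg.mem _ _ h1
    · exact hg.mem _ _ hc.adj_pq
    · exact hg.mem _ _ hc.adj_qr.symm
  · rw [dsum, hg.dsum, ← hsum]
    omega
  · intro u hu
    rw [deg, hcard, hg.deg u hu]
  · intro u hu hu3
    rw [hcard] at hu3
    have u1 : u ≠ v := by
      rintro rfl
      simp at hu3
    rw [if_neg u1] at hu3
    by_cases u2 : u = z
    · subst u2
      rw [if_pos rfl, ← hdz] at hu3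
      have h4 : 3 < (F u).card := by omega
      rw [nbhdB, if_neg u1, if_neg hb.sp, if_neg hb.sr, if_pos rfl, nb₁ hu3, nb₂ hu3]
      have hxe : x ∈ (F u).erase v := Finset.mem_erase.2 ⟨hb.pq, axz⟩
      have hye : y ∈ ((F u).erase v).erase x :=
        Finset.mem_erase.2 ⟨hb.pr.symm, Finset.mem_erase.2 ⟨hb.qr.symm, ayz⟩⟩
      -- The apex had degree four; apart from `v`, `x` and `y` it has a single neighbor `c`.
      have hce : ((((F u).erase v).erase x).erase y).card = 1 := by
        rw [Finset.card_erase_of_mem hye, Finset.card_erase_of_mem hxe,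
          Finset.card_erase_of_mem avz]
        omega
      obtain ⟨c, hc1⟩ := Finset.card_eq_one.1 hce
      have e1 := Finset.add_sum_erase (F u) id avz
      have e2 := Finset.add_sum_erase _ id hxe
      have e3 := Finset.add_sum_erase _ id hye
      rw [hc1] at e3
      simp only [id, Finset.sum_singleton] at e1 e2 e3
      have hcF : c ∈ F u := by
        have : c ∈ (((F u).erase v).erase x).erase y := by rw [hc1]; simp
        exact Finset.mem_of_mem_erase (Finset.mem_of_mem_erase (Finset.mem_of_mem_erase this))
      have hcn : c < n := hg.adj_lt ((hN _ _).1 hcF).symm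
      -- Both numbers are below `n`, so their congruence, obtained from the neighbor sum, is an
      -- equality.
      have hcc : h'.arr .nb₃ u = c := by
        have k1 := hg.sum u hu h4
        have k2 := (nb₃ hu3).add_right v
        have k3 := (k2.trans sumz).trans k1
        rw [← e1, ← e2, ← e3, show h'.arr .nb₃ u + x + y + v = h'.arr .nb₃ u + (x + y + v) by ring,
          show v + (x + (y + c)) = c + (x + y + v) by ring] at k3
        exact (Nat.ModEq.add_right_cancel' _ k3).eq_of_lt_of_lt (nb₃_lt hu3) hcn
      rw [hcc, ← Finset.insert_erase hxe, ← Finset.insert_erase hye, hc1]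
    · rw [if_neg u2] at hu3
      have hF := hg.nb u hu hu3
      rw [nb _ (.inl rfl) u (.inl u2), nb _ (.inr (.inl rfl)) u (.inl u2),
        nb _ (.inr (.inr rfl)) u (.inl u2), nbhdB, if_neg u1]
      by_cases u3 : u = x
      · subst u3
        have hxy : ¬ u = y := hb.pr
        simp only [if_true, true_and, hxy, false_and, if_false]
        rw [hF]
        exact insert_erase_triple (hF ▸ avx)
      by_cases u4 : u = y
      · subst u4
        simp only [if_true, true_and, u3, false_and, if_false]
        rw [hF]
        exact insert_erase_triple (hF ▸ avy)
      simp only [u3, u4, u2, false_and, if_false]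
      exact hF
  · intro u hu hu3
    rw [hcard] at hu3
    have u1 : u ≠ v := by
      rintro rfl
      simp at hu3
    rw [if_neg u1] at hu3
    by_cases u2 : u = z
    · subst u2
      rw [if_pos rfl] at hu3
      have hF := hg.sum u hu (by omega)
      rw [nbhdB, if_neg u1, if_neg hb.sp, if_neg hb.sr, if_pos rfl]
      have e1 := Finset.add_sum_erase (F u) id avz
      simp only [id] at e1
      have := sumz.trans hF
      rw [← e1, add_comm v] at this
      exact Nat.ModEq.add_right_cancel' _ this
    · rw [if_neg u2] at hu3
      have u3 : u ≠ x := by rintro rfl; omega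
      have u4 : u ≠ y := by rintro rfl; omega
      rw [nbhdB, if_neg u1, if_neg u3, if_neg u4, if_neg u2, sum u u3 u4 u2]
      exact hg.sum u hu hu3
  · intro f hf u hu
    by_cases u1 : u = z ∧ h.arr .deg z - 1 = 3
    · obtain ⟨rfl, u1⟩ := u1
      rcases hf with rfl | rfl | rfl
      · rwa [nb₁ u1]
      · rwa [nb₂ u1]
      · exact nb₃_lt u1
    rw [nb f hf u (by tauto)]
    have := hg.nb_lt f hf u hu
    split_ifs <;> assumption
  · intro u hu
    by_cases u1 : u = x ∨ u = y ∨ u = z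
    · exact sum_lt u u1
    · rw [sum u (by tauto) (by tauto) (by tauto)]
      exact hg.sum_lt u hu
  · rw [← hg.card]
    exact Finset.card_pos.2 ⟨v, hvA⟩

end ArrayLang

/-! ### Programs that carry out a reduction -/

namespace ArrayLang

open D3

/-- Apply rule D3a to the triangle `v`, `x`, `y` with outside neighbors `z`, `x'`, `y'`. -/
def applyA : Pr := block
  [.put .nb₁ .v (.reg .z), .put .nb₂ .v (.reg .x'), .put .nb₃ .v (.reg .y'),
    replaceNb .x' .x .v, replaceNb .y' .y .v, .put .deg .x (.const 0), .put .deg .y (.const 0),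
    .set .alive (.sub (.reg .alive) (.const 2)), .set .dsum (.sub (.reg .dsum) (.const 6)),
    .set .done (.const 1), .set .t₁ (.reg .v), .set .t₂ (.reg .x'), .set .t₃ (.reg .y')]

/-- Apply rule D3b to the path `x`, `v`, `y` with apex `z`. -/
def applyB : Pr := block
  [replaceNb .x .v .y, replaceNb .y .v .x, removeNb, .put .deg .v (.const 0),
    .set .alive (.sub (.reg .alive) (.const 1)), .set .dsum (.sub (.reg .dsum) (.const 4)),
    .set .done (.const 1), .set .t₁ (.reg .x), .set .t₂ (.reg .y), .set .t₃ (.reg .z)]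

/-- A reduction has led from `h` to `h'`; the registers `t₁`, `t₂`, `t₃` hold all vertices of
degree three whose neighborhoods have changed, and `v` if it still has degree three. -/
structure Reduced (n : ℕ) (h h' : St) (G : SimpleGraph ℕ) (F : ℕ → Finset ℕ)
    (G' : SimpleGraph ℕ) (F' : ℕ → Finset ℕ) (A' : Finset ℕ) : Prop where
  good : Good n h' G' F' A'
  cRed : CRed G (h.reg .alive) ↔ CRed G' (h'.reg .alive)
  alive : h'.reg .alive < h.reg .alive
  sp : h'.reg .sp = h.reg .sp
  done : h'.reg .done = 1
  stack : ∀ i, h'.arr .stack i = h.arr .stack i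
  touched : ∀ u, (F' u).card = 3 → F' u ≠ F u ∨ u = h.reg .v →
    u = h'.reg .t₁ ∨ u = h'.reg .t₂ ∨ u = h'.reg .t₃
  t₁ : h'.reg .t₁ < n
  t₂ : h'.reg .t₂ < n
  t₃ : h'.reg .t₃ < n

theorem wp_applyA {E : Env} {n : ℕ} {h : St} {G : SimpleGraph ℕ} {F : ℕ → Finset ℕ}
    {A : Finset ℕ} (hg : Good n h G F A) (hM : 4 * n < E.M)
    (ha : IsA G (h.reg .v) (h.reg .x) (h.reg .y) (h.reg .z) (h.reg .x') (h.reg .y')) :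
    wp E applyA (fun h' => ∃ G' F' A', Reduced n h h' G F G' F' A') h := by
  have hc := canA_iff.2 ⟨_, _, _, ha⟩
  have hvn : h.reg .v < n := hg.adj_lt hc.adj_pq
  have hxn : h.reg .x < n := hg.adj_lt hc.adj_qr
  have hyn : h.reg .y < n := hg.adj_lt hc.adj_qr.symm
  have hxn' : h.reg .x' < n := hg.adj_lt (w := h.reg .x) (by rw [G.adj_comm, ha.nq]; simp)
  have hyn' : h.reg .y' < n := hg.adj_lt (w := h.reg .y) (by rw [G.adj_comm, ha.nr]; simp)
  have hn := hg.reg_n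
  have k1 := ha.qr'
  have k2 := ha.qq.1
  have k3 := ha.rr.1
  simp only [applyA, wp_block_cons]
  refine ⟨trivial, trivial, trivial, ?_⟩
  simp only [Ex.val, St.setArr_reg]
  generalize hh₀ : ((h.setArr .nb₁ (h.reg .v) (h.reg .z)).setArr .nb₂ (h.reg .v)
    (h.reg .x')).setArr .nb₃ (h.reg .v) (h.reg .y') = h₀
  have r₀ : ∀ r, h₀.reg r = h.reg r := fun r => by rw [← hh₀]; rfl
  have d₀ : ∀ i, h₀.arr .deg i = h.arr .deg i := fun i => by rw [← hh₀]; simp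
  have s₀ : ∀ i, h₀.arr .stack i = h.arr .stack i := fun i => by rw [← hh₀]; simp
  have m₀ : ∀ i, h₀.arr .sum i = h.arr .sum i := fun i => by rw [← hh₀]; simp
  have n₀ : ∀ f : Field, f.IsNb → ∀ i, i ≠ h.reg .v → h₀.arr f i = h.arr f i := by
    intro f _ i hi
    rw [← hh₀]
    simp [hi]
  have n₁ : h₀.arr .nb₁ (h.reg .v) = h.reg .z := by rw [← hh₀]; simp
  have n₂ : h₀.arr .nb₂ (h.reg .v) = h.reg .x' := by rw [← hh₀]; simp
  have n₃ : h₀.arr .nb₃ (h.reg .v) = h.reg .y' := by rw [← hh₀]; simp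
  clear hh₀
  rw [wp_block_cons]
  refine wp_mono (wp_replaceNb (u := .x') (old := .x) (new := .v)
    (by decide) ?_ ?_ ?_ ?_) ?_
  · rwa [r₀, hn]
  · rwa [r₀, r₀, hn]
  · rwa [r₀, r₀, hn]
  · rw [m₀, r₀, r₀, hn]
    exact hg.sum_lt _ hxn'
  simp only [r₀]
  intro h₁ R₁
  have r₁ : ∀ r, r ≠ .tmp → h₁.reg r = h.reg r := fun r hr => by rw [R₁.reg r hr, r₀]
  have q₁ : h₁.reg .v = h.reg .v := r₁ _ (by decide)
  have q₂ : h₁.reg .x = h.reg .x := r₁ _ (by decide)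
  have q₃ : h₁.reg .y = h.reg .y := r₁ _ (by decide)
  have q₄ : h₁.reg .x' = h.reg .x' := r₁ _ (by decide)
  have q₅ : h₁.reg .y' = h.reg .y' := r₁ _ (by decide)
  have q₆ : h₁.reg .n = n := by rw [r₁ _ (by decide), hn]
  have hs₁ : h₁.arr .sum (h.reg .y') = h.arr .sum (h.reg .y') := by
    rw [R₁.sum_ne _ k1.symm, m₀]
  rw [wp_block_cons]
  refine wp_mono (wp_replaceNb (u := .y') (old := .y) (new := .v)
    (by decide) ?_ ?_ ?_ ?_) ?_
  · rwa [q₆]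
  · rwa [q₃, q₆]
  · rwa [q₁, q₆]
  · rw [q₅, hs₁, q₆]
    exact hg.sum_lt _ hyn'
  rw [q₅, q₃, q₁]
  intro h₂ R₂
  have r₂ : ∀ r, r ≠ .tmp → h₂.reg r = h.reg r := fun r hr => by rw [R₂.reg r hr, r₁ r hr]
  have p₁ : h₂.reg .v = h.reg .v := r₂ _ (by decide)
  have p₂ : h₂.reg .x = h.reg .x := r₂ _ (by decide)
  have p₃ : h₂.reg .y = h.reg .y := r₂ _ (by decide)
  have p₄ : h₂.reg .x' = h.reg .x' := r₂ _ (by decide)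
  have p₅ : h₂.reg .y' = h.reg .y' := r₂ _ (by decide)
  have p₆ : h₂.reg .n = n := by rw [r₂ _ (by decide), hn]
  have p₇ : h₂.reg .alive = h.reg .alive := r₂ _ (by decide)
  have p₈ : h₂.reg .dsum = h.reg .dsum := r₂ _ (by decide)
  have p₉ : h₂.reg .sp = h.reg .sp := r₂ _ (by decide)
  simp only [wp, block, Ex.Safe, Ex.val, St.setArr_reg, St.setReg_reg, reduceCtorEq, if_false,
    p₁, p₂, p₃, p₄, p₅, p₇, p₈, Nat.reduceLT, true_and, and_self]
  have key := hg.opA (h' := (((((((h₂.setArr .deg (h.reg .x) 0).setArr .deg (h.reg .y) 0).setReg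
    .alive (h.reg .alive - 2)).setReg .dsum (h.reg .dsum - 6)).setReg .done 1).setReg .t₁
    (h.reg .v)).setReg .t₂ (h.reg .x')).setReg .t₃ (h.reg .y')) ha (by simp [p₆, hn]) (by simp)
    (by simp) ?_ ?_ ?_ ?_ ?_ ?_ ?_ ?_ ?_
  · obtain ⟨kg, k2⟩ := key
    refine ⟨_, _, _, kg, ?_, ?_, ?_, ?_, ?_, ?_, ?_, ?_, ?_⟩
    · simpa using CRed.iff_opA hc
    · simp; omega
    · simpa using p₉
    · simp
    · intro i
      simp [R₂.stack, R₁.stack, s₀]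
    -- The vertex `z` was adjacent to `v` and remains so; among the surviving vertices only `v`,
    -- `x'` and `y'` get new neighborhoods.
    · intro u hu hne
      simp only [St.setReg_reg, reduceCtorEq, if_false, if_true]
      by_contra! hcon
      refine hne.resolve_right hcon.1 ?_
      rw [ha.card_nbhdA hg.nbhd] at hu
      have : ¬ (u = h.reg .x ∨ u = h.reg .y) := fun e => by simp [e] at hu
      simp [nbhdA, hcon, this]
    · simpa using hvn
    · simpa using hxn'
    · simpa using hyn'
  · intro i
    simp [R₂.deg, R₁.deg, d₀]
    grind
  · intro f hf i hi
    have hfd : f ≠ .deg := by rcases hf with rfl | rfl | rfl <;> decide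
    simp [hfd, R₂.nb f hf, R₁.nb f hf, n₀ f hf i hi]
    grind
  · simp [R₂.nb .nb₁ (.inl rfl), R₁.nb .nb₁ (.inl rfl), n₁, k2.symm, k3.symm]
  · simp [R₂.nb .nb₂ (.inr (.inl rfl)), R₁.nb .nb₂ (.inr (.inl rfl)), n₂, k2.symm, k3.symm]
  · simp [R₂.nb .nb₃ (.inr (.inr rfl)), R₁.nb .nb₃ (.inr (.inr rfl)), n₃, k2.symm, k3.symm]
  · intro i hi hi'
    simp [R₂.sum_ne i hi', R₁.sum_ne i hi, m₀]
  · rintro i (rfl | rfl)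
    · have := R₁.sum_lt
      rw [r₀, hn] at this
      simpa [R₂.sum_ne _ k1] using this
    · have := R₂.sum_lt
      rw [q₆] at this
      simpa using this
  · have := R₁.sum_modEq
    rw [r₀, hn, m₀] at this
    simpa [R₂.sum_ne _ k1] using this
  · have := R₂.sum_modEq
    rw [q₆, hs₁] at this
    simpa using this

theorem wp_applyB {E : Env} {n : ℕ} {h : St} {G : SimpleGraph ℕ} {F : ℕ → Finset ℕ}
    {A : Finset ℕ} (hg : Good n h G F A) (hM : 4 * n < E.M) {x' y' : ℕ}
    (hb : IsB G (h.reg .x) (h.reg .v) (h.reg .y) (h.reg .z) x' y') :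
    wp E applyB (fun h' => ∃ G' F' A', Reduced n h h' G F G' F' A') h := by
  have hc := canB_iff.2 ⟨_, _, _, hb⟩
  have hvn : h.reg .v < n := hg.adj_lt hc.adj_qr
  have hxn : h.reg .x < n := hg.adj_lt hc.adj_pq
  have hyn : h.reg .y < n := hg.adj_lt hc.adj_qr.symm
  have hzn : h.reg .z < n := hg.adj_lt (w := h.reg .v) (by rw [G.adj_comm, hb.nq]; simp)
  have hn := hg.reg_n
  have kxy := hb.pr
  have kzx := hb.sp
  have kzy := hb.sr
  simp only [applyB, wp_block_cons]
  refine wp_mono (wp_replaceNb (u := .x) (old := .v) (new := .y)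
    (by decide) ?_ ?_ ?_ ?_) ?_
  · rwa [hn]
  · rwa [hn]
  · rwa [hn]
  · rw [hn]
    exact hg.sum_lt _ hxn
  intro h₁ R₁
  have r₁ := R₁.reg
  have q₁ : h₁.reg .v = h.reg .v := r₁ _ (by decide)
  have q₂ : h₁.reg .x = h.reg .x := r₁ _ (by decide)
  have q₃ : h₁.reg .y = h.reg .y := r₁ _ (by decide)
  have q₆ : h₁.reg .n = n := by rw [r₁ _ (by decide), hn]
  rw [wp_block_cons]
  refine wp_mono (wp_replaceNb (u := .y) (old := .v) (new := .x)
    (by decide) ?_ ?_ ?_ ?_) ?_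
  · rwa [q₆]
  · rwa [q₁, q₆]
  · rwa [q₂, q₆]
  · rw [q₃, R₁.sum_ne _ kxy.symm, q₆]
    exact hg.sum_lt _ hyn
  rw [q₁, q₂, q₃]
  intro h₂ R₂
  have r₂ : ∀ r, r ≠ .tmp → h₂.reg r = h.reg r := fun r hr => by rw [R₂.reg r hr, r₁ r hr]
  have o₁ : h₂.reg .v = h.reg .v := r₂ _ (by decide)
  have o₂ : h₂.reg .x = h.reg .x := r₂ _ (by decide)
  have o₃ : h₂.reg .y = h.reg .y := r₂ _ (by decide)
  have o₄ : h₂.reg .z = h.reg .z := r₂ _ (by decide)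
  have o₆ : h₂.reg .n = n := by rw [r₂ _ (by decide), hn]
  have hsz : h₂.arr .sum (h.reg .z) = h.arr .sum (h.reg .z) := by
    rw [R₂.sum_ne _ kzy, R₁.sum_ne _ kzx]
  have d₂ : ∀ i, h₂.arr .deg i = h.arr .deg i := fun i => by rw [R₂.deg, R₁.deg]
  rw [wp_block_cons]
  refine wp_mono (wp_removeNb ?_ ?_ ?_ ?_ ?_) ?_
  · rwa [o₆]
  · rwa [o₁, o₆]
  · rwa [o₂, o₆]
  · rwa [o₃, o₆]
  · rw [o₄, o₆, hsz]
    exact hg.sum_lt _ hzn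
  rw [o₁, o₂, o₃, o₄]
  intro h₃ R₃
  have r₃ : ∀ r, r ≠ .tmp → h₃.reg r = h.reg r := fun r hr => by rw [R₃.reg r hr, r₂ r hr]
  have p₁ : h₃.reg .v = h.reg .v := r₃ _ (by decide)
  have p₂ : h₃.reg .x = h.reg .x := r₃ _ (by decide)
  have p₃ : h₃.reg .y = h.reg .y := r₃ _ (by decide)
  have p₄ : h₃.reg .z = h.reg .z := r₃ _ (by decide)
  have p₆ : h₃.reg .n = n := by rw [r₃ _ (by decide), hn]
  have p₇ : h₃.reg .alive = h.reg .alive := r₃ _ (by decide)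
  have p₈ : h₃.reg .dsum = h.reg .dsum := r₃ _ (by decide)
  have p₉ : h₃.reg .sp = h.reg .sp := r₃ _ (by decide)
  simp only [wp, block, Ex.Safe, Ex.val, St.setArr_reg, St.setReg_reg, reduceCtorEq, if_false,
    p₁, p₂, p₃, p₄, p₇, p₈, Nat.reduceLT, true_and, and_self]
  have key := hg.opB (h' := ((((((h₃.setArr .deg (h.reg .v) 0).setReg
    .alive (h.reg .alive - 1)).setReg .dsum (h.reg .dsum - 4)).setReg .done 1).setReg .t₁
    (h.reg .x)).setReg .t₂ (h.reg .y)).setReg .t₃ (h.reg .z)) hb (by simp [p₆, hn]) (by simp)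
    (by simp) ?_ ?_ ?_ ?_ ?_ ?_ ?_ ?_ ?_
  · obtain ⟨kg, k2⟩ := key
    refine ⟨_, _, _, kg, ?_, ?_, ?_, ?_, ?_, ?_, ?_, ?_, ?_⟩
    · simpa using CRed.iff_opB hc
    · simp; omega
    · simpa using p₉
    · simp
    · intro i
      simp [R₃.stack, R₂.stack, R₁.stack]
    -- The deleted vertex `v` has degree 0 now, so it need not be among the touched vertices.
    · intro u hu hne
      simp only [St.setReg_reg, reduceCtorEq, if_false, if_true]
      by_contra! hcon
      rw [hb.card_nbhdB hg.nbhd] at hu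
      have : ¬ u = h.reg .v := fun e => by simp [e] at hu
      refine hne.resolve_right this ?_
      simp [nbhdB, hcon, this]
    · simpa using hxn
    · simpa using hyn
    · simpa using hzn
  · intro i
    simp [R₃.deg, d₂]
  · intro f hf i hi
    have hfd : f ≠ .deg := by rcases hf with rfl | rfl | rfl <;> decide
    rw [← d₂] at hi
    simp [hfd, R₃.nb f hf i hi, R₂.nb f hf, R₁.nb f hf]
    grind
  · intro hd
    rw [← d₂] at hd
    simp [R₃.nb₁ hd]
  · intro hd
    rw [← d₂] at hd
    simp [R₃.nb₂ hd]
  · intro hd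
    rw [← d₂] at hd
    have := R₃.nb₃_lt hd
    rw [o₆] at this
    simpa using this
  · intro hd
    rw [← d₂] at hd
    have := R₃.nb₃ hd
    rw [o₆] at this
    simpa using this
  · intro i h1 h2 h3
    simp [R₃.sum_ne i h3, R₂.sum_ne i h2, R₁.sum_ne i h1]
  · rintro i (rfl | rfl | rfl)
    · have := R₁.sum_lt
      rw [hn] at this
      simpa [R₃.sum_ne _ kzx.symm, R₂.sum_ne _ kxy] using this
    · have := R₂.sum_lt
      rw [q₆] at this
      simpa [R₃.sum_ne _ kzy.symm] using this
    · have := R₃.sum_lt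
      rw [o₆] at this
      simpa using this
  · have := R₃.sum_modEq
    rw [o₆, hsz] at this
    simpa using this

end ArrayLang

/-! ### Testing whether a reduction applies at a vertex -/

namespace ArrayLang

open D3

/-- A reduction applies at `u`: `u` is in the triangle of rule D3a, or the vertex that rule D3b
deletes. -/
def Active (G : SimpleGraph ℕ) (u : ℕ) : Prop := ∃ x y, CanA G u x y ∨ CanB G x u y

/-- In `IsA` and `IsB` only the neighborhoods of three vertices of degree three occur, namely `u`
and two of its neighbors; nothing is required of the neighborhood of the apex. So a vertex can
become active only near a changed vertex of degree three. -/
theorem Active.of_unchanged {G G' : SimpleGraph ℕ} {F F' : ℕ → Finset ℕ} (hF : Nbhd G F)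
    (hF' : Nbhd G' F') {u : ℕ}
    (hu : ∀ w, (F' w).card = 3 → w = u ∨ w ∈ F' u → F' w = F w) (h : Active G' u) :
    Active G u := by
  have key : ∀ w, DegThree G' w → w = u ∨ G'.Adj u w → ∀ t, G.Adj w t ↔ G'.Adj w t := by
    intro w hw hwu t
    rw [← hF, ← hF', hu w (hF'.degThree_iff.1 hw) (by rwa [hF'])]
  obtain ⟨x, y, h | h⟩ := h
  · have ku := key u h.deg_p (.inl rfl)
    have kx := key x h.deg_q (.inr h.adj_pq)
    have ky := key y h.deg_r (.inr h.adj_pr)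
    obtain ⟨u', x', y', h⟩ := canA_iff.1 h
    exact ⟨x, y, .inl (canA_iff.2 ⟨u', x', y', { h with
      np := fun w => (ku w).trans (h.np w)
      nq := fun w => (kx w).trans (h.nq w)
      nr := fun w => (ky w).trans (h.nr w) }⟩)⟩
  · have ku := key u h.deg_q (.inl rfl)
    have kx := key x h.deg_p (.inr h.adj_pq.symm)
    have ky := key y h.deg_r (.inr h.adj_qr)
    obtain ⟨s, x', y', h⟩ := canB_iff.1 h
    exact ⟨x, y, .inr (canB_iff.2 ⟨s, x', y', { h with
      np := fun w => (kx w).trans (h.np w)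
      nq := fun w => (ku w).trans (h.nq w)
      nr := fun w => (ky w).trans (h.nr w) }⟩)⟩

/-- Is `w` one of the three recorded neighbors of `u`? -/
def isNb (u w : Reg) : Ex :=
  .or (.eq (.arr .nb₁ u) (.reg w)) (.or (.eq (.arr .nb₂ u) (.reg w)) (.eq (.arr .nb₃ u) (.reg w)))

/-- The recorded neighbor of `u` other than `a` and `b`. -/
def thirdNb (u a b : Reg) : Ex :=
  .sub (.sub (.add (.add (.arr .nb₁ u) (.arr .nb₂ u)) (.arr .nb₃ u)) (.reg a)) (.reg b)

/-- Apply a reduction to `v` and its neighbors `x` and `y` if possible; `z` is the third neighbor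
of `v`. -/
def tryReduce : Pr :=
  .ite (.eq (.arr .deg .x) (.const 3)) (.ite (.eq (.arr .deg .y) (.const 3))
    (.ite (isNb .x .y)
      (block [.set .x' (thirdNb .x .v .y), .set .y' (thirdNb .y .v .x),
        .ite (.eq (.reg .z) (.reg .x')) .skip (.ite (.eq (.reg .z) (.reg .y')) .skip
          (.ite (.eq (.reg .x') (.reg .y')) .skip applyA))])
      (.ite (isNb .x .z) (.ite (isNb .y .z) applyB .skip) .skip)) .skip) .skip

theorem isNb_safe {E : Env} {h : St} {u w : Reg} : (isNb u w).Safe E h := by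
  simp [isNb, Ex.Safe]

theorem isNb_val {E : Env} {h : St} {u w : Reg} : (isNb u w).val E h ≠ 0 ↔
    h.reg w ∈ ({h.arr .nb₁ (h.reg u), h.arr .nb₂ (h.reg u), h.arr .nb₃ (h.reg u)} : Finset ℕ) := by
  simp only [isNb, Ex.val, Finset.mem_insert, Finset.mem_singleton]
  split_ifs <;> simp_all <;> grind

theorem isNb_val' {E : Env} {h : St} {u w : Reg} : (isNb u w).val E h = 0 ↔
    h.reg w ∉ ({h.arr .nb₁ (h.reg u), h.arr .nb₂ (h.reg u), h.arr .nb₃ (h.reg u)} : Finset ℕ) := by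
  rw [← isNb_val (E := E), not_not]

theorem eq_val {E : Env} {h : St} {a b : Ex} :
    (Ex.eq a b).val E h ≠ 0 ↔ a.val E h = b.val E h := by
  simp [Ex.val]

theorem eq_val' {E : Env} {h : St} {a b : Ex} :
    (Ex.eq a b).val E h = 0 ↔ a.val E h ≠ b.val E h := by
  simp [Ex.val]

theorem third_spec {a b c v y : ℕ} (h3 : ({a, b, c} : Finset ℕ).card = 3)
    (hv : v ∈ ({a, b, c} : Finset ℕ)) (hy : y ∈ ({a, b, c} : Finset ℕ)) (hvy : v ≠ y) :
    a + b + c - v - y ≠ v ∧ a + b + c - v - y ≠ y ∧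
      ({a, b, c} : Finset ℕ) = {v, y, a + b + c - v - y} := by
  have hab : a ≠ b := by
    rintro rfl
    have := Finset.card_le_two (a := a) (b := c)
    simp at h3
    omega
  have hac : a ≠ c := by
    rintro rfl
    have := Finset.card_le_two (a := a) (b := b)
    rw [Finset.insert_comm, Finset.pair_eq_singleton, Finset.pair_comm] at h3
    omega
  have hbc : b ≠ c := by
    rintro rfl
    have := Finset.card_le_two (a := a) (b := b)
    simp at h3
    omega
  simp only [Finset.mem_insert, Finset.mem_singleton] at hv hy
  have h1 : a + b + c - v - y ≠ v ∧ a + b + c - v - y ≠ y ∧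
    (a + b + c - v - y = a ∨ a + b + c - v - y = b ∨ a + b + c - v - y = c) := by omega
  refine ⟨h1.1, h1.2.1, ?_⟩
  ext u
  simp only [Finset.mem_insert, Finset.mem_singleton]
  omega

theorem Good.of_eq {n : ℕ} {h h' : St} {G : SimpleGraph ℕ} {F : ℕ → Finset ℕ} {A : Finset ℕ}
    (hg : Good n h G F A) (hn : h'.reg .n = h.reg .n) (ha : h'.reg .alive = h.reg .alive)
    (hd : h'.reg .dsum = h.reg .dsum) (harr : ∀ f, f ≠ .stack → ∀ i, h'.arr f i = h.arr f i) :
    Good n h' G F A := by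
  have h1 := harr .deg (by decide)
  have h2 := harr .nb₁ (by decide)
  have h3 := harr .nb₂ (by decide)
  have h4 := harr .nb₃ (by decide)
  have h5 := harr .sum (by decide)
  obtain ⟨g1, g2, g3, g4, g5, g6, g7, g8, g9, g10, g11⟩ := hg
  refine ⟨hn.trans g1, g2, g3.trans ha.symm, g4, g5, hd.trans g6, ?_, ?_, ?_, ?_, ?_⟩
  · simpa only [h1] using g7
  · simpa only [h2, h3, h4] using g8
  · simpa only [h5] using g9
  · rintro f (rfl | rfl | rfl)
    · simpa only [h2] using g10 _ (.inl rfl)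
    · simpa only [h3] using g10 _ (.inr (.inl rfl))
    · simpa only [h4] using g10 _ (.inr (.inr rfl))
  · simpa only [h5] using g11

/-- The state `h` arises from `h₀` by unsuccessful attempts, which show `P`, or by a reduction. -/
def Tried (n : ℕ) (h₀ : St) (G : SimpleGraph ℕ) (F : ℕ → Finset ℕ) (P : Prop) (h : St) : Prop :=
  (h.reg .done = 0 ∧ h.arr = h₀.arr ∧ (∀ r, r = .n ∨ r = .alive ∨ r = .dsum ∨ r = .sp ∨ r = .v →
    h.reg r = h₀.reg r) ∧ P) ∨ ∃ G' F' A', Reduced n h₀ h G F G' F' A'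

theorem Reduced.of_eq {n : ℕ} {h₀ h h' : St} {G : SimpleGraph ℕ} {F : ℕ → Finset ℕ}
    {G' : SimpleGraph ℕ} {F' : ℕ → Finset ℕ} {A' : Finset ℕ} (hr : Reduced n h h' G F G' F' A')
    (harr : h.arr = h₀.arr) (hreg : ∀ r, r = .n ∨ r = .alive ∨ r = .dsum ∨ r = .sp ∨ r = .v →
      h.reg r = h₀.reg r) : Reduced n h₀ h' G F G' F' A' := by
  have h1 := hreg .alive (by simp)
  have h2 := hreg .sp (by simp)
  have h3 := hreg .v (by simp)
  obtain ⟨g1, g2, g3, g4, g5, g6, g7, g8, g9, g10⟩ := hr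
  rw [h1] at g2 g3
  rw [h2] at g4
  rw [harr] at g6
  rw [h3] at g7
  exact ⟨g1, g2, g3, g4, g5, g6, g7, g8, g9, g10⟩

/-- If `x` and `y` are adjacent, only D3a is possible, with the outside neighbors computed as the
third neighbors. If they are not, only D3b is possible, and its apex must be `z`. `P` accumulates
what earlier attempts have ruled out. -/
theorem wp_tryReduce {E : Env} {n : ℕ} {h₀ h : St} {G : SimpleGraph ℕ} {F : ℕ → Finset ℕ}
    {A : Finset ℕ} {P : Prop} (hg : Good n h₀ G F A) (hM : 4 * n < E.M)
    (hdone : h.reg .done = 0) (harr : h.arr = h₀.arr)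
    (hreg : ∀ r, r = .n ∨ r = .alive ∨ r = .dsum ∨ r = .sp ∨ r = .v → h.reg r = h₀.reg r)
    (hP : P) (hv3 : (F (h.reg .v)).card = 3)
    (hv : F (h.reg .v) = {h.reg .x, h.reg .y, h.reg .z}) :
    wp E tryReduce (Tried n h₀ G F (P ∧ ¬ CanA G (h.reg .v) (h.reg .x) (h.reg .y) ∧
      ¬ CanB G (h.reg .x) (h.reg .v) (h.reg .y))) h := by
  have hg' : Good n h G F A := hg.of_eq (hreg _ (by simp)) (hreg _ (by simp)) (hreg _ (by simp))
    (fun f _ i => by rw [harr])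
  have hN := hg.nbhd
  have dist : h.reg .x ≠ h.reg .y ∧ h.reg .x ≠ h.reg .z ∧ h.reg .y ≠ h.reg .z := by
    rw [hv] at hv3
    refine ⟨?_, ?_, ?_⟩ <;> intro e <;> rw [e] at hv3
    · have := Finset.card_le_two (a := h.reg .y) (b := h.reg .z)
      simp at hv3
      omega
    · have := Finset.card_le_two (a := h.reg .y) (b := h.reg .z)
      rw [Finset.insert_comm, Finset.pair_eq_singleton] at hv3
      omega
    · have := Finset.card_le_two (a := h.reg .x) (b := h.reg .z)
      simp at hv3
      omega
  have nv : ∀ w, G.Adj (h.reg .v) w ↔ w = h.reg .x ∨ w = h.reg .y ∨ w = h.reg .z := by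
    intro w
    rw [← hN, hv]
    simp
  have avx := (nv (h.reg .x)).2 (by simp)
  have avy := (nv (h.reg .y)).2 (by simp)
  have avz := (nv (h.reg .z)).2 (by simp)
  have hxn := hg.adj_lt avx.symm
  have hyn := hg.adj_lt avy.symm
  have fail : (¬ CanA G (h.reg .v) (h.reg .x) (h.reg .y) ∧
      ¬ CanB G (h.reg .x) (h.reg .v) (h.reg .y)) → Tried n h₀ G F (P ∧
      ¬ CanA G (h.reg .v) (h.reg .x) (h.reg .y) ∧ ¬ CanB G (h.reg .x) (h.reg .v) (h.reg .y)) h :=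
    fun hf => .inl ⟨hdone, harr, hreg, hP, hf⟩
  refine ⟨by simp [Ex.Safe], fun h1 => ?_, fun h1 => ?_⟩
  swap
  · rw [eq_val'] at h1
    refine fail ⟨fun hc => h1 ?_, fun hc => h1 ?_⟩
    · exact (hg'.deg _ hxn).trans (hN.degThree_iff.1 hc.deg_q)
    · exact (hg'.deg _ hxn).trans (hN.degThree_iff.1 hc.deg_p)
  rw [eq_val] at h1
  have hx3 : (F (h.reg .x)).card = 3 := (hg'.deg _ hxn).symm.trans h1
  refine ⟨by simp [Ex.Safe], fun h2 => ?_, fun h2 => ?_⟩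
  swap
  · rw [eq_val'] at h2
    refine fail ⟨fun hc => h2 ?_, fun hc => h2 ?_⟩
    · exact (hg'.deg _ hyn).trans (hN.degThree_iff.1 hc.deg_r)
    · exact (hg'.deg _ hyn).trans (hN.degThree_iff.1 hc.deg_r)
  rw [eq_val] at h2
  have hy3 : (F (h.reg .y)).card = 3 := (hg'.deg _ hyn).symm.trans h2
  have hFx := hg'.nb _ hxn hx3
  have hFy := hg'.nb _ hyn hy3
  have lx₁ := hg'.nb_lt _ (.inl rfl) _ hxn
  have lx₂ := hg'.nb_lt _ (.inr (.inl rfl)) _ hxn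
  have lx₃ := hg'.nb_lt _ (.inr (.inr rfl)) _ hxn
  have ly₁ := hg'.nb_lt _ (.inl rfl) _ hyn
  have ly₂ := hg'.nb_lt _ (.inr (.inl rfl)) _ hyn
  have ly₃ := hg'.nb_lt _ (.inr (.inr rfl)) _ hyn
  refine ⟨isNb_safe, fun h3 => ?_, fun h3 => ?_⟩
  · rw [isNb_val, ← hFx, hN] at h3
    simp only [wp_block_cons]
    refine ⟨?_, ?_, ?_⟩
    · simp [thirdNb, Ex.Safe, Ex.val]
      omega
    · simp [thirdNb, Ex.Safe, Ex.val]
      omega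
    obtain ⟨c1, c2, c3⟩ := third_spec (hFx ▸ hx3) (v := h.reg .v) (y := h.reg .y)
      (by rw [← hFx, hN]; exact avx.symm) (by rw [← hFx, hN]; exact h3) avy.ne
    obtain ⟨d1, d2, d3⟩ := third_spec (hFy ▸ hy3) (v := h.reg .v) (y := h.reg .x)
      (by rw [← hFy, hN]; exact avy.symm) (by rw [← hFy, hN]; exact h3.symm) avx.ne
    rw [← hFx] at c3
    rw [← hFy] at d3
    simp only [thirdNb, Ex.val, St.setReg_reg, St.setReg_arr, reduceCtorEq, if_false]
    generalize h.arr .nb₁ (h.reg .x) + h.arr .nb₂ (h.reg .x) + h.arr .nb₃ (h.reg .x) -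
      h.reg .v - h.reg .y = a at *
    generalize h.arr .nb₁ (h.reg .y) + h.arr .nb₂ (h.reg .y) + h.arr .nb₃ (h.reg .y) -
      h.reg .v - h.reg .x = b at *
    have nx : ∀ w, G.Adj (h.reg .x) w ↔ w = h.reg .v ∨ w = h.reg .y ∨ w = a := by
      intro w
      rw [← hN, c3]
      simp
    have ny : ∀ w, G.Adj (h.reg .y) w ↔ w = h.reg .v ∨ w = h.reg .x ∨ w = b := by
      intro w
      rw [← hN, d3]
      simp
    have ax := ((nx a).2 (by simp)).ne'
    have ay := ((ny b).2 (by simp)).ne'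
    have notB : ¬ CanB G (h.reg .x) (h.reg .v) (h.reg .y) := fun hc => hc.not_adj_pr h3
    have isA : ∀ {p' q' r'}, IsA G (h.reg .v) (h.reg .x) (h.reg .y) p' q' r' →
        h.reg .z = p' ∧ a = q' ∧ b = r' := by
      intro p' q' r' hA
      have e1 := (hA.np (h.reg .z)).1 avz
      have e2 := (hA.nq a).1 ((nx a).2 (by simp))
      have e3 := (hA.nr b).1 ((ny b).2 (by simp))
      grind
    have fail' : ¬ CanA G (h.reg .v) (h.reg .x) (h.reg .y) → Tried n h₀ G F (P ∧
        ¬ CanA G (h.reg .v) (h.reg .x) (h.reg .y) ∧ ¬ CanB G (h.reg .x) (h.reg .v) (h.reg .y))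
        ((h.setReg .x' a).setReg .y' b) := by
      refine fun hf => .inl ⟨by simpa using hdone, harr, fun r hr => ?_, hP, hf, notB⟩
      rw [← hreg r hr]
      rcases hr with rfl | rfl | rfl | rfl | rfl <;> simp
    refine ⟨by simp [Ex.Safe], fun h4 => ?_, fun h4 => ?_⟩
    · rw [eq_val] at h4
      simp [Ex.val] at h4
      refine fail' fun hc => ?_
      obtain ⟨p', q', r', hA⟩ := canA_iff.1 hc
      obtain ⟨rfl, rfl, rfl⟩ := isA hA
      exact hA.pq' h4
    refine ⟨by simp [Ex.Safe], fun h5 => ?_, fun h5 => ?_⟩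
    · rw [eq_val] at h5
      simp [Ex.val] at h5
      refine fail' fun hc => ?_
      obtain ⟨p', q', r', hA⟩ := canA_iff.1 hc
      obtain ⟨rfl, rfl, rfl⟩ := isA hA
      exact hA.pr' h5
    refine ⟨by simp [Ex.Safe], fun h6 => ?_, fun h6 => ?_⟩
    · rw [eq_val] at h6
      simp [Ex.val] at h6
      refine fail' fun hc => ?_
      obtain ⟨p', q', r', hA⟩ := canA_iff.1 hc
      obtain ⟨rfl, rfl, rfl⟩ := isA hA
      exact hA.qr' h6
    rw [eq_val'] at h4 h5 h6
    simp [Ex.val] at h4 h5 h6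
    refine wp_mono (wp_applyA (hg'.of_eq (h' := (h.setReg .x' a).setReg .y' b) (by simp) (by simp)
      (by simp) (fun _ _ _ => rfl)) hM ?_) ?_
    · simp only [St.setReg_reg, reduceCtorEq, if_false, if_true]
      exact ⟨nv, nx, ny, avx.ne, avy.ne, dist.1, ⟨avz.ne', dist.2.1.symm, dist.2.2.symm⟩,
        ⟨c1, ax, c2⟩, ⟨d1, d2, ay⟩, h4, h5, h6⟩
    · rintro h' ⟨G', F', A', hR⟩
      refine .inr ⟨G', F', A', hR.of_eq harr fun r hr => ?_⟩
      rw [← hreg r hr]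
      rcases hr with rfl | rfl | rfl | rfl | rfl <;> simp
  · rw [isNb_val', ← hFx, hN] at h3
    have notA : ¬ CanA G (h.reg .v) (h.reg .x) (h.reg .y) := fun hc => h3 hc.adj_qr
    have apex : CanB G (h.reg .x) (h.reg .v) (h.reg .y) →
        G.Adj (h.reg .x) (h.reg .z) ∧ G.Adj (h.reg .y) (h.reg .z) := by
      intro hc
      obtain ⟨s, s1, s2, s3⟩ := hc.apex
      have := (nv s).1 s2.symm
      have := s1.ne
      have := s3.ne
      have : s = h.reg .z := by grind
      subst this
      exact ⟨s1.symm, s3.symm⟩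
    refine ⟨isNb_safe, fun h4 => ?_, fun h4 => ?_⟩
    swap
    · rw [isNb_val', ← hFx, hN] at h4
      exact fail ⟨notA, fun hc => h4 (apex hc).1⟩
    rw [isNb_val, ← hFx, hN] at h4
    refine ⟨isNb_safe, fun h5 => ?_, fun h5 => ?_⟩
    swap
    · rw [isNb_val', ← hFy, hN] at h5
      exact fail ⟨notA, fun hc => h5 (apex hc).2⟩
    rw [isNb_val, ← hFy, hN] at h5
    have hB : CanB G (h.reg .x) (h.reg .v) (h.reg .y) :=
      ⟨hN.degThree_iff.2 hx3, hN.degThree_iff.2 hv3, hN.degThree_iff.2 hy3, avx.symm, avy,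
        dist.1, h3, _, h4.symm, avz.symm, h5.symm⟩
    obtain ⟨s, p', r', hB⟩ := canB_iff.1 hB
    have hs : s = h.reg .z := by
      have := (hB.nq (h.reg .z)).1 avz
      grind
    subst hs
    refine wp_mono (wp_applyB hg' hM hB) ?_
    rintro h' ⟨G', F', A', hR⟩
    exact .inr ⟨G', F', A', hR.of_eq harr hreg⟩

end ArrayLang

/-! ### The main loop and its stack -/

namespace ArrayLang

open D3

theorem wp_set {E : Env} {r : Reg} {e : Ex} {Q : St → Prop} {h : St} (hs : e.Safe E h)
    (hQ : Q (h.setReg r (e.val E h))) : wp E (.set r e) Q h :=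
  ⟨hs, hQ⟩

theorem wp_ite {E : Env} {e : Ex} {c d : Pr} {Q : St → Prop} {h : St} (hs : e.Safe E h)
    (hc : e.val E h ≠ 0 → wp E c Q h) (hd : e.val E h = 0 → wp E d Q h) :
    wp E (.ite e c d) Q h :=
  ⟨hs, hc, hd⟩

theorem wp_skip {E : Env} {Q : St → Prop} {h : St} (hQ : Q h) : wp E .skip Q h := hQ

theorem wp_seq {E : Env} {c : Pr} {l : List Pr} {Q : St → Prop} {h : St}
    (hc : wp E c (wp E (block l) Q) h) : wp E (block (c :: l)) Q h :=
  hc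

theorem wp_nil {E : Env} {Q : St → Prop} {h : St} (hQ : Q h) : wp E (block []) Q h := hQ

/-- Unless a reduction has been made, try to make one with the neighbors of `v` in the given
order. -/
def attempt (f₁ f₂ f₃ : Field) : Pr :=
  .ite (.reg .done) .skip
    (block [.set .x (.arr f₁ .v), .set .y (.arr f₂ .v), .set .z (.arr f₃ .v), tryReduce])

theorem wp_attempt {E : Env} {n : ℕ} {h₀ h : St} {G : SimpleGraph ℕ} {F : ℕ → Finset ℕ}
    {A : Finset ℕ} {P : Prop} (f₁ f₂ f₃ : Field) (hg : Good n h₀ G F A) (hM : 4 * n < E.M)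
    (hv3 : (F (h₀.reg .v)).card = 3)
    (hv : F (h₀.reg .v) =
      {h₀.arr f₁ (h₀.reg .v), h₀.arr f₂ (h₀.reg .v), h₀.arr f₃ (h₀.reg .v)})
    (ht : Tried n h₀ G F P h) :
    wp E (attempt f₁ f₂ f₃) (Tried n h₀ G F (P ∧
      ¬ CanA G (h₀.reg .v) (h₀.arr f₁ (h₀.reg .v)) (h₀.arr f₂ (h₀.reg .v)) ∧
      ¬ CanB G (h₀.arr f₁ (h₀.reg .v)) (h₀.reg .v) (h₀.arr f₂ (h₀.reg .v)))) h := by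
  refine ⟨trivial, fun h1 => ?_, fun h1 => ?_⟩
  · rcases ht with ht | ht
    · exact absurd ht.1 h1
    · exact .inr ht
  · rcases ht with ⟨g1, g2, g3, hP⟩ | ⟨G', F', A', ht⟩
    · have hv0 := g3 .v (by simp)
      simp only [wp_block_cons]
      refine ⟨trivial, trivial, trivial, ?_⟩
      simp only [Ex.val, St.setReg_reg, St.setReg_arr, reduceCtorEq, if_false, g2, hv0]
      have := wp_tryReduce (E := E) (h := ((h.setReg .x (h₀.arr f₁ (h₀.reg .v))).setReg .y
        (h₀.arr f₂ (h₀.reg .v))).setReg .z (h₀.arr f₃ (h₀.reg .v))) hg hM (by simpa using g1) g2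
        (fun r hr => ?_) hP (by simpa [hv0] using hv3) (by simpa [hv0] using hv)
      · simp only [St.setReg_reg, reduceCtorEq, if_false, if_true, hv0] at this
        exact wp_mono this fun _ h => h
      · rw [← g3 r hr]
        rcases hr with rfl | rfl | rfl | rfl | rfl <;> simp
    · have h2 := ht.done
      simp only [Ex.val] at h1
      omega

/-- Push a vertex on the stack. -/
def push (r : Reg) : Pr := block [.put .stack .sp (.reg r), .set .sp (.add (.reg .sp) (.const 1))]

/-- Push a vertex and its recorded neighbors on the stack. -/
def pushAll (r : Reg) : Pr := block
  [push r, .set .tmp (.arr .nb₁ r), push .tmp, .set .tmp (.arr .nb₂ r), push .tmp,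
    .set .tmp (.arr .nb₃ r), push .tmp]

/-- The vertex `t` and its recorded neighbors have been pushed. -/
structure Pushed (h h' : St) (t : ℕ) : Prop where
  reg : ∀ r, r ≠ .tmp → r ≠ .sp → h'.reg r = h.reg r
  arr : ∀ f, f ≠ .stack → ∀ i, h'.arr f i = h.arr f i
  sp : h'.reg .sp = h.reg .sp + 4
  stack : ∀ i < h.reg .sp, h'.arr .stack i = h.arr .stack i
  top : h'.arr .stack (h.reg .sp) = t
  top₁ : h'.arr .stack (h.reg .sp + 1) = h.arr .nb₁ t
  top₂ : h'.arr .stack (h.reg .sp + 2) = h.arr .nb₂ t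
  top₃ : h'.arr .stack (h.reg .sp + 3) = h.arr .nb₃ t

theorem wp_pushAll {E : Env} {h : St} {r : Reg} (hr : r ≠ .tmp) (hr' : r ≠ .sp)
    (hM : h.reg .sp + 4 < E.M) :
    wp E (pushAll r) (fun h' => Pushed h h' (h.reg r)) h := by
  simp only [pushAll, push, block, wp, Ex.Safe, Ex.val, St.setReg_reg, St.setArr_reg,
    St.setReg_arr, St.setArr_arr, reduceCtorEq, if_true, if_false, hr, hr', true_and,
    false_and, Nat.reduceLT, add_assoc, Nat.reduceAdd]
  refine ⟨by omega, by omega, by omega, by omega, ?_⟩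
  constructor
  · intro q h1 h2
    simp [h1, h2]
  · intro f hf i
    simp [hf]
  · simp
  · intro i hi
    simp
    rw [if_neg, if_neg, if_neg, if_neg] <;> omega
  all_goals simp

theorem Pushed.stack_lt {h h' : St} {t n : ℕ} (hp : Pushed h h' t)
    (hs : ∀ i < h.reg .sp, h.arr .stack i < n) (ht : t < n)
    (hnb : ∀ f : Field, f.IsNb → h.arr f t < n) : ∀ i < h'.reg .sp, h'.arr .stack i < n := by
  intro i hi
  rw [hp.sp] at hi
  by_cases h0 : i < h.reg .sp
  · rw [hp.stack i h0]
    exact hs i h0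
  obtain rfl | rfl | rfl | rfl : i = h.reg .sp ∨ i = h.reg .sp + 1 ∨ i = h.reg .sp + 2 ∨
    i = h.reg .sp + 3 := by omega
  · rwa [hp.top]
  · rw [hp.top₁]
    exact hnb _ (.inl rfl)
  · rw [hp.top₂]
    exact hnb _ (.inr (.inl rfl))
  · rw [hp.top₃]
    exact hnb _ (.inr (.inr rfl))

theorem Pushed.mem_old {h h' : St} {t u : ℕ} (hp : Pushed h h' t)
    (hu : ∃ i < h.reg .sp, h.arr .stack i = u) : ∃ i < h'.reg .sp, h'.arr .stack i = u := by
  obtain ⟨i, hi, hiu⟩ := hu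
  exact ⟨i, by rw [hp.sp]; omega, by rw [hp.stack i hi, hiu]⟩

theorem Pushed.mem_new {h h' : St} {t u : ℕ} (hp : Pushed h h' t)
    (hu : u = t ∨ ∃ f : Field, f.IsNb ∧ u = h.arr f t) :
    ∃ i < h'.reg .sp, h'.arr .stack i = u := by
  have h4 := hp.sp
  rcases hu with rfl | ⟨f, rfl | rfl | rfl, rfl⟩
  · exact ⟨_, by omega, hp.top⟩
  · exact ⟨_, by omega, hp.top₁⟩
  · exact ⟨_, by omega, hp.top₂⟩
  · exact ⟨_, by omega, hp.top₃⟩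

/-- The body of the main loop: pop a vertex and apply a reduction there if possible. -/
def mainBody : Pr := block
  [.set .sp (.sub (.reg .sp) (.const 1)), .set .v (.arr .stack .sp), .set .done (.const 0),
    .ite (.eq (.arr .deg .v) (.const 3)) (block
      [attempt .nb₁ .nb₂ .nb₃, attempt .nb₂ .nb₃ .nb₁, attempt .nb₃ .nb₁ .nb₂,
        .ite (.reg .done) (block [pushAll .t₁, pushAll .t₂, pushAll .t₃]) .skip]) .skip]

/-- The invariant of the main loop. -/
structure Inv (n : ℕ) (G₀ : SimpleGraph ℕ) (h : St) (G : SimpleGraph ℕ) (F : ℕ → Finset ℕ)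
    (A : Finset ℕ) : Prop where
  good : Good n h G F A
  cRed : CRed G₀ n ↔ CRed G (h.reg .alive)
  stack_lt : ∀ i < h.reg .sp, h.arr .stack i < n
  active : ∀ u, Active G u → ∃ i < h.reg .sp, h.arr .stack i = u
  bound : h.reg .sp + 13 * h.reg .alive ≤ 14 * n

/-- Both rules are symmetric in the two neighbors of `v` that take part, so the three cyclic orders
cover all choices. -/
theorem not_active {G : SimpleGraph ℕ} {F : ℕ → Finset ℕ} (hF : Nbhd G F) {v a b c : ℕ}
    (hv : F v = {a, b, c}) (h1 : ¬ CanA G v a b ∧ ¬ CanB G a v b)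
    (h2 : ¬ CanA G v b c ∧ ¬ CanB G b v c) (h3 : ¬ CanA G v c a ∧ ¬ CanB G c v a) :
    ¬ Active G v := by
  have mem : ∀ w, G.Adj v w → w = a ∨ w = b ∨ w = c := by
    intro w hw
    rw [← hF, hv] at hw
    simpa using hw
  rintro ⟨x, y, h | h⟩
  · have hs := h.swap_qr
    have hne := h.adj_qr.ne
    rcases mem x h.adj_pq with rfl | rfl | rfl <;> rcases mem y h.adj_pr with rfl | rfl | rfl <;>
      grind
  · have hs := h.swap
    have hne := h.ne_pr
    rcases mem x h.adj_pq.symm with rfl | rfl | rfl <;>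
      rcases mem y h.adj_qr with rfl | rfl | rfl <;> grind

theorem wp_mainBody {E : Env} {n : ℕ} {h : St} {G₀ G : SimpleGraph ℕ} {F : ℕ → Finset ℕ}
    {A : Finset ℕ} (hM : 20 * n + 20 < E.M) (hI : Inv n G₀ h G F A) (hsp : h.reg .sp ≠ 0) :
    wp E mainBody (fun h' => (∃ G' F' A', Inv n G₀ h' G' F' A') ∧
      h'.reg .sp + 13 * h'.reg .alive < h.reg .sp + 13 * h.reg .alive) h := by
  obtain ⟨hg, hcr, hst, hac, hbd⟩ := hI
  have hN := hg.nbhd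
  have hvn := hst (h.reg .sp - 1) (by omega)
  rw [mainBody]
  refine wp_seq (wp_set (by simp [Ex.Safe]) (wp_seq (wp_set trivial (wp_seq
    (wp_set (by simp [Ex.Safe]) (wp_seq ?_))))))
  simp only [Ex.val, St.setReg_reg, St.setReg_arr, if_true]
  generalize hh₀ : ((h.setReg .sp (h.reg .sp - 1)).setReg .v
    (h.arr .stack (h.reg .sp - 1))).setReg .done 0 = h₀
  have hsp₀ : h₀.reg .sp = h.reg .sp - 1 := by rw [← hh₀]; simp
  have hal₀ : h₀.reg .alive = h.reg .alive := by rw [← hh₀]; simp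
  have harr : h₀.arr = h.arr := by rw [← hh₀]; simp
  have hv₀ : h₀.reg .v = h.arr .stack (h.reg .sp - 1) := by rw [← hh₀]; simp
  have hd₀ : h₀.reg .done = 0 := by rw [← hh₀]; simp
  have hg₀ : Good n h₀ G F A :=
    hg.of_eq (by rw [← hh₀]; simp) hal₀ (by rw [← hh₀]; simp) (fun f _ i => by rw [harr])
  clear hh₀
  rw [← hv₀] at hvn
  have old : ∀ u, Active G u → u ≠ h₀.reg .v → ∃ i < h₀.reg .sp, h₀.arr .stack i = u := by
    intro u hu hne
    obtain ⟨i, hi, hiu⟩ := hac u hu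
    rw [harr, hsp₀]
    refine ⟨i, ?_, hiu⟩
    have : i ≠ h.reg .sp - 1 := by
      rintro rfl
      exact hne (hiu.symm.trans hv₀.symm)
    omega
  -- If no reduction applies at the popped vertex, the stack may lose it.
  have fail : ∀ h' : St, h'.arr = h₀.arr → (∀ r, r = .n ∨ r = .alive ∨ r = .dsum ∨ r = .sp ∨
      r = .v → h'.reg r = h₀.reg r) → ¬ Active G (h₀.reg .v) →
      (∃ G' F' A', Inv n G₀ h' G' F' A') ∧
      h'.reg .sp + 13 * h'.reg .alive < h.reg .sp + 13 * h.reg .alive := by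
    intro h' e1 e2 hna
    have a1 := e2 .alive (by simp)
    have a2 := e2 .sp (by simp)
    refine ⟨⟨G, F, A, hg₀.of_eq (e2 _ (by simp)) a1 (e2 _ (by simp)) (fun f _ i => by rw [e1]),
      ?_, ?_, ?_, ?_⟩, ?_⟩
    · rw [a1, hal₀]
      exact hcr
    · intro i hi
      rw [e1, harr]
      exact hst i (by omega)
    · intro u hu
      rw [a2, e1]
      exact old u hu (fun e => hna (e ▸ hu))
    · omega
    · omega
  refine wp_ite (by simp [Ex.Safe]) (fun h1 => ?_) (fun h1 => ?_)
  swap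
  · rw [eq_val'] at h1
    refine wp_skip (wp_nil (fail h₀ rfl (fun _ _ => rfl) fun hact => h1 ?_))
    refine (hg₀.deg _ hvn).trans (hN.degThree_iff.1 ?_)
    obtain ⟨x, y, hc | hc⟩ := hact
    · exact hc.deg_p
    · exact hc.deg_q
  rw [eq_val] at h1
  have hv3 : (F (h₀.reg .v)).card = 3 := (hg₀.deg _ hvn).symm.trans h1
  have hFv := hg₀.nb _ hvn hv3
  refine wp_seq (wp_mono (wp_attempt (P := True) .nb₁ .nb₂ .nb₃ hg₀ (by omega) hv3 hFv
    (.inl ⟨hd₀, rfl, fun _ _ => rfl, trivial⟩)) fun h₁ ht₁ => ?_)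
  refine wp_seq (wp_mono (wp_attempt .nb₂ .nb₃ .nb₁ hg₀ (by omega) hv3
    (by rw [hFv]; ext; simp; tauto) ht₁) fun h₂ ht₂ => ?_)
  refine wp_seq (wp_mono (wp_attempt .nb₃ .nb₁ .nb₂ hg₀ (by omega) hv3
    (by rw [hFv]; ext; simp; tauto) ht₂) fun h₃ ht₃ => wp_seq ?_)
  rcases ht₃ with ⟨g1, g2, g3, ⟨⟨-, g4⟩, g5⟩, g6⟩ | ⟨G', F', A', hR⟩
  · exact wp_ite trivial (fun hd => absurd g1 hd)
      (fun _ => wp_skip (wp_nil (wp_nil (fail h₃ g2 g3 (not_active hN hFv g4 g5 g6)))))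
  refine wp_ite trivial (fun _ => ?_) (fun hd => ?_)
  swap
  · have := hR.done
    simp only [Ex.val] at hd
    omega
  have b1 := hR.alive
  have b2 := hR.sp
  refine wp_seq (wp_mono (wp_pushAll (r := .t₁) (by decide) (by decide) (by omega)) fun h₄ p₁ => ?_)
  have c1 := p₁.sp
  refine wp_seq (wp_mono (wp_pushAll (r := .t₂) (by decide) (by decide) (by omega)) fun h₅ p₂ => ?_)
  have c2 := p₂.sp
  refine wp_seq (wp_mono (wp_pushAll (r := .t₃) (by decide) (by decide) (by omega)) fun h₆ p₃ =>
    wp_nil (wp_nil (wp_nil ?_)))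
  have c3 := p₃.sp
  have r₅ : ∀ r, r ≠ .tmp → r ≠ .sp → h₅.reg r = h₃.reg r := fun r e1 e2 => by
    rw [p₂.reg r e1 e2, p₁.reg r e1 e2]
  have r₆ : ∀ r, r ≠ .tmp → r ≠ .sp → h₆.reg r = h₃.reg r := fun r e1 e2 => by
    rw [p₃.reg r e1 e2, r₅ r e1 e2]
  have a₅ : ∀ f, f ≠ .stack → ∀ i, h₅.arr f i = h₃.arr f i := fun f hf i => by
    rw [p₂.arr f hf, p₁.arr f hf]
  have a₆ : ∀ f, f ≠ .stack → ∀ i, h₆.arr f i = h₃.arr f i := fun f hf i => by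
    rw [p₃.arr f hf, a₅ f hf]
  have al₆ : h₆.reg .alive = h₃.reg .alive := r₆ _ (by decide) (by decide)
  have n₃ : ∀ f : Field, f.IsNb → f ≠ .stack := by
    rintro f (rfl | rfl | rfl) <;> decide
  have ht₂ : h₄.reg .t₂ = h₃.reg .t₂ := p₁.reg _ (by decide) (by decide)
  have ht₃ : h₅.reg .t₃ = h₃.reg .t₃ := r₅ _ (by decide) (by decide)
  rw [ht₂] at p₂
  rw [ht₃] at p₃
  have hg₃ := hR.good
  have l₃ : ∀ i < h₃.reg .sp, h₃.arr .stack i < n := by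
    intro i hi
    rw [hR.stack, harr]
    exact hst i (by omega)
  have l₄ := p₁.stack_lt l₃ hR.t₁ fun f hf => hg₃.nb_lt f hf _ hR.t₁
  have l₅ := p₂.stack_lt l₄ hR.t₂ fun f hf => by
    rw [p₁.arr f (n₃ f hf)]
    exact hg₃.nb_lt f hf _ hR.t₂
  have l₆ := p₃.stack_lt l₅ hR.t₃ fun f hf => by
    rw [a₅ f (n₃ f hf)]
    exact hg₃.nb_lt f hf _ hR.t₃
  have new : ∀ t u, t = h₃.reg .t₁ ∨ t = h₃.reg .t₂ ∨ t = h₃.reg .t₃ →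
      u = t ∨ (∃ f : Field, f.IsNb ∧ u = h₃.arr f t) →
      ∃ i < h₆.reg .sp, h₆.arr .stack i = u := by
    rintro t u (rfl | rfl | rfl) hu
    · exact p₃.mem_old (p₂.mem_old (p₁.mem_new hu))
    · refine p₃.mem_old (p₂.mem_new (hu.imp_right ?_))
      rintro ⟨f, hf, rfl⟩
      exact ⟨f, hf, (p₁.arr f (n₃ f hf) _).symm⟩
    · refine p₃.mem_new (hu.imp_right ?_)
      rintro ⟨f, hf, rfl⟩
      exact ⟨f, hf, (a₅ f (n₃ f hf) _).symm⟩
  have hN' := hg₃.nbhd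
  refine ⟨⟨G', F', A', hg₃.of_eq (r₆ _ (by decide) (by decide)) al₆
    (r₆ _ (by decide) (by decide)) a₆, ?_, l₆, ?_, ?_⟩, ?_⟩
  · rw [al₆, ← hR.cRed, hal₀]
    exact hcr
  · intro u hu
    -- Either `u` is or neighbors a touched vertex of degree three, and was just pushed; or nothing
    -- relevant to `u` has changed, so that `u` was active before, differs from the popped vertex
    -- and is still on the stack.
    by_cases hch : ∃ w, (F' w).card = 3 ∧ (w = u ∨ w ∈ F' u) ∧ (F' w ≠ F w ∨ w = h₀.reg .v)
    · obtain ⟨w, hw3, hwu, hw⟩ := hch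
      have hwt := hR.touched w hw3 hw
      refine new w u hwt ?_
      rcases hwu with rfl | hwu
      · exact .inl rfl
      · right
        have hu' : u ∈ F' w := by
          rw [hN'] at hwu ⊢
          exact hwu.symm
        have hwn : w < n := by
          rw [hN'] at hu'
          exact hg₃.adj_lt hu'
        rw [hg₃.nb w hwn hw3] at hu'
        simp only [Finset.mem_insert, Finset.mem_singleton] at hu'
        rcases hu' with h | h | h
        · exact ⟨.nb₁, .inl rfl, h⟩
        · exact ⟨.nb₂, .inr (.inl rfl), h⟩
        · exact ⟨.nb₃, .inr (.inr rfl), h⟩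
    · have hch' : ∀ w, (F' w).card = 3 → (w = u ∨ w ∈ F' u) → F' w = F w ∧ w ≠ h₀.reg .v := by
        intro w hw3 hwu
        by_contra hcon
        exact hch ⟨w, hw3, hwu, by tauto⟩
      have hu3 : (F' u).card = 3 := by
        rw [← hN'.degThree_iff]
        obtain ⟨x, y, hc | hc⟩ := hu
        · exact hc.deg_p
        · exact hc.deg_q
      have hold := old u (hu.of_unchanged hN hN' fun w h1 h2 => (hch' w h1 h2).1)
        (hch' u hu3 (.inl rfl)).2
      refine p₃.mem_old (p₂.mem_old (p₁.mem_old ?_))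
      obtain ⟨i, hi, hiu⟩ := hold
      exact ⟨i, by omega, by rw [hR.stack, hiu]⟩
  -- The reduction pushes 12 entries and removes at least one vertex of weight 13.
  · omega
  · omega

end ArrayLang

/-! ### Addresses and entries of the encoded adjacency lists -/

namespace AdjList

/-- The adjacency list of `u` as a list of natural numbers, empty if `u` is not a vertex. -/
def nbList {n : ℕ} (L : Fin n → List (Fin n)) (u : ℕ) : List ℕ :=
  if h : u < n then (L ⟨u, h⟩).map Fin.val else []

theorem nbList_of_lt {n : ℕ} (L : Fin n → List (Fin n)) {u : ℕ} (h : u < n) :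
    nbList L u = (L ⟨u, h⟩).map Fin.val := dif_pos h

theorem nbList_of_ge {n : ℕ} (L : Fin n → List (Fin n)) {u : ℕ} (h : ¬ u < n) :
    nbList L u = [] := dif_neg h

theorem start_zero {n : ℕ} (L : Fin n → List (Fin n)) : start L 0 = n + 2 := by
  simp [start]

theorem start_succ {n : ℕ} (L : Fin n → List (Fin n)) {v : ℕ} (hv : v < n) :
    start L (v + 1) = start L v + (nbList L v).length := by
  rw [start, start, List.take_add_one, nbList_of_lt L hv]
  simp [hv, add_assoc]

theorem start_eq_sum {n : ℕ} (L : Fin n → List (Fin n)) {v : ℕ} (hv : v ≤ n) :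
    start L v = n + 2 + ∑ u ∈ Finset.range v, (nbList L u).length := by
  induction v with
  | zero => simp [start_zero]
  | succ v ih => rw [start_succ L hv, ih (by omega), Finset.sum_range_succ, add_assoc]

theorem start_mono {n : ℕ} (L : Fin n → List (Fin n)) {v w : ℕ} (hvw : v ≤ w) (hw : w ≤ n) :
    start L v ≤ start L w := by
  rw [start_eq_sum L (hvw.trans hw), start_eq_sum L hw]
  have := Finset.sum_le_sum_of_subset (f := fun u => (nbList L u).length)
    (Finset.range_mono hvw)
  omega

theorem length_encode {n : ℕ} (L : Fin n → List (Fin n)) : (encode L).length = start L n := by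
  have : (List.ofFn L).take n = List.ofFn L := List.take_of_length_le (by simp)
  rw [start, this]
  simp only [encode, List.length_cons, List.length_append, List.length_map, List.length_range]
  omega

theorem encode_zero {n : ℕ} (L : Fin n → List (Fin n)) : (encode L).getD 0 0 = n := rfl

theorem encode_start {n : ℕ} (L : Fin n → List (Fin n)) {v : ℕ} (hv : v ≤ n) :
    (encode L).getD (v + 1) 0 = start L v := by
  rw [encode, List.getD_cons_succ, List.getD_append _ _ _ _ (by simp; omega)]
  have : v < n + 1 := by omega
  simp [this]

theorem encode_list {n : ℕ} (L : Fin n → List (Fin n)) {v j : ℕ} (hv : v < n)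
    (hj : j < (nbList L v).length) :
    (encode L).getD (start L v + j) 0 = (nbList L v)[j] := by
  have e1 : start L v + j = (n + 1 + (((List.ofFn L).take v).flatten.length + j)) + 1 := by
    rw [start]
    omega
  rw [e1, encode, List.getD_cons_succ, List.getD_append_right _ _ _ _ (by simp)]
  have e2 : (List.ofFn L).flatten = ((List.ofFn L).take v).flatten ++
      (L ⟨v, hv⟩ ++ ((List.ofFn L).drop (v + 1)).flatten) := by
    conv_lhs => rw [← List.take_append_drop v (List.ofFn L), List.flatten_append]
    rw [List.drop_eq_getElem_cons (by simpa using hv), List.flatten_cons]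
    simp
  have hj' : j < ((L ⟨v, hv⟩).map Fin.val).length := by rwa [nbList_of_lt L hv] at hj
  rw [e2, List.map_append, List.map_append, List.getD_append_right _ _ _ _ (by
      simp only [List.length_map, List.length_range]; omega)]
  have e3 : n + 1 + (((List.ofFn L).take v).flatten.length + j) -
      (List.map (start L) (List.range (n + 1))).length -
      (List.map Fin.val ((List.ofFn L).take v).flatten).length = j := by
    simp only [List.length_map, List.length_range]
    omega
  rw [e3, List.getD_append _ _ _ _ hj', List.getD_eq_getElem _ _ hj']
  simp only [nbList_of_lt L hv]

theorem nbList_lt {n : ℕ} (L : Fin n → List (Fin n)) {u w : ℕ} (hw : w ∈ nbList L u) : w < n := by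
  by_cases hu : u < n
  · rw [nbList_of_lt L hu] at hw
    obtain ⟨w, -, rfl⟩ := List.mem_map.1 hw
    exact w.2
  · simp [nbList_of_ge L hu] at hw

theorem Represents.nodup_nbList {n : ℕ} {L : Fin n → List (Fin n)} {G : SimpleGraph (Fin n)}
    (h : Represents L G) (u : ℕ) : (nbList L u).Nodup := by
  by_cases hu : u < n
  · rw [nbList_of_lt L hu]
    exact (h _).1.map Fin.val_injective
  · simp [nbList_of_ge L hu]

theorem Represents.mem_nbList {n : ℕ} {L : Fin n → List (Fin n)} {G : SimpleGraph (Fin n)}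
    (h : Represents L G) (u w : ℕ) :
    w ∈ nbList L u ↔ (G.map Fin.valEmbedding).Adj u w := by
  rw [SimpleGraph.map_adj]
  by_cases hu : u < n
  · rw [nbList_of_lt L hu, List.mem_map]
    constructor
    · rintro ⟨w, hw, rfl⟩
      exact ⟨_, _, ((h _).2 w).1 hw, rfl, rfl⟩
    · rintro ⟨u, w, huw, rfl, rfl⟩
      exact ⟨w, ((h _).2 w).2 huw, rfl⟩
  · simp only [nbList_of_ge L hu, List.not_mem_nil, false_iff]
    rintro ⟨u, w, huw, rfl, rfl⟩
    exact hu u.2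

theorem add_two_le_length_encode {n : ℕ} (L : Fin n → List (Fin n)) :
    n + 2 ≤ (encode L).length := by
  rw [length_encode, ← start_zero L]
  exact start_mono L (Nat.zero_le n) le_rfl

theorem encode_le {n : ℕ} (L : Fin n → List (Fin n)) (a : ℕ) :
    (encode L).getD a 0 ≤ (encode L).length := by
  have hn := add_two_le_length_encode L
  by_cases ha : a < (encode L).length
  · rw [List.getD_eq_getElem _ _ ha]
    have hmem := List.getElem_mem ha
    generalize (encode L)[a] = w at hmem
    rw [encode, List.mem_cons, List.mem_append, List.mem_map, List.mem_map] at hmem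
    rcases hmem with rfl | ⟨v, hv, rfl⟩ | ⟨v, -, rfl⟩
    · omega
    · rw [length_encode]
      exact start_mono L (by simpa [Nat.lt_succ_iff] using hv) le_rfl
    · have := v.2
      omega
  · rw [List.getD_eq_default _ _ (by omega)]
    omega

end AdjList

/-! ### Reading the adjacency lists -/

namespace ArrayLang

open D3 AdjList

theorem wp_put {E : Env} {f : Field} {r : Reg} {e : Ex} {Q : St → Prop} {h : St}
    (hs : e.Safe E h) (hQ : Q (h.setArr f (h.reg r) (e.val E h))) : wp E (.put f r e) Q h :=
  ⟨hs, hQ⟩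

/-- Record `x` as a neighbor of `v`. -/
def record : Pr := block
  [.ite (.eq (.arr .deg .v) (.const 0)) (.put .nb₁ .v (.reg .x))
      (.ite (.eq (.arr .deg .v) (.const 1)) (.put .nb₂ .v (.reg .x))
        (.ite (.eq (.arr .deg .v) (.const 2)) (.put .nb₃ .v (.reg .x)) .skip)),
    .put .deg .v (.add (.arr .deg .v) (.const 1)),
    .set .tmp (.add (.arr .sum .v) (.reg .x)), reduce, .put .sum .v (.reg .tmp)]

/-- The neighbors in `l` have been recorded for vertex `u`. -/
structure Recorded (n : ℕ) (h : St) (u : ℕ) (l : List ℕ) : Prop where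
  deg : h.arr .deg u = l.length
  nb₁ : h.arr .nb₁ u = l.getD 0 0
  nb₂ : h.arr .nb₂ u = l.getD 1 0
  nb₃ : h.arr .nb₃ u = l.getD 2 0
  sum : h.arr .sum u ≡ l.sum [MOD n]
  sum_lt : u < n → h.arr .sum u < n

theorem Recorded.of_eq {n : ℕ} {h h' : St} {u : ℕ} {l : List ℕ} (hr : Recorded n h u l)
    (he : ∀ f, f ≠ .stack → h'.arr f u = h.arr f u) : Recorded n h' u l := by
  obtain ⟨h1, h2, h3, h4, h5, h6⟩ := hr
  constructor <;> rw [he _ (by decide)] <;> assumption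

/-- The default 0 of `getD` agrees with the initially empty memory, so entries for neighbors not yet
read are correct from the start. -/
theorem wp_record {E : Env} {n : ℕ} {h : St} {l : List ℕ} (hn : h.reg .n = n) (hM : 2 * n < E.M)
    (hv : h.reg .v < n) (hx : h.reg .x < n) (hl : l.length + 1 < E.M)
    (hr : Recorded n h (h.reg .v) l) :
    wp E record (fun h' => (∀ r, r ≠ .tmp → h'.reg r = h.reg r) ∧
      (∀ i, h'.arr .stack i = h.arr .stack i) ∧
      (∀ f u, u ≠ h.reg .v → h'.arr f u = h.arr f u) ∧
      Recorded n h' (h.reg .v) (l ++ [h.reg .x])) h := by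
  have hs := hr.sum_lt hv
  -- The common end of the four branches, which treat the first, second, third and any later
  -- neighbor.
  have key : ∀ h₁ : St, (∀ r, h₁.reg r = h.reg r) → (∀ i, h₁.arr .stack i = h.arr .stack i) →
      (∀ f u, u ≠ h.reg .v → h₁.arr f u = h.arr f u) →
      h₁.arr .deg (h.reg .v) = h.arr .deg (h.reg .v) →
      h₁.arr .sum (h.reg .v) = h.arr .sum (h.reg .v) →
      h₁.arr .nb₁ (h.reg .v) = (l ++ [h.reg .x]).getD 0 0 →
      h₁.arr .nb₂ (h.reg .v) = (l ++ [h.reg .x]).getD 1 0 →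
      h₁.arr .nb₃ (h.reg .v) = (l ++ [h.reg .x]).getD 2 0 →
      wp E (block [.put .deg .v (.add (.arr .deg .v) (.const 1)),
        .set .tmp (.add (.arr .sum .v) (.reg .x)), reduce, .put .sum .v (.reg .tmp)])
        (fun h' => (∀ r, r ≠ .tmp → h'.reg r = h.reg r) ∧
        (∀ i, h'.arr .stack i = h.arr .stack i) ∧
        (∀ f u, u ≠ h.reg .v → h'.arr f u = h.arr f u) ∧
        Recorded n h' (h.reg .v) (l ++ [h.reg .x])) h₁ := by
    intro h₁ k1 k2 k3 k4 k5 k6 k7 k8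
    have kv := k1 .v
    have kx := k1 .x
    have kn := (k1 .n).trans hn
    have kd := k4.trans hr.deg
    refine wp_seq (wp_put ?_ (wp_seq (wp_set ?_ (wp_seq (wp_reduce (wp_seq
      (wp_put trivial (wp_nil ?_))))))))
    · simp [Ex.Safe, Ex.val, kv, kd]
      omega
    · simp [Ex.Safe, Ex.val, kv, kx, k5]
      omega
    · simp only [Ex.val, St.setReg_reg, St.setArr_reg, St.setReg_arr, St.setArr_arr, kv, kx, kn,
        k5, kd, reduceCtorEq, if_true, if_false, false_and]
      generalize ht : h.arr .sum (h.reg .v) + h.reg .x = t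
      have h1 := sub_mod_aux (n := n) (t := t)
      have h3 : (if t < n then t else t - n) < n := by split_ifs <;> omega
      generalize (if t < n then t else t - n) = t' at *
      refine ⟨fun r hr => by simp [hr, k1], fun i => by simp [k2], fun f u hu => by
        simp [hu, k3 f u hu], ?_⟩
      constructor
      · simp
      · simpa using k6
      · simpa using k7
      · simpa using k8
      · simp only [St.setArr_arr, and_self, if_true, List.sum_append, List.sum_singleton]
        refine h1.trans ?_
        rw [← ht]
        exact hr.sum.add_right _
      · simpa using fun _ => h3
  have e1 := hr.nb₁
  have e2 := hr.nb₂
  have e3 := hr.nb₃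
  refine wp_seq (wp_ite (by simp [Ex.Safe]) (fun h1 => wp_put trivial ?_) fun h1 =>
    wp_ite (by simp [Ex.Safe]) (fun h2 => wp_put trivial ?_) fun h2 =>
    wp_ite (by simp [Ex.Safe]) (fun h3 => wp_put trivial ?_) fun h3 => wp_skip ?_)
  · rw [eq_val] at h1
    simp only [Ex.val, hr.deg] at h1
    rw [List.length_eq_zero_iff] at h1
    subst h1
    refine key _ (fun _ => rfl) (fun i => by simp) (fun f u hu => by simp [hu]) (by simp) (by simp)
      ?_ ?_ ?_
    · simp [Ex.val]
    · simpa using e2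
    · simpa using e3
  · rw [eq_val] at h2
    simp only [Ex.val, hr.deg] at h2
    obtain ⟨a, rfl⟩ := List.length_eq_one_iff.1 h2
    refine key _ (fun _ => rfl) (fun i => by simp) (fun f u hu => by simp [hu]) (by simp) (by simp)
      ?_ ?_ ?_
    · simpa using e1
    · simp [Ex.val]
    · simpa using e3
  · rw [eq_val] at h3
    simp only [Ex.val, hr.deg] at h3
    obtain ⟨a, b, rfl⟩ := List.length_eq_two.1 h3
    refine key _ (fun _ => rfl) (fun i => by simp) (fun f u hu => by simp [hu]) (by simp) (by simp)
      ?_ ?_ ?_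
    · simpa using e1
    · simpa using e2
    · simp [Ex.val]
  · rw [eq_val'] at h1 h2 h3
    simp only [Ex.val, hr.deg] at h1 h2 h3
    have g : ∀ i < 3, (l ++ [h.reg .x]).getD i 0 = l.getD i 0 := fun i hi =>
      List.getD_append _ _ _ _ (by omega)
    apply key <;> simp only [implies_true, g _ (by norm_num : 0 < 3), g _ (by norm_num : 1 < 3),
      g _ (by norm_num : 2 < 3), e1, e2, e3]

/-- The body of the loop that reads the adjacency lists. -/
def readBody : Pr := block
  [.set .tmp (.add (.reg .v) (.const 2)),
    .ite (.lt (.reg .ptr) (.inp .tmp))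
      (block [.set .x (.inp .ptr), record, .set .ptr (.add (.reg .ptr) (.const 1))])
      (block [push .v, .set .v (.add (.reg .v) (.const 1))])]

/-- The invariant of the loop that reads the adjacency lists; `j` neighbors of the current vertex
have been read. -/
structure ReadInv {n : ℕ} (L : Fin n → List (Fin n)) (h : St) (j : ℕ) : Prop where
  reg_n : h.reg .n = n
  alive : h.reg .alive = n
  dsum : h.reg .dsum = ∑ u ∈ Finset.range n, (nbList L u).length
  v_le : h.reg .v ≤ n
  j_le : j ≤ (nbList L (h.reg .v)).length
  ptr : h.reg .ptr = start L (h.reg .v) + j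
  sp : h.reg .sp = h.reg .v
  stack : ∀ i < h.reg .v, h.arr .stack i = i
  recorded : ∀ u, Recorded n h u (if u < h.reg .v then nbList L u else
    if u = h.reg .v then (nbList L u).take j else [])

theorem wp_readBody {n : ℕ} {L : Fin n → List (Fin n)} {E : Env} {h : St} {j : ℕ}
    (hE : E.inp = fun a => (encode L).getD a 0) (hEN : E.N = (encode L).length)
    (hM : 20 * n + 20 < E.M) (hI : ReadInv L h j) (hv : h.reg .v < n) :
    wp E readBody (fun h' => (∃ j, ReadInv L h' j) ∧
      (n - h'.reg .v) + (E.N - h'.reg .ptr) < (n - h.reg .v) + (E.N - h.reg .ptr)) h := by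
  obtain ⟨h1, h2, h3, h4, h5, h6, h7, h8, h9⟩ := hI
  rw [length_encode] at hEN
  have hs := start_succ L hv
  have hle : start L (h.reg .v + 1) ≤ start L n := start_mono L (by omega) le_rfl
  have hn2 : n + 2 ≤ start L n := by
    rw [← start_zero L]
    exact start_mono L (Nat.zero_le n) le_rfl
  have hNM := E.N_lt
  -- Address 0 holds `n`, so the end of the list of `v`, which is the start of the next list, is at
  -- address `v + 2`.
  have hinp : E.inp (h.reg .v + 2) = start L (h.reg .v + 1) := by
    rw [hE]
    exact encode_start L (by omega)
  refine wp_seq (wp_set ?_ (wp_seq (wp_ite ?_ (fun hc => ?_) (fun hc => ?_))))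
  · simp [Ex.Safe, Ex.val]
    omega
  · simp [Ex.Safe, Ex.val]
    omega
  · simp [Ex.val, hinp] at hc
    have hj : j < (nbList L (h.reg .v)).length := by omega
    have hx : E.inp (h.reg .ptr) = (nbList L (h.reg .v))[j] := by
      rw [hE, h6]
      exact encode_list L hv hj
    have hxn : E.inp (h.reg .ptr) < n := by
      rw [hx]
      exact nbList_lt L (List.getElem_mem hj)
    refine wp_seq (wp_set ?_ (wp_seq ?_))
    · simp [Ex.Safe]
      omega
    have hr := h9 (h.reg .v)
    simp only [lt_irrefl, if_false, if_true] at hr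
    refine wp_mono (wp_record (n := n) (l := (nbList L (h.reg .v)).take j) ?_ (by omega) ?_ ?_
      ?_ ?_) ?_
    · simpa using h1
    · simpa using hv
    · simpa [Ex.val] using hxn
    · simp
      omega
    · simp only [St.setReg_reg, reduceCtorEq, if_false]
      exact hr.of_eq (fun f _ => rfl)
    · rintro h' ⟨r1, r2, r3, r4⟩
      simp only [Ex.val, St.setReg_reg, St.setReg_arr, reduceCtorEq, if_true, if_false] at r1 r2 r3 r4
      have q : ∀ r, r ≠ .tmp → r ≠ .x → h'.reg r = h.reg r := fun r e1 e2 => by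
        rw [r1 r e1, if_neg e2, if_neg e1]
      have q1 : h'.reg .ptr = h.reg .ptr := q _ (by decide) (by decide)
      have q2 : h'.reg .v = h.reg .v := q _ (by decide) (by decide)
      have q3 : h'.reg .n = h.reg .n := q _ (by decide) (by decide)
      have q4 : h'.reg .alive = h.reg .alive := q _ (by decide) (by decide)
      have q5 : h'.reg .dsum = h.reg .dsum := q _ (by decide) (by decide)
      have q6 : h'.reg .sp = h.reg .sp := q _ (by decide) (by decide)
      refine wp_seq (wp_set ?_ (wp_nil (wp_nil ⟨⟨j + 1, ?_⟩, ?_⟩)))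
      · simp [Ex.Safe, Ex.val, q1]
        omega
      · constructor
        · simpa [q3] using h1
        · simpa [q4] using h2
        · simpa [q5] using h3
        · simpa [q2] using h4
        · simpa [q2] using hj
        · simp [q1, q2, h6, Ex.val]
          omega
        · simpa [q6, q2] using h7
        · simpa [q2, r2] using h8
        · intro u
          simp only [St.setReg_reg, reduceCtorEq, if_false, q2]
          by_cases hu : u = h.reg .v
          · subst hu
            simp only [lt_irrefl, if_false, if_true]
            rw [List.take_add_one, List.getElem?_eq_getElem hj, Option.toList_some, ← hx]
            exact r4.of_eq (fun f _ => rfl)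
          · have := h9 u
            rw [if_neg hu] at this ⊢
            exact this.of_eq (fun f _ => r3 f u hu)
      · simp [q1, q2, Ex.val]
        omega
  · simp [Ex.val, hinp] at hc
    have hj : j = (nbList L (h.reg .v)).length := by omega
    rw [push]
    refine wp_seq (wp_seq (wp_put trivial (wp_seq (wp_set ?_ (wp_nil (wp_seq (wp_set ?_
      (wp_nil (wp_nil ⟨⟨0, ?_⟩, ?_⟩)))))))))
    · simp [Ex.Safe, Ex.val]
      omega
    · simp [Ex.Safe, Ex.val]
      omega
    · simp only [Ex.val, St.setReg_reg, St.setArr_reg, reduceCtorEq,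
        if_false]
      constructor
      · simpa using h1
      · simpa using h2
      · simpa using h3
      · simpa using hv
      · simp
      · simp [h6, hs, hj]
      · simpa using h7
      · intro i hi
        simp [h7] at hi ⊢
        split_ifs with e
        · exact e.symm
        · exact h8 i (by omega)
      · intro u
        have := h9 u
        simp only [St.setReg_reg, reduceCtorEq, if_false, if_true, List.take_zero, ite_self]
        refine Recorded.of_eq (h := h) ?_ fun f hf => by simp [hf]
        by_cases hu : u = h.reg .v
        · subst hu
          rw [if_pos (by omega)]
          rw [if_neg (by omega), if_pos rfl, hj, List.take_length] at this
          exact this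
        · by_cases hu' : u < h.reg .v
          · rw [if_pos (by omega)]
            rwa [if_pos hu'] at this
          · rw [if_neg (by omega)]
            rwa [if_neg hu', if_neg hu] at this
    · simp [Ex.val]
      omega

/-- After reading, the stack contains every vertex, in particular the active ones, and its height
`n` together with the weight `13 * n` gives the bound `14 * n`. -/
theorem ReadInv.inv {n : ℕ} {L : Fin n → List (Fin n)} {G : SimpleGraph (Fin n)} {h : St} {j : ℕ}
    (hL : Represents L G) (hI : ReadInv L h j) (hv : ¬ h.reg .v < n) :
    Inv n (G.map Fin.valEmbedding) h (G.map Fin.valEmbedding) (fun u => (nbList L u).toFinset)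
      (Finset.range n) := by
  obtain ⟨h1, h2, h3, h4, h5, h6, h7, h8, h9⟩ := hI
  have hvn : h.reg .v = n := by omega
  rw [hvn] at h7 h8
  have hr : ∀ u < n, Recorded n h u (nbList L u) := by
    intro u hu
    have := h9 u
    rwa [hvn, if_pos hu] at this
  have hc : ∀ u, (nbList L u).toFinset.card = (nbList L u).length := fun u =>
    List.toFinset_card_of_nodup (hL.nodup_nbList u)
  have hN : Nbhd (G.map Fin.valEmbedding) (fun u => (nbList L u).toFinset) := by
    intro u w
    rw [List.mem_toFinset, hL.mem_nbList]
  have hlt : ∀ u w, (G.map Fin.valEmbedding).Adj u w → u < n := by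
    intro u w huw
    obtain ⟨u, w, -, rfl, rfl⟩ := (SimpleGraph.map_adj _ _ _ _).1 huw
    exact u.2
  -- The default 0 is below `n` because `u` is.
  have hget : ∀ u i, u < n → (nbList L u).getD i 0 < n := by
    intro u i hu
    by_cases hi : i < (nbList L u).length
    · rw [List.getD_eq_getElem _ _ hi]
      exact nbList_lt L (List.getElem_mem hi)
    · rw [List.getD_eq_default _ _ (by omega)]
      omega
  refine ⟨⟨h1, hN, by simp [h2], by simp, ?_, ?_, ?_, ?_, ?_, ?_, ?_⟩, by rw [h2], ?_, ?_, ?_⟩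
  · exact fun u w huw => Finset.mem_range.2 (hlt u w huw)
  · simp only [h3, hc]
  · intro u hu
    rw [hc, (hr u hu).deg]
  · intro u hu hu3
    rw [hc] at hu3
    rw [(hr u hu).nb₁, (hr u hu).nb₂, (hr u hu).nb₃]
    obtain ⟨a, b, c, e⟩ := List.length_eq_three.1 hu3
    rw [e]
    simp
  · intro u hu _
    have := List.sum_toFinset id (hL.nodup_nbList u)
    simp only [id, List.map_id] at this
    rw [show ∑ w ∈ (nbList L u).toFinset, w = (nbList L u).sum from by simpa using this]
    exact (hr u hu).sum
  · rintro f (rfl | rfl | rfl) u hu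
    · rw [(hr u hu).nb₁]
      exact hget u _ hu
    · rw [(hr u hu).nb₂]
      exact hget u _ hu
    · rw [(hr u hu).nb₃]
      exact hget u _ hu
  · exact fun u hu => (hr u hu).sum_lt hu
  · intro i hi
    rw [h7] at hi
    rwa [h8 i hi]
  · intro u hu
    have hun : u < n := by
      obtain ⟨x, y, hc | hc⟩ := hu
      · exact hlt _ _ hc.adj_pq
      · exact hlt _ _ hc.adj_qr
    exact ⟨u, by omega, h8 u hun⟩
  · omega

end ArrayLang

/-! ### The complete program and its running time -/

namespace ArrayLang

open D3 AdjList

/-- Read the number of vertices and the sum of the degrees, and initialize the registers. -/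
def prep : Pr := block
  [.set .n (.inp .ptr), .set .tmp (.add (.reg .n) (.const 1)),
    .set .dsum (.sub (.inp .tmp) (.add (.reg .n) (.const 2))),
    .set .ptr (.add (.reg .n) (.const 2)), .set .alive (.reg .n)]

/-- Decide whether the graph that is left is complete on four vertices. -/
def finish : Pr :=
  .ite (.eq (.reg .alive) (.const 4))
    (.ite (.eq (.reg .dsum) (.const 12)) (.set .out (.const 1)) (.set .out (.const 0)))
    (.set .out (.const 0))

/-- There are too many edges. -/
def dense : Ex := .lt (.add (.add (.reg .n) (.reg .n)) (.add (.reg .n) (.reg .n))) (.reg .dsum)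

/-- The recognition program. -/
def recognize : Pr :=
  .seq prep (.ite dense (.set .out (.const 0))
    (.seq (.loop (.lt (.reg .v) (.reg .n)) readBody) (.seq (.loop (.reg .sp) mainBody) finish)))

/-- The initial state. -/
def St.zero : St := ⟨fun _ => 0, fun _ _ => 0⟩

/-- The environment for the adjacency lists `L`. -/
def env {n : ℕ} (L : Fin n → List (Fin n)) (W : ℕ) (hW : 1000 * (encode L).length ≤ W) : Env where
  inp a := (encode L).getD a 0
  N := (encode L).length
  M := 100 * (encode L).length
  W := W
  N_lt := by have := add_two_le_length_encode L; omega
  inp_lt a _ := by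
    have := add_two_le_length_encode L
    have := encode_le L a
    omega
  le_M := by have := add_two_le_length_encode L; omega
  le_W := by have := add_two_le_length_encode L; omega

/-- The arrays start right behind the input, where all cells are 0. -/
theorem rel_zero {n : ℕ} (L : Fin n → List (Fin n)) {W : ℕ} (hW : 1000 * (encode L).length ≤ W) :
    Rel (env L W hW) { RAM.init (encode L) with
      reg := Function.update (RAM.init (encode L)).reg 0 (encode L).length } St.zero where
  base := by exact Function.update_self 0 (encode L).length (RAM.init (encode L)).reg
  reg r := Function.update_of_ne r.idx_pos.ne' _ _
  arr f i := List.getD_eq_default _ _ (Nat.le_add_right _ _)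
  inp _ _ := rfl
  reg_lt _ := (Nat.zero_lt_of_lt (env L W hW).N_lt)
  arr_lt _ _ := (Nat.zero_lt_of_lt (env L W hW).N_lt)

/-- The last start address exceeds the total length of the lists by `n + 2`. The degree sum is thus
known in constant time, before any list is read. -/
theorem wp_prep {n : ℕ} (L : Fin n → List (Fin n)) {W : ℕ} (hW : 1000 * (encode L).length ≤ W) :
    wp (env L W hW) prep (fun h => ReadInv L h 0 ∧ h.reg .v = 0) St.zero := by
  have hN := add_two_le_length_encode L
  have h0 : (env L W hW).inp 0 = n := encode_zero L
  have h1 : (env L W hW).inp (n + 1) = start L n := encode_start L le_rfl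
  have hM : (env L W hW).M = 100 * (encode L).length := rfl
  have hNe : (env L W hW).N = (encode L).length := rfl
  have hs := start_eq_sum L le_rfl
  rw [prep]
  refine wp_seq (wp_set ?_ (wp_seq (wp_set ?_ (wp_seq (wp_set ?_ (wp_seq (wp_set ?_ (wp_seq
    (wp_set trivial (wp_nil ?_)))))))))) <;>
  simp only [Ex.Safe, Ex.val, St.zero, St.setReg_reg, reduceCtorEq, if_true,
    if_false, h0, h1, hM, hNe]
  · omega
  · and_intros <;> first | trivial | omega
  · and_intros <;> first | trivial | omega
  · and_intros <;> first | trivial | omega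
  · refine ⟨?_, ?_⟩
    · constructor <;> simp only [St.setReg_reg, St.setReg_arr, reduceCtorEq, if_true, if_false]
      · omega
      · omega
      · omega
      · rw [start_zero]
      · simp
      · intro u
        simp only [Nat.not_lt_zero, if_false, List.take_zero, ite_self]
        constructor
        · rfl
        · rfl
        · rfl
        · rfl
        · rfl
        · intro hu
          exact Nat.zero_lt_of_lt hu
    · simp

/-- Without active vertices only the base case of `CRed` is possible, and four vertices with degree
sum 12 form a $K_4$. -/
theorem cRed_iff_of_not_active {n k : ℕ} {G : SimpleGraph ℕ} {F : ℕ → Finset ℕ} {A : Finset ℕ}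
    (hF : Nbhd G F) (hA : A.card = k) (hlt : ∀ u ∈ A, u < n) (hmem : ∀ u w, G.Adj u w → u ∈ A)
    (h : ∀ u, ¬ Active G u) :
    CRed G k ↔ k = 4 ∧ ∑ u ∈ Finset.range n, (F u).card = 12 := by
  constructor
  · intro hc
    cases hc with
    | base hK => exact ⟨rfl, hK.sum_card hF fun u w huw => hlt u (hmem u w huw)⟩
    | stepA p q r hp _ => exact (h p ⟨q, r, .inl hp⟩).elim
    | stepB p q r hq _ => exact (h q ⟨p, r, .inr hq⟩).elim
  · rintro ⟨rfl, hs⟩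
    exact .base (isK4_of_sum_card hA hF hmem hlt hs)

/-- The output tells whether `P` holds. -/
def Answer (P : Prop) (h : St) : Prop := (P → h.reg .out = 1) ∧ (¬ P → h.reg .out = 0)

theorem wp_finish {E : Env} {n : ℕ} {h : St} {G₀ G : SimpleGraph ℕ} {F : ℕ → Finset ℕ}
    {A : Finset ℕ} (hI : Inv n G₀ h G F A) (hsp : h.reg .sp = 0) :
    wp E finish (Answer (CRed G₀ n)) h := by
  have hg := hI.good
  have := cRed_iff_of_not_active hg.nbhd hg.card hg.lt hg.mem (fun u hu => by
    obtain ⟨i, hi, -⟩ := hI.active u hu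
    omega)
  rw [← hg.dsum] at this
  have hiff := hI.cRed.trans this
  refine wp_ite (by simp [Ex.Safe]) (fun h1 => wp_ite (by simp [Ex.Safe])
    (fun h2 => wp_set (by simp [Ex.Safe]) ?_) fun h2 => wp_set (by simp [Ex.Safe]) ?_)
    fun h1 => wp_set (by simp [Ex.Safe]) ?_
  · rw [eq_val] at h1 h2
    exact ⟨fun _ => by simp [Ex.val], fun hn => (hn (hiff.2 ⟨h1, h2⟩)).elim⟩
  · rw [eq_val'] at h2
    exact ⟨fun hc => (h2 (hiff.1 hc).2).elim, fun _ => by simp [Ex.val]⟩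
  · rw [eq_val'] at h1
    exact ⟨fun hc => (h1 (hiff.1 hc).1).elim, fun _ => by simp [Ex.val]⟩

/-- The time for one iteration of the loop that reads the input. -/
def readTime : ℕ := (Ex.lt (.reg .v) (.reg .n)).compile.cost + 1 + readBody.cost

/-- The time for one iteration of the loop that makes the reductions. -/
def mainTime : ℕ := (Ex.reg .sp).compile.cost + 1 + mainBody.cost

theorem triple_read {n : ℕ} (L : Fin n → List (Fin n)) {W : ℕ}
    (hW : 1000 * (encode L).length ≤ W) :
    Triple (env L W hW)
      (fun h => (ReadInv L h 0 ∧ h.reg .v = 0) ∧ h.reg .dsum ≤ 4 * n)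
      (.loop (.lt (.reg .v) (.reg .n)) readBody) ((5 * n + 1) * readTime)
      (fun h => (∃ j, ReadInv L h j) ∧ ¬ h.reg .v < n) := by
  have hN := add_two_le_length_encode L
  have hM : (env L W hW).M = 100 * (encode L).length := rfl
  have hNe : (env L W hW).N = (encode L).length := rfl
  refine (Triple.loop (I := fun h => ∃ j, ReadInv L h j)
    -- Each round advances either the vertex or the read pointer; there are `n` vertices and at most
    -- `4 * n` list entries.
    (fun h => (n - h.reg .v) + ((env L W hW).N - h.reg .ptr)) (5 * n) ?_ ?_).conseq ?_ le_rfl ?_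
  · exact fun h _ => ⟨trivial, trivial⟩
  · rintro h ⟨j, hj⟩ hv
    refine wp_readBody rfl rfl (by omega) hj ?_
    simpa [Ex.val, hj.reg_n] using hv
  · rintro h ⟨⟨hI, hv⟩, hd⟩
    refine ⟨⟨0, hI⟩, ?_⟩
    have h1 := hI.dsum
    have h2 := hI.ptr
    rw [hv, start_zero] at h2
    have h3 := length_encode L
    rw [start_eq_sum L le_rfl] at h3
    omega
  · rintro h ⟨⟨j, hj⟩, hv⟩
    refine ⟨⟨j, hj⟩, ?_⟩
    simpa [Ex.val, hj.reg_n] using hv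

theorem triple_main {E : Env} {n : ℕ} {G₀ : SimpleGraph ℕ} (hM : 20 * n + 20 < E.M) :
    Triple E (fun h => ∃ G F A, Inv n G₀ h G F A) (.loop (.reg .sp) mainBody)
      ((14 * n + 1) * mainTime) (fun h => (∃ G F A, Inv n G₀ h G F A) ∧ h.reg .sp = 0) := by
  refine (Triple.loop (I := fun h => ∃ G F A, Inv n G₀ h G F A)
    (fun h => h.reg .sp + 13 * h.reg .alive) (14 * n) ?_ ?_).conseq ?_ le_rfl ?_
  · exact fun h _ => trivial
  · rintro h ⟨G, F, A, hI⟩ hsp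
    exact wp_mainBody hM hI hsp
  · rintro h ⟨G, F, A, hI⟩
    exact ⟨⟨G, F, A, hI⟩, hI.bound⟩
  · exact fun h hh => hh

theorem triple_recognize {n : ℕ} {L : Fin n → List (Fin n)} {G : SimpleGraph (Fin n)}
    (hL : Represents L G) {W : ℕ} (hW : 1000 * (encode L).length ≤ W) :
    Triple (env L W hW) (fun h => h = St.zero) recognize
      (prep.cost + (dense.compile.cost + 1 +
        ((Pr.set .out (.const 0)).cost + ((5 * n + 1) * readTime +
          ((14 * n + 1) * mainTime + finish.cost)))))
      (Answer (CRed (G.map Fin.valEmbedding) n)) := by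
  have hN := add_two_le_length_encode L
  have hM : (env L W hW).M = 100 * (encode L).length := rfl
  have hdense : ∀ h, ReadInv L h 0 →
      (dense.val (env L W hW) h ≠ 0 ↔ 4 * n < h.reg .dsum) := by
    intro h hI
    simp only [dense, Ex.val, hI.reg_n]
    split_ifs <;> omega
  refine (Triple.of_wp ?_).seq (Triple.ite (P := fun h => ReadInv L h 0 ∧ h.reg .v = 0) ?_
    ((Triple.of_wp ?_).conseq (fun _ h => h) (Nat.le_add_right _ _) fun _ h => h)
    ((((triple_read L hW).conseq ?_ le_rfl ?_).seq
      ((triple_main (n := n) (G₀ := G.map Fin.valEmbedding) (by omega)).seq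
        (Triple.of_wp ?_))).conseq (fun _ h => h) (Nat.le_add_left _ _) fun _ h => h))
  · rintro h rfl
    exact wp_prep L hW
  · rintro h ⟨hI, -⟩
    simp only [dense, Ex.Safe, Ex.val, hI.reg_n, hM]
    and_intros <;> first | trivial | omega
  · rintro h ⟨⟨hI, -⟩, hd⟩
    rw [hdense h hI] at hd
    -- Output 0 is right here, since a reducible graph has degree sum at most `4 * n`.
    refine wp_set (by simp [Ex.Safe]) ⟨fun hc => ?_, fun _ => by simp [Ex.val]⟩
    have hF : Nbhd (G.map Fin.valEmbedding) (fun u => (nbList L u).toFinset) := by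
      intro u w
      rw [List.mem_toFinset, hL.mem_nbList]
    have := (hc.sum_card_le (n := n) hF fun u w huw => by
      obtain ⟨u, w, -, rfl, rfl⟩ := (SimpleGraph.map_adj _ _ _ _).1 huw
      exact u.2).2
    simp only [List.toFinset_card_of_nodup (hL.nodup_nbList _), ← hI.dsum] at this
    omega
  · rintro h ⟨hI, hd⟩
    refine ⟨hI, ?_⟩
    by_contra hlt
    exact (hdense h hI.1).2 (by omega) hd
  · rintro h ⟨⟨j, hj⟩, hv⟩
    exact ⟨_, _, _, hj.inv hL hv⟩
  · rintro h ⟨⟨G', F, A, hI⟩, hsp⟩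
    exact wp_finish hI hsp

theorem emb_val {n : ℕ} (G : SimpleGraph (Fin n)) :
    Emb (Fin.val : Fin n → ℕ) G (G.map Fin.valEmbedding) where
  inj := Fin.val_injective
  adj u v := SimpleGraph.map_adj_apply (f := Fin.valEmbedding)
  range u v h := by
    obtain ⟨u, v, -, rfl, rfl⟩ := (SimpleGraph.map_adj _ _ _ _).1 h
    exact ⟨u, rfl⟩

/-- The machine program: the length of the input is the last of the start addresses. -/
def machineProg : RAM.Prog :=
  .seq (.assign 0 (.load (.add (.load (.const 0)) (.const 1))))
    (.seq recognize.compile (.assign 0 (.reg Reg.out.idx)))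

/-- The time bound of the machine program, per vertex. -/
def timeBound : ℕ :=
  1000 + prep.cost + dense.compile.cost + (Pr.set .out (.const 0)).cost + 5 * readTime +
    14 * mainTime + finish.cost

theorem exec_machineProg {n : ℕ} {G : SimpleGraph (Fin n)} {L : Fin n → List (Fin n)}
    (hL : Represents L G) {W : ℕ} (hW : 1000 * (encode L).length ≤ W) :
    ∃ (t : ℕ) (τ : RAM.State), RAM.Exec W machineProg (RAM.init (encode L)) t τ ∧
      t ≤ timeBound * (n + 1) ∧ (Reducible G → τ.reg 0 = 1) ∧ (¬ Reducible G → τ.reg 0 = 0) := by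
  have hN := add_two_le_length_encode L
  have hred : Reducible G ↔ CRed (G.map Fin.valEmbedding) n := by
    simpa using reducible_iff_cRed (emb_val G)
  have h0 : (encode L).getD 0 0 = n := encode_zero L
  have h1 : (encode L).getD (n + 1) 0 = (encode L).length := by
    rw [encode_start L le_rfl, length_encode]
  have hfit : (RAM.Expr.load (.add (.load (.const 0)) (.const 1))).Fits W
      (RAM.init (encode L)) := by
    simp only [RAM.Expr.Fits, RAM.Expr.val, RAM.init, h0, h1]
    and_intros <;> omega
  have hval : (RAM.Expr.load (.add (.load (.const 0)) (.const 1))).val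
      (RAM.init (encode L)) = (encode L).length := by
    simp only [RAM.Expr.val, RAM.init, h0, h1]
  obtain ⟨t, τ, h, hex, ht, hrel, hans⟩ :=
    triple_recognize hL hW _ _ (rel_zero L hW) rfl
  have hout := hrel.reg_lt .out
  have hle := (env L W hW).le_W
  have hfit' : (RAM.Expr.reg Reg.out.idx).Fits W τ := by
    simp only [RAM.Expr.Fits, hrel.reg]
    exact lt_of_lt_of_le hout (le_trans (by omega) hle)
  have hfirst := RAM.Exec.assign (W := W) 0 _ _ hfit
  rw [hval] at hfirst
  refine ⟨_, _, .seq hfirst (.seq hex (.assign 0 _ _ hfit')), ?_, ?_⟩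
  · rw [timeBound]
    simp only [RAM.Expr.cost]
    generalize prep.cost = a at *
    generalize dense.compile.cost = b at *
    generalize (Pr.set .out (.const 0)).cost = c at *
    generalize finish.cost = d at *
    generalize readTime = e at *
    generalize mainTime = f at *
    nlinarith [Nat.zero_le (n * a), Nat.zero_le (n * b), Nat.zero_le (n * c), Nat.zero_le (n * d)]
  · simp only [RAM.Expr.val, Function.update_self, hrel.reg, hred]
    exact hans

end ArrayLang

theorem mainTheorem2 :
    ∃ (prog : RAM.Prog) (c : ℕ),
      ∀ (n : ℕ) (G : SimpleGraph (Fin n)) (L : Fin n → List (Fin n)),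
        AdjList.Represents L G →
        ∀ W : ℕ, c * (AdjList.encode L).length ≤ W →
          ∃ (t : ℕ) (τ : RAM.State),
            RAM.Exec W prog (RAM.init (AdjList.encode L)) t τ ∧
            t ≤ c * (n + 1) ∧
            (D3.Reducible G → τ.reg 0 = 1) ∧
            (¬ D3.Reducible G → τ.reg 0 = 0) := by
  refine ⟨ArrayLang.machineProg, ArrayLang.timeBound, fun n G L hL W hW =>
    ArrayLang.exec_machineProg hL (le_trans (Nat.mul_le_mul_right _ ?_) hW)⟩
  -- One constant bounds both time and word size; its summand 1000 provides the word size required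
  -- by `exec_machineProg`.
  rw [ArrayLang.timeBound]
  omega
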